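/- **Setting.** Let $\theta=\frac{1+\sqrt7\,i}{2}$ and let $\mathcal O\subset \mathrm{SL}_3(\mathbb C)$ be the group of the $24$ signed permutation matrices of determinant $1$ (the rotations of the cube with vertices $(\pm1,\pm1,\pm1)$). Put $$Q=\frac12\begin{pmatrix}1&1&-\theta\\1&1&\theta\\1-\theta&\theta-1&0\end{pmatrix},\qquad M=\begin{pmatrix}2&0&\kappa\\1&\sqrt3&-\kappa\\-1&\sqrt3&\kappa\end{pmatrix},\qquad \kappa=\frac{5-3\theta}{2}.$$ The group $\langle \mathcal O,Q\rangle$ acts on $\mathbb{CP}^2$ in coordinates $x$; in the coordinates $y$ given by $x=My$ it becomes $M^{-1}\langle \mathcal O,Q\rangle M$. Let $K_{168}\subset\mathrm{PGL}_3(\mathbb C)$ be the image of this last group; it is Klein's simple group of order $168$. A *reflection line* is a line of $\mathbb{CP}^2$ that is fixed pointwise by an involution in $K_{168}$. A *holomorphic map* $f:\mathbb{CP}^2\to\mathbb{CP}^2$ is a map $f=[P_1:P_2:P_3]$ given by three homogeneous polynomials of the same degree with no common zero in $\mathbb C^3\setminus\{0\}$. It is *$K_{168}$-equivariant* if $f(Tp)=Tf(p)$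 for all $T\in K_{168}$ and $p\in\mathbb{CP}^2$. It is *doubly critical exactly at the reflection lines* if the critical set $\{\det J(P)=0\}$, where $J(P)=(\partial P_i/\partial y_j)$, is the union of the reflection lines and every linear form that defines a reflection line divides $\det J(P)$ with multiplicity exactly $2$. Define $$F=3(y_1^4+y_2^4)-49y_3^4-14y_1^3y_3+6y_1^2y_2^2-21(y_1^2+y_2^2)y_3^2+42y_1y_2^2y_3,$$ $$\Phi=-\frac1{1512}\det H(F),\qquad \Psi=-\frac1{9072}\det\begin{pmatrix}H(F)&\nabla\Phi\\ (\nabla\Phi)^T&0\end{pmatrix},$$ where $H(F)$ is the Hessian matrix of $F$; these have degrees $4,6,14$. Let $g_9=(a_1,a_2,a_3)$ and $g_{11}=(b_1,b_2,b_3)$, where $$a_1=27y_1^9 + 336y_1^8y_3 - 4428y_1^7y_2^2 + 308y_1^7y_3^2 - 14700y_1^6y_3^3 - 10920y_1^6y_2^2y_3 - 13446y_1^5y_2^4 - 151851y_1^5y_3^4 + 18564y_1^5y_2^2y_3^2 - 149548y_1^4y_3^5 - 192864y_1^4y_2^2y_3^3 + 33600y_1^4y_2^4y_3 - 5436y_1^3y_2^6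 - 8232y_1^3y_3^6 - 44394y_1^3y_2^2y_3^4 - 116676y_1^3y_2^4y_3^2 + 605052y_1^2y_3^7 - 329280y_1^2y_2^2y_3^5 - 104076y_1^2y_2^4y_3^3 - 11592y_1^2y_2^6y_3 + 3555y_1y_2^8 - 261709y_1y_3^8 - 8232y_1y_2^2y_3^6 - 238287y_1y_2^4y_3^4 + 37548y_1y_2^6y_3^2 - 605052y_2^2y_3^7 + 259308y_2^4y_3^5 + 74088y_2^6y_3^3$$ $$a_2=-y_2(4509y_1^8 + 4956y_1^7y_3 - 1620y_1^6y_2^2 + 39382y_1^6y_3^2 - 207564y_1^5y_3^3 - 22596y_1^5y_2^2y_3 - 7722y_1^4y_2^4 + 22197y_1^4y_3^4 - 111174y_1^4y_2^2y_3^2 - 628376y_1^3y_3^5 - 177576y_1^3y_2^2y_3^3 + 24612y_1^3y_2^4y_3 - 612y_1^2y_2^6 + 8232y_1^2y_3^6 + 476574y_1^2y_2^2y_3^4 + 24066y_1^2y_2^4y_3^2 + 1210104y_1y_3^7 - 189336y_1y_2^2y_3^5 + 29988y_1y_2^4y_3^3 - 4284y_1y_2^6y_3 + 981y_2^8 + 261709y_3^8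 + 8232y_2^2y_3^6 + 108633y_2^4y_3^4 + 2142y_2^6y_3^2)$$ $$a_3=224y_1^9 + 2547y_1^8y_3 - 2016y_1^7y_2^2 + 9156y_1^7y_3^2 + 7952y_1^6y_3^3 + 19260y_1^6y_2^2y_3 + 6048y_1^5y_2^4 - 57918y_1^5y_3^4 - 9156y_1^5y_2^2y_3^2 + 150675y_1^4y_3^5 - 43176y_1^4y_2^2y_3^3 + 18306y_1^4y_2^4y_3 - 6048y_1^3y_2^6 - 48706y_1^3y_3^6 + 115836y_1^3y_2^2y_3^4 - 45780y_1^3y_2^4y_3^2 - 51450y_1^2y_3^7 + 301350y_1^2y_2^2y_3^5 + 68544y_1^2y_2^4y_3^3 + 5148y_1^2y_2^6y_3 + 146118y_1y_2^2y_3^6 + 173754y_1y_2^4y_3^4 - 27468y_1y_2^6y_3^2 + 7203y_3^9 - 51450y_2^2y_3^7 + 150675y_2^4y_3^5 + 504y_2^6y_3^3 + 3555y_2^8y_3$$ $$b_1=-1334y_1^{11} - 2534y_1^{10}y_3 - 63034y_1^9y_2^2 + 47355y_1^9y_3^2 + 542136y_1^8y_3^3 + 45864y_1^8y_2^2y_3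 - 88716y_1^7y_2^4 + 1184232y_1^7y_3^4 - 551460y_1^7y_2^2y_3^2 - 312816y_1^6y_3^5 + 2446080y_1^6y_2^2y_3^3 - 308196y_1^6y_2^4y_3 - 114084y_1^5y_2^6 - 4519368y_1^5y_3^6 - 6856668y_1^5y_2^2y_3^4 + 735714y_1^5y_2^4y_3^2 + 432180y_1^4y_3^7 + 625632y_1^4y_2^2y_3^5 - 446880y_1^4y_2^4y_3^3 + 634536y_1^4y_2^6y_3 + 18306y_1^3y_2^8 - 11503191y_1^3y_3^8 + 4272408y_1^3y_2^2y_3^6 + 4515840y_1^3y_2^4y_3^4 + 1066716y_1^3y_2^6y_3^2 + 5176556y_1^2y_3^9 + 18670176y_1^2y_2^2y_3^7 + 938448y_1^2y_2^4y_3^5 - 268128y_1^2y_2^6y_3^3 - 162918y_1^2y_2^8y_3 + 5022y_1y_2^{10} + 9311078y_1y_3^{10} - 11503191y_1y_2^2y_3^8 - 8956416y_1y_2^4y_3^6 + 2019780y_1y_2^6y_3^4 - 267813y_1y_2^8y_3^2 - 5176556y_2^2y_3^9 - 6655572y_2^4y_3^7 - 814968y_2^8y_3^3$$ $$b_2=y_2(-17294y_1^{10}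 - 60746y_1^9y_3 - 36546y_1^8y_2^2 + 309309y_1^8y_3^2 - 1631112y_1^7y_3^3 + 356328y_1^7y_2^2y_3 - 77628y_1^6y_2^4 - 1056930y_1^6y_3^4 - 900732y_1^6y_2^2y_3^2 - 312816y_1^5y_3^5 - 5794152y_1^5y_2^2y_3^3 - 579852y_1^5y_2^4y_3 + 52236y_1^4y_2^6 + 2136204y_1^4y_3^6 - 1627290y_1^4y_2^2y_3^4 - 486738y_1^4y_2^4y_3^2 - 19534536y_1^3y_3^7 + 625632y_1^3y_2^2y_3^5 - 2348472y_1^3y_2^4y_3^3 + 168840y_1^3y_2^6y_3 + 1674y_1^2y_2^8 - 11503191y_1^2y_3^8 - 17912832y_1^2y_2^2y_3^6 + 9745218y_1^2y_2^4y_3^4 + 717444y_1^2y_2^6y_3^2 - 10353112y_1y_3^9 + 5359032y_1y_2^2y_3^7 + 938448y_1y_2^4y_3^5 - 1083096y_1y_2^6y_3^3 + 11718y_1y_2^8y_3 - 8586y_2^{10} + 9311078y_3^{10} - 11503191y_2^2y_3^8 - 2300844y_2^4y_3^6 - 221382y_2^6y_3^4 - 5859y_2^8y_3^2)$$ $$b_3=-(2464y_1^{11}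 + 8670y_1^{10}y_3 - 19712y_1^9y_2^2 + 26250y_1^9y_3^2 - 196119y_1^8y_3^3 - 79878y_1^8y_2^2y_3 + 44352y_1^7y_2^4 - 89376y_1^7y_3^4 - 201096y_1^7y_2^2y_3^2 - 1953924y_1^6y_3^5 - 276444y_1^6y_2^2y_3^3 - 77604y_1^6y_2^4y_3 + 1422078y_1^5y_3^6 + 89376y_1^5y_2^2y_3^4 + 579852y_1^5y_2^4y_3^2 + 1825446y_1^4y_3^7 - 6454476y_1^4y_2^2y_3^5 - 1007370y_1^4y_2^4y_3^3 + 114084y_1^4y_2^6y_3 - 66528y_1^3y_2^8 - 5978490y_1^3y_3^8 - 2844156y_1^3y_2^2y_3^6 + 446880y_1^3y_2^4y_3^4 - 634536y_1^3y_2^6y_3^2 + 4477865y_1^2y_3^9 + 3650892y_1^2y_2^2y_3^7 - 5466636y_1^2y_2^4y_3^5 - 1066716y_1^2y_2^6y_3^3 + 98118y_1^2y_2^8y_3 + 17935470y_1y_2^2y_3^8 - 4266234y_1y_2^4y_3^6 + 268128y_1y_2^6y_3^4 - 11718y_1y_2^8y_3^2 + 100842y_3^{11} + 4477865y_2^2y_3^9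 + 1825446y_2^4y_3^7 - 2019780y_2^6y_3^5 - 139671y_2^8y_3^3 - 5022y_2^{10}y_3)$$ **Theorem.** There are exactly $21$ reflection lines. The formula $$h=\Bigl(\frac{827}{14}F^2\Phi+\frac{99}{49}\Psi\Bigr)\cdot\mathrm{id}+\frac{11}{98}\,\Phi\cdot g_9+\frac{9}{49}\,F\cdot g_{11}$$ defines a holomorphic map $h:\mathbb{CP}^2\to\mathbb{CP}^2$ of degree $15$. This map is $K_{168}$-equivariant and doubly critical exactly at the $21$ reflection lines, and it is the only holomorphic $K_{168}$-equivariant map of $\mathbb{CP}^2$ (of any degree) that is doubly critical exactly at the $21$ reflection lines. -/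

import Mathlib

open scoped LinearAlgebra.Projectivization MatrixGroups Matrix

namespace KleinHeptic

noncomputable section

/-- The complex projective plane. -/
abbrev CP2 : Type := ℙ ℂ (Fin 3 → ℂ)

/-- Polynomials in the three homogeneous coordinates. -/
abbrev Poly3 : Type := MvPolynomial (Fin 3) ℂ

/-! ### Klein's group -/

/-- `θ = (1 + √7 i) / 2`. -/
def theta : ℂ := (1 + (Real.sqrt 7 : ℂ) * Complex.I) / 2

theorem theta_sq : theta ^ 2 = theta - 2 := by
  have h7 : ((Real.sqrt 7 : ℝ) : ℂ) ^ 2 = 7 := by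
    rw [← Complex.ofReal_pow, Real.sq_sqrt (by norm_num)]; norm_num
  have hI := Complex.I_sq
  unfold theta
  linear_combination (Complex.I ^ 2 / 4) * h7 + (7 / 4) * hI

/-- The octahedral rotation matrices: the signed permutation matrices of determinant `1`, that is,
the rotations of the cube with vertices `(±1, ±1, ±1)`. -/
def octahedralMatrices : Set (Matrix (Fin 3) (Fin 3) ℂ) :=
  {A | A.det = 1 ∧ ∃ (σ : Equiv.Perm (Fin 3)) (ε : Fin 3 → ℤˣ),
    A = Matrix.of fun i j => if σ j = i then (((ε j : ℤˣ) : ℤ) : ℂ) else 0}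

/-- The matrix `Q` of the additional generator of order four. -/
def matrixQ : Matrix (Fin 3) (Fin 3) ℂ :=
  (1 / 2 : ℂ) • !![1, 1, -theta; 1, 1, theta; 1 - theta, theta - 1, 0]

theorem matrixQ_det : matrixQ.det = 1 := by
  have h := theta_sq
  simp only [matrixQ, Matrix.det_smul, Matrix.det_fin_three, Fintype.card_fin]
  simp
  linear_combination (-1 / 2 : ℂ) * h

/-- The linear group of order 168, in the octahedral coordinates `x`: it is generated by the
octahedral rotations and by `Q`. -/
def linearGroupX : Subgroup (GL (Fin 3) ℂ) :=
  Subgroup.closure {g | (g : Matrix (Fin 3) (Fin 3) ℂ) ∈ octahedralMatrices ∨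
    (g : Matrix (Fin 3) (Fin 3) ℂ) = matrixQ}

/-- The matrix `M` of the change of coordinates `x = M y`. -/
def matrixM : Matrix (Fin 3) (Fin 3) ℂ :=
  !![2, 0, (5 - 3 * theta) / 2;
     1, (Real.sqrt 3 : ℂ), -((5 - 3 * theta) / 2);
     -1, (Real.sqrt 3 : ℂ), (5 - 3 * theta) / 2]

theorem matrixM_det_ne_zero : matrixM.det ≠ 0 := by
  have h3 : (Real.sqrt 3 : ℂ) ≠ 0 := by
    exact_mod_cast (Real.sqrt_pos.mpr (by norm_num : (0 : ℝ) < 3)).ne'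
  have hk : 5 - 3 * theta ≠ 0 := by
    intro h
    have ht : theta = 5 / 3 := by linear_combination (-1 / 3 : ℂ) * h
    have := theta_sq
    rw [ht] at this
    norm_num at this
  have hd : matrixM.det = 3 * (Real.sqrt 3 : ℂ) * (5 - 3 * theta) := by
    simp [matrixM, Matrix.det_fin_three]
    ring
  rw [hd]
  exact mul_ne_zero (mul_ne_zero (by norm_num) h3) hk

/-- The change of coordinates as an invertible matrix. -/
def coordChange : GL (Fin 3) ℂ :=
  Matrix.GeneralLinearGroup.mkOfDetNeZero matrixM matrixM_det_ne_zero

/-- The linear group of order 168 in the coordinates `y`: the matrices `g` for which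
`M g M⁻¹` belongs to the group in the coordinates `x`. -/
def linearGroup : Subgroup (GL (Fin 3) ℂ) :=
  linearGroupX.comap (MulAut.conj coordChange).toMonoidHom

/-- The projective group `K₁₆₈`, acting on the projective plane in the coordinates `y`. -/
def K168 : Subgroup PGL(3, ℂ) := linearGroup.map Matrix.ProjGenLinGroup.mk

/-! ### Reflection lines -/

/-- The projective line with equation `a₁ y₁ + a₂ y₂ + a₃ y₃ = 0`. -/
def projLine (a : Fin 3 → ℂ) : Set CP2 := {p | a ⬝ᵥ p.rep = 0}

/-- The linear form `a` defines a reflection line: a line fixed pointwise by an involution that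
belongs to `K₁₆₈`. -/
def IsReflectionForm (a : Fin 3 → ℂ) : Prop :=
  a ≠ 0 ∧ ∃ T ∈ K168, T ≠ 1 ∧ T * T = 1 ∧ ∀ p ∈ projLine a, T • p = p

/-- The set of all reflection lines. -/
def reflectionLines : Set (Set CP2) := {L | ∃ a, IsReflectionForm a ∧ L = projLine a}

/-- The linear form with coefficient vector `a`, as a polynomial. -/
def linearForm (a : Fin 3 → ℂ) : Poly3 := ∑ i, MvPolynomial.C (a i) * MvPolynomial.X i

/-! ### Holomorphic maps of the projective plane -/

/-- `P` is a homogeneous polynomial lift of degree `d` of `f : CP2 → CP2`: the three components of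
`P` are homogeneous of degree `d`, have no common zero other than the origin, and
`f [v] = [P v]` for all `v ≠ 0`. -/
def IsLift (d : ℕ) (P : Fin 3 → Poly3) (f : CP2 → CP2) : Prop :=
  (∀ i, (P i).IsHomogeneous d) ∧
    ∀ (v : Fin 3 → ℂ) (hv : v ≠ 0), ∃ hP : (fun i => MvPolynomial.eval v (P i)) ≠ 0,
      f (Projectivization.mk ℂ v hv) =
        Projectivization.mk ℂ (fun i => MvPolynomial.eval v (P i)) hP

/-- Holomorphic self-maps of the projective plane: the maps given in homogeneous coordinates by
three homogeneous polynomials of the same degree without common zeros. -/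
def IsHolomorphicMap (f : CP2 → CP2) : Prop := ∃ d P, IsLift d P f

/-- `f` commutes with the action of `K₁₆₈`. -/
def IsEquivariant (f : CP2 → CP2) : Prop := ∀ T ∈ K168, ∀ p : CP2, f (T • p) = T • f p

/-- The determinant of the Jacobian matrix of `P`. -/
def jacobianDet (P : Fin 3 → Poly3) : Poly3 :=
  (Matrix.of fun i j => MvPolynomial.pderiv j (P i)).det

/-- `f` is doubly critical exactly at the reflection lines: the critical set, which is the zero set
of the Jacobian determinant of a homogeneous lift, is the union of the reflection lines, and each
of these lines has multiplicity two in it. -/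
def IsDoublyCriticalAtReflectionLines (f : CP2 → CP2) : Prop :=
  ∃ d P, IsLift d P f ∧
    {p : CP2 | MvPolynomial.eval p.rep (jacobianDet P) = 0} = ⋃₀ reflectionLines ∧
    ∀ a, IsReflectionForm a → emultiplicity (linearForm a) (jacobianDet P) = 2

/-! ### Basic invariants and equivariants, and the map `h` -/

/-- The polynomial with the given list of terms: `(c, k, l, m)` stands for the monomial
`c y₁ ^ k y₂ ^ l y₃ ^ m`. -/
def ofTerms (L : List (ℤ × ℕ × ℕ × ℕ)) : Poly3 :=
  (L.map fun t => MvPolynomial.C (t.1 : ℂ) * MvPolynomial.X 0 ^ t.2.1 *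
    MvPolynomial.X 1 ^ t.2.2.1 * MvPolynomial.X 2 ^ t.2.2.2).sum

/-- The invariant `F` of degree `4` (Klein's quartic form). -/
def polyF : Poly3 :=
  ofTerms [(3, 4, 0, 0), (3, 0, 4, 0), (-49, 0, 0, 4), (-14, 3, 0, 1), (6, 2, 2, 0),
    (-21, 2, 0, 2), (-21, 0, 2, 2), (42, 1, 2, 1)]

/-- The Hessian matrix of `F`. -/
def hessianF : Matrix (Fin 3) (Fin 3) Poly3 :=
  Matrix.of fun i j => MvPolynomial.pderiv i (MvPolynomial.pderiv j polyF)

/-- The invariant `Φ` of degree `6`, a multiple of the Hessian determinant of `F`. -/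
def polyPhi : Poly3 := MvPolynomial.C (-1 / 1512) * hessianF.det

/-- The Hessian matrix of `F` bordered by the gradient of `Φ`. -/
def borderedHessian : Matrix (Fin 3 ⊕ Unit) (Fin 3 ⊕ Unit) Poly3 :=
  Matrix.fromBlocks hessianF (Matrix.of fun i _ => MvPolynomial.pderiv i polyPhi)
    (Matrix.of fun _ j => MvPolynomial.pderiv j polyPhi) 0

/-- The invariant `Ψ` of degree `14`, a multiple of the bordered Hessian determinant. -/
def polyPsi : Poly3 := MvPolynomial.C (-1 / 9072) * borderedHessian.det

/-- The basic equivariant `g₉` of degree `9`. -/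
def mapG9 : Fin 3 → Poly3 :=
  ![
    ofTerms [
      (27, 9, 0, 0), (336, 8, 0, 1), (-4428, 7, 2, 0), (308, 7, 0, 2), (-14700, 6, 0, 3),
      (-10920, 6, 2, 1), (-13446, 5, 4, 0), (-151851, 5, 0, 4), (18564, 5, 2, 2),
      (-149548, 4, 0, 5), (-192864, 4, 2, 3), (33600, 4, 4, 1), (-5436, 3, 6, 0),
      (-8232, 3, 0, 6), (-44394, 3, 2, 4), (-116676, 3, 4, 2), (605052, 2, 0, 7),
      (-329280, 2, 2, 5), (-104076, 2, 4, 3), (-11592, 2, 6, 1), (3555, 1, 8, 0),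
      (-261709, 1, 0, 8), (-8232, 1, 2, 6), (-238287, 1, 4, 4), (37548, 1, 6, 2),
      (-605052, 0, 2, 7), (259308, 0, 4, 5), (74088, 0, 6, 3)],
    ofTerms [
      (-4509, 8, 1, 0), (-4956, 7, 1, 1), (1620, 6, 3, 0), (-39382, 6, 1, 2), (207564, 5, 1, 3),
      (22596, 5, 3, 1), (7722, 4, 5, 0), (-22197, 4, 1, 4), (111174, 4, 3, 2), (628376, 3, 1, 5),
      (177576, 3, 3, 3), (-24612, 3, 5, 1), (612, 2, 7, 0), (-8232, 2, 1, 6), (-476574, 2, 3, 4),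
      (-24066, 2, 5, 2), (-1210104, 1, 1, 7), (189336, 1, 3, 5), (-29988, 1, 5, 3),
      (4284, 1, 7, 1), (-981, 0, 9, 0), (-261709, 0, 1, 8), (-8232, 0, 3, 6), (-108633, 0, 5, 4),
      (-2142, 0, 7, 2)],
    ofTerms [
      (224, 9, 0, 0), (2547, 8, 0, 1), (-2016, 7, 2, 0), (9156, 7, 0, 2), (7952, 6, 0, 3),
      (19260, 6, 2, 1), (6048, 5, 4, 0), (-57918, 5, 0, 4), (-9156, 5, 2, 2), (150675, 4, 0, 5),
      (-43176, 4, 2, 3), (18306, 4, 4, 1), (-6048, 3, 6, 0), (-48706, 3, 0, 6), (115836, 3, 2, 4),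
      (-45780, 3, 4, 2), (-51450, 2, 0, 7), (301350, 2, 2, 5), (68544, 2, 4, 3), (5148, 2, 6, 1),
      (146118, 1, 2, 6), (173754, 1, 4, 4), (-27468, 1, 6, 2), (7203, 0, 0, 9), (-51450, 0, 2, 7),
      (150675, 0, 4, 5), (504, 0, 6, 3), (3555, 0, 8, 1)]]

/-- The basic equivariant `g₁₁` of degree `11`. -/
def mapG11 : Fin 3 → Poly3 :=
  ![
    ofTerms [
      (-1334, 11, 0, 0), (-2534, 10, 0, 1), (-63034, 9, 2, 0), (47355, 9, 0, 2),
      (542136, 8, 0, 3), (45864, 8, 2, 1), (-88716, 7, 4, 0), (1184232, 7, 0, 4),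
      (-551460, 7, 2, 2), (-312816, 6, 0, 5), (2446080, 6, 2, 3), (-308196, 6, 4, 1),
      (-114084, 5, 6, 0), (-4519368, 5, 0, 6), (-6856668, 5, 2, 4), (735714, 5, 4, 2),
      (432180, 4, 0, 7), (625632, 4, 2, 5), (-446880, 4, 4, 3), (634536, 4, 6, 1),
      (18306, 3, 8, 0), (-11503191, 3, 0, 8), (4272408, 3, 2, 6), (4515840, 3, 4, 4),
      (1066716, 3, 6, 2), (5176556, 2, 0, 9), (18670176, 2, 2, 7), (938448, 2, 4, 5),
      (-268128, 2, 6, 3), (-162918, 2, 8, 1), (5022, 1, 10, 0), (9311078, 1, 0, 10),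
      (-11503191, 1, 2, 8), (-8956416, 1, 4, 6), (2019780, 1, 6, 4), (-267813, 1, 8, 2),
      (-5176556, 0, 2, 9), (-6655572, 0, 4, 7), (-814968, 0, 8, 3)],
    ofTerms [
      (-17294, 10, 1, 0), (-60746, 9, 1, 1), (-36546, 8, 3, 0), (309309, 8, 1, 2),
      (-1631112, 7, 1, 3), (356328, 7, 3, 1), (-77628, 6, 5, 0), (-1056930, 6, 1, 4),
      (-900732, 6, 3, 2), (-312816, 5, 1, 5), (-5794152, 5, 3, 3), (-579852, 5, 5, 1),
      (52236, 4, 7, 0), (2136204, 4, 1, 6), (-1627290, 4, 3, 4), (-486738, 4, 5, 2),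
      (-19534536, 3, 1, 7), (625632, 3, 3, 5), (-2348472, 3, 5, 3), (168840, 3, 7, 1),
      (1674, 2, 9, 0), (-11503191, 2, 1, 8), (-17912832, 2, 3, 6), (9745218, 2, 5, 4),
      (717444, 2, 7, 2), (-10353112, 1, 1, 9), (5359032, 1, 3, 7), (938448, 1, 5, 5),
      (-1083096, 1, 7, 3), (11718, 1, 9, 1), (-8586, 0, 11, 0), (9311078, 0, 1, 10),
      (-11503191, 0, 3, 8), (-2300844, 0, 5, 6), (-221382, 0, 7, 4), (-5859, 0, 9, 2)],
    ofTerms [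
      (-2464, 11, 0, 0), (-8670, 10, 0, 1), (19712, 9, 2, 0), (-26250, 9, 0, 2),
      (196119, 8, 0, 3), (79878, 8, 2, 1), (-44352, 7, 4, 0), (89376, 7, 0, 4), (201096, 7, 2, 2),
      (1953924, 6, 0, 5), (276444, 6, 2, 3), (77604, 6, 4, 1), (-1422078, 5, 0, 6),
      (-89376, 5, 2, 4), (-579852, 5, 4, 2), (-1825446, 4, 0, 7), (6454476, 4, 2, 5),
      (1007370, 4, 4, 3), (-114084, 4, 6, 1), (66528, 3, 8, 0), (5978490, 3, 0, 8),
      (2844156, 3, 2, 6), (-446880, 3, 4, 4), (634536, 3, 6, 2), (-4477865, 2, 0, 9),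
      (-3650892, 2, 2, 7), (5466636, 2, 4, 5), (1066716, 2, 6, 3), (-98118, 2, 8, 1),
      (-17935470, 1, 2, 8), (4266234, 1, 4, 6), (-268128, 1, 6, 4), (11718, 1, 8, 2),
      (-100842, 0, 0, 11), (-4477865, 0, 2, 9), (-1825446, 0, 4, 7), (2019780, 0, 6, 5),
      (139671, 0, 8, 3), (5022, 0, 10, 1)]]

/-- The homogeneous lift of `h`:
`(827/14 F² Φ + 99/49 Ψ) · id + 11/98 Φ · g₉ + 9/49 F · g₁₁`. -/
def mapH : Fin 3 → Poly3 := fun i =>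
  (MvPolynomial.C (827 / 14) * polyF ^ 2 * polyPhi + MvPolynomial.C (99 / 49) * polyPsi) *
      MvPolynomial.X i
    + MvPolynomial.C (11 / 98) * polyPhi * mapG9 i
    + MvPolynomial.C (9 / 49) * polyF * mapG11 i

end

end KleinHeptic

/-! The linear group is generated by 21 reflections with eigenvalues 1, -1, -1. They are the only
elements other than 1 with scalar square, and they are conjugate, so every question about a
reflection line reduces to the line y₂ = 0 (the variable `X 1`), whose reflection is diag(-1, 1,
-1).

Let R be a triple of forms of odd degree n commuting with the group. Then R₂ is odd in y₂. If
y₂^(k+1) is the exact power dividing R₂, with quotient u, then det J(R) = y₂^k ((k+1) u J₀ + y₂ w),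
where J₀ is the Jacobian of the map induced on the line (`jacobianDet_of_eq_X_pow_mul`). If J₀
vanishes on the line, the induced map is constant there or R vanishes there. A constant value would
be a point fixed by the stabilizer of the line, and there is none: `refl 6` fixes two points of the
line and `refl 10` exchanges them (`evalMap_eq_zero_of_lineJacobian`). So, unless R vanishes on the
line, y₂² divides det J(R) only if y₂³ divides R₂, and the converse always holds. This turns double
criticality into a linear condition on R. Moreover, if n < 21 and det J(R) = 0, then R = 0, because
R₂ = 0 spreads to all components by equivariance, and otherwise every component is divisible by the
product L of the 21 linear forms (`eq_zero_of_jacobianDet_eq_zero`).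

Uniqueness. The critical condition and the Nullstellensatz give det J(P) = c L² with c ≠ 0, so 3(n -
1) = 42 and n = 15. A lift P of an equivariant map commutes with each g up to a scalar, which is 1
on reflections when n is odd. If H is the lift of h, then P + tH satisfies the linear condition for
every t, so its Jacobian determinant is d L². Choosing t so that this vanishes at a point off the
lines gives d = 0, hence P + tH = 0.

Existence. The triple H is built from covariants of F, so it is equivariant. An explicit derivative
and parity give y₂³ ∣ H₂, and a Bezout identity shows that H has no zero on y₂ = 0 except the
origin. Hence det J(H) = c L² with c ≠ 0. By Euler's identity a nontrivial common zero would lie on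
a reflection line, and the group moves it to y₂ = 0. -/

namespace KleinHeptic

open MvPolynomial

/-! ### Linear changes of variables -/

/-- Values of a triple of polynomials. -/
noncomputable def evalMap (P : Fin 3 → Poly3) (v : Fin 3 → ℂ) : Fin 3 → ℂ := fun i => eval v (P i)

/-- The substitution `y ↦ g y`. -/
noncomputable def subst (g : Matrix (Fin 3) (Fin 3) ℂ) : Poly3 →ₐ[ℂ] Poly3 :=
  aeval fun i => ∑ j, C (g i j) * X j

theorem subst_X (g : Matrix (Fin 3) (Fin 3) ℂ) (i : Fin 3) :
    subst g (X i) = ∑ j, C (g i j) * X j := by simp [subst]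

theorem subst_C (g : Matrix (Fin 3) (Fin 3) ℂ) (c : ℂ) : subst g (C c) = C c := by simp [subst]

theorem eval_subst (g : Matrix (Fin 3) (Fin 3) ℂ) (v : Fin 3 → ℂ) (p : Poly3) :
    eval v (subst g p) = eval (g *ᵥ v) p := by
  induction p using MvPolynomial.induction_on with
  | C a => simp
  | add p q hp hq => simp [hp, hq]
  | mul_X p i hp => simp [hp, subst_X, Matrix.mulVec, dotProduct]

theorem subst_subst (g h : Matrix (Fin 3) (Fin 3) ℂ) (p : Poly3) :
    subst h (subst g p) = subst (g * h) p := by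
  apply MvPolynomial.funext
  intro v
  simp [eval_subst, Matrix.mulVec_mulVec]

theorem subst_one (p : Poly3) : subst 1 p = p := by
  apply MvPolynomial.funext
  intro v
  simp [eval_subst]

theorem subst_linearForm (g : Matrix (Fin 3) (Fin 3) ℂ) (a : Fin 3 → ℂ) :
    subst g (linearForm a) = linearForm (a ᵥ* g) := by
  apply MvPolynomial.funext
  intro v
  have h (a v : Fin 3 → ℂ) : eval v (linearForm a) = a ⬝ᵥ v := by simp [linearForm, dotProduct]
  rw [eval_subst, h, h, Matrix.dotProduct_mulVec]

theorem eval_linearForm (a v : Fin 3 → ℂ) : eval v (linearForm a) = a ⬝ᵥ v := by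
  simp [linearForm, dotProduct]

theorem isHomogeneous_linearForm (a : Fin 3 → ℂ) : (linearForm a).IsHomogeneous 1 :=
  IsHomogeneous.sum _ _ _ fun i _ => (isHomogeneous_C_mul_X (a i) i)

theorem pderiv_subst (g : Matrix (Fin 3) (Fin 3) ℂ) (j : Fin 3) (p : Poly3) :
    pderiv j (subst g p) = ∑ i, C (g i j) * subst g (pderiv i p) := by
  induction p using MvPolynomial.induction_on with
  | C a => simp
  | add p q hp hq => simp [hp, hq, mul_add, Finset.sum_add_distrib]
  | mul_X p i hp =>
    have h1 : pderiv j (subst g (X i)) = C (g i j) := by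
      simp [subst_X, pderiv_X, Pi.single_apply]
    have h2 (k : Fin 3) : pderiv k (p * X i) = pderiv k p * X i + p * (if k = i then 1 else 0) := by
      rw [pderiv_mul, pderiv_X, Pi.single_apply]
      simp [eq_comm]
    have h3 : ∑ k, C (g k j) * subst g (p * (if k = i then 1 else 0)) = subst g p * C (g i j) := by
      rw [Finset.sum_eq_single i]
      · rw [if_pos rfl, mul_one, mul_comm]
      · intro b _ hb
        rw [if_neg hb, mul_zero, map_zero, mul_zero]
      · simp
    have h4 (k : Fin 3) : C (g k j) * subst g (pderiv k (p * X i)) =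
        C (g k j) * subst g (pderiv k p) * subst g (X i) +
          C (g k j) * subst g (p * (if k = i then 1 else 0)) := by
      rw [h2, map_add, map_mul (subst g) (pderiv k p)]
      ring
    rw [Finset.sum_congr rfl fun k _ => h4 k, Finset.sum_add_distrib, h3, ← Finset.sum_mul, ← hp,
      map_mul (subst g) p, pderiv_mul, h1]

/-! ### Covariants -/

/-- The gradient. -/
noncomputable def gradient (p : Poly3) : Fin 3 → Poly3 := fun i => pderiv i p

/-- The Hessian matrix. -/
noncomputable def hessian (p : Poly3) : Matrix (Fin 3) (Fin 3) Poly3 :=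
  Matrix.of fun i j => pderiv i (pderiv j p)

/-- The Hessian matrix of `p` bordered by the gradient of `q`. -/
noncomputable def bordered (p q : Poly3) : Matrix (Fin 3 ⊕ Unit) (Fin 3 ⊕ Unit) Poly3 :=
  Matrix.fromBlocks (hessian p) (Matrix.of fun i _ => gradient q i)
    (Matrix.of fun _ j => gradient q j) 0

/-- The Jacobian matrix. -/
noncomputable def jacobian (P : Fin 3 → Poly3) : Matrix (Fin 3) (Fin 3) Poly3 :=
  Matrix.of fun i j => pderiv j (P i)

theorem jacobianDet_eq (P : Fin 3 → Poly3) : jacobianDet P = (jacobian P).det := rfl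

theorem gradient_subst (g : Matrix (Fin 3) (Fin 3) ℂ) (p : Poly3) :
    gradient (subst g p) = (g.map C)ᵀ *ᵥ (subst g ∘ gradient p) := by
  funext j
  simp [gradient, pderiv_subst, Matrix.mulVec, dotProduct]

theorem hessian_subst (g : Matrix (Fin 3) (Fin 3) ℂ) (p : Poly3) :
    hessian (subst g p) = (g.map C)ᵀ * (hessian p).map (subst g) * g.map C := by
  ext1 i j
  simp only [hessian, Matrix.of_apply, pderiv_subst, map_sum, Matrix.mul_apply, Matrix.map_apply,
    Matrix.transpose_apply]
  refine Finset.sum_congr rfl fun k _ => ?_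
  rw [pderiv_C_mul, pderiv_subst]
  exact mul_comm _ _

theorem jacobian_subst (g : Matrix (Fin 3) (Fin 3) ℂ) (P : Fin 3 → Poly3) :
    jacobian (fun i => subst g (P i)) = (jacobian P).map (subst g) * g.map C := by
  ext1 i j
  simp only [jacobian, Matrix.of_apply, pderiv_subst, Matrix.mul_apply, Matrix.map_apply]
  exact Finset.sum_congr rfl fun k _ => by ring

theorem jacobian_mulVec (g : Matrix (Fin 3) (Fin 3) ℂ) (P : Fin 3 → Poly3) :
    jacobian ((g.map C) *ᵥ P) = g.map C * jacobian P := by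
  ext1 i j
  simp [jacobian, Matrix.mulVec, dotProduct, Matrix.mul_apply]

theorem det_map_subst {n : Type*} [Fintype n] [DecidableEq n] (g : Matrix (Fin 3) (Fin 3) ℂ)
    (A : Matrix n n Poly3) : (A.map (subst g)).det = subst g A.det :=
  ((subst g).map_det A).symm

theorem det_map_C (g : Matrix (Fin 3) (Fin 3) ℂ) :
    (g.map (C : ℂ →+* Poly3)).det = C g.det :=
  ((C : ℂ →+* Poly3).map_det g).symm

theorem subst_hessian_det {g : Matrix (Fin 3) (Fin 3) ℂ} (hg : g.det = 1) {p : Poly3}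
    (hp : subst g p = p) : subst g (hessian p).det = (hessian p).det := by
  conv_rhs => rw [← hp, hessian_subst, Matrix.det_mul, Matrix.det_mul, Matrix.det_transpose,
    det_map_C, hg, det_map_subst]
  simp

/-- The bordered Hessian transforms by congruence with the block matrix diag(g, 1), which again has
determinant 1. -/
theorem subst_bordered_det {g : Matrix (Fin 3) (Fin 3) ℂ} (hg : g.det = 1) {p q : Poly3}
    (hp : subst g p = p) (hq : subst g q = q) :
    subst g (bordered p q).det = (bordered p q).det := by
  set G : Matrix (Fin 3 ⊕ Unit) (Fin 3 ⊕ Unit) Poly3 := Matrix.fromBlocks (g.map C) 0 0 1 with hG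
  have h : bordered p q = Gᵀ * (bordered p q).map (subst g) * G := by
    conv_lhs => rw [← hp, ← hq]
    rw [bordered, hessian_subst, gradient_subst, hG, bordered, Matrix.fromBlocks_transpose,
      Matrix.fromBlocks_map, Matrix.fromBlocks_multiply, Matrix.fromBlocks_multiply]
    congr 1
    · simp
    · ext1 i j
      simp [Matrix.mul_apply, Matrix.mulVec, dotProduct]
    · ext1 i j
      simp [Matrix.mul_apply, Matrix.mulVec, dotProduct, mul_comm]
    · ext1 i j
      simp
  have hGd : G.det = 1 := by rw [hG, Matrix.det_fromBlocks_zero₂₁, det_map_C, hg]; simp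
  conv_rhs => rw [h, Matrix.det_mul, Matrix.det_mul, Matrix.det_transpose, hGd, det_map_subst]
  simp

/-- The map `adj (H p) ∇ q`. -/
noncomputable def adjHessianGradient (p q : Poly3) : Fin 3 → Poly3 :=
  (hessian p).adjugate *ᵥ gradient q

/-- By the chain rule the Hessian picks up gᵀ and g, and the gradient picks up gᵀ. Since det g = 1,
the adjugates of g and gᵀ are their inverses, and one factor g survives. This is the source of the
equivariants `mapG9` and `mapG11`. -/
theorem subst_adjHessianGradient {g : Matrix (Fin 3) (Fin 3) ℂ} (hg : g.det = 1) {p q : Poly3}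
    (hp : subst g p = p) (hq : subst g q = q) (i : Fin 3) :
    subst g (adjHessianGradient p q i) = ((g.map C) *ᵥ adjHessianGradient p q) i := by
  have hGd : (g.map (C : ℂ →+* Poly3)).det = 1 := by rw [det_map_C, hg]; simp
  have h : (g.map C) *ᵥ adjHessianGradient p q =
      ((hessian p).map (subst g)).adjugate *ᵥ (subst g ∘ gradient q) := by
    have hH : hessian p = _ := (congrArg hessian hp.symm).trans (hessian_subst g p)
    have hG : gradient q = _ := (congrArg gradient hq.symm).trans (gradient_subst g q)
    conv_lhs => rw [adjHessianGradient, hH, hG]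
    rw [Matrix.adjugate_mul_distrib, Matrix.adjugate_mul_distrib, Matrix.mulVec_mulVec,
      Matrix.mulVec_mulVec]
    congr 1
    have h1 := Matrix.mul_adjugate (g.map (C : ℂ →+* Poly3))
    have h2 := Matrix.adjugate_mul (g.map (C : ℂ →+* Poly3))ᵀ
    rw [hGd, one_smul] at h1
    rw [Matrix.det_transpose, hGd, one_smul] at h2
    rw [← Matrix.mul_assoc, ← Matrix.mul_assoc, h1, Matrix.one_mul, Matrix.mul_assoc, h2,
      Matrix.mul_one]
  have h3 : ((hessian p).map (subst g)).adjugate = (hessian p).adjugate.map (subst g) :=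
    ((subst g).map_adjugate (hessian p)).symm
  rw [h, h3]
  simp [adjHessianGradient, Matrix.mulVec, dotProduct]

/-! ### Equivariant triples -/

/-- The linear maps that commute with the polynomial map `P`. -/
noncomputable def commutant (P : Fin 3 → Poly3) : Subgroup (GL (Fin 3) ℂ) where
  carrier := {g | ∀ v, evalMap P (g.1 *ᵥ v) = g.1 *ᵥ evalMap P v}
  one_mem' := by simp
  mul_mem' := by
    intro a b ha hb v
    simp only [Set.mem_ofPred_eq] at ha hb
    rw [Units.val_mul, ← Matrix.mulVec_mulVec, ha, hb, Matrix.mulVec_mulVec]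
  inv_mem' := by
    intro a ha v
    have h := ha (a⁻¹.1 *ᵥ v)
    rw [Matrix.mulVec_mulVec, Units.mul_inv, Matrix.one_mulVec] at h
    rw [h, Matrix.mulVec_mulVec, Units.inv_mul, Matrix.one_mulVec]

theorem mem_commutant {P : Fin 3 → Poly3} {g : GL (Fin 3) ℂ} :
    g ∈ commutant P ↔ ∀ v, evalMap P (g.1 *ᵥ v) = g.1 *ᵥ evalMap P v := Iff.rfl

theorem mem_commutant_iff_subst {P : Fin 3 → Poly3} {g : GL (Fin 3) ℂ} :
    g ∈ commutant P ↔ ∀ i, subst g.1 (P i) = ((g.1.map C) *ᵥ P) i := by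
  rw [mem_commutant]
  constructor
  · intro h i
    apply MvPolynomial.funext
    intro v
    rw [eval_subst]
    have := congrFun (h v) i
    simpa [evalMap, Matrix.mulVec, dotProduct] using this
  · intro h v
    funext i
    have := congrArg (eval v) (h i)
    rw [eval_subst] at this
    simpa [evalMap, Matrix.mulVec, dotProduct] using this

theorem commutant_add_smul {P Q : Fin 3 → Poly3} (c : ℂ) {g : GL (Fin 3) ℂ}
    (hP : g ∈ commutant P) (hQ : g ∈ commutant Q) :
    g ∈ commutant (fun i => P i + C c * Q i) := by
  rw [mem_commutant] at *
  intro v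
  have h (w : Fin 3 → ℂ) : evalMap (fun i => P i + C c * Q i) w = evalMap P w + c • evalMap Q w := by
    funext i
    simp [evalMap]
  rw [h, h, hP, hQ, Matrix.mulVec_add, Matrix.mulVec_smul]

/-- Differentiating P(g v) = g P(v) gives J(P)(g v) g = g J(P)(v), and det g cancels. So
divisibility of the Jacobian determinant by one linear form passes to all conjugate ones. -/
theorem subst_jacobianDet {P : Fin 3 → Poly3} {g : GL (Fin 3) ℂ} (hP : g ∈ commutant P) :
    subst g.1 (jacobianDet P) = jacobianDet P := by
  rw [mem_commutant_iff_subst] at hP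
  have h : (jacobian P).map (subst g.1) * g.1.map C = g.1.map C * jacobian P := by
    rw [← jacobian_subst, ← jacobian_mulVec]
    congr 1
    funext i
    exact hP i
  have h2 := congrArg Matrix.det h
  rw [Matrix.det_mul, Matrix.det_mul, det_map_subst, det_map_C, mul_comm] at h2
  have h3 : (C g.1.det : Poly3) ≠ 0 := by
    rw [Ne, C_eq_zero]
    exact (Matrix.isUnits_det_units g).ne_zero
  exact mul_left_cancel₀ h3 h2

end KleinHeptic

namespace KleinHeptic

/-! ### Exact arithmetic with `θ` -/

/-- The ring `ℤ[θ]`, with `θ ^ 2 = θ - 2`. -/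
abbrev ZTheta : Type := QuadraticAlgebra ℤ (-2) 1

/-- The embedding of `ℤ[θ]` into the complex numbers. -/
noncomputable def toComplex : ZTheta →+* ℂ :=
  (QuadraticAlgebra.lift ⟨theta, by
    have h := theta_sq
    simp only [zsmul_eq_mul]
    push_cast
    linear_combination h⟩ : ZTheta →ₐ[ℤ] ℂ).toRingHom

theorem toComplex_apply (z : ZTheta) : toComplex z = (z.re : ℂ) + z.im * theta := by
  simp [toComplex, QuadraticAlgebra.lift]

theorem theta_im_ne_zero : theta.im ≠ 0 := by
  have : (0 : ℝ) < Real.sqrt 7 := Real.sqrt_pos.mpr (by norm_num)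
  simp [theta]

/-- Identities and non-identities between complex matrices can thus be decided by exact computation
in ℤ[θ]. -/
theorem toComplex_injective : Function.Injective toComplex := by
  rw [injective_iff_map_eq_zero]
  intro z hz
  rw [toComplex_apply] at hz
  have h1 := congrArg Complex.im hz
  have h2 := congrArg Complex.re hz
  simp [theta_im_ne_zero] at h1
  simp [h1] at h2
  exact QuadraticAlgebra.ext h2 h1

/-- A matrix over `ℤ[θ]` as a complex matrix. -/
noncomputable def toComplexMatrix : Matrix (Fin 3) (Fin 3) ZTheta →+* Matrix (Fin 3) (Fin 3) ℂ :=
  toComplex.mapMatrix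

/-! ### The octahedral rotations -/

/-- The permutation parts of the octahedral rotations. -/
def octPerm : Fin 6 → Fin 3 → Fin 3 :=
  ![![0, 1, 2], ![0, 2, 1], ![1, 0, 2], ![1, 2, 0], ![2, 0, 1], ![2, 1, 0]]

/-- The signs of the permutations. -/
def octPermSign : Fin 6 → ℤ := ![1, -1, -1, 1, 1, -1]

/-- The even sign changes. -/
def octSign : Fin 4 → Fin 3 → ℤ := ![![1, 1, 1], ![1, -1, -1], ![-1, 1, -1], ![-1, -1, 1]]

/-- The list of the octahedral rotations. -/
def octMatrix (i : Fin 24) : Matrix (Fin 3) (Fin 3) ZTheta :=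
  Matrix.of fun a b => if octPerm (Fin.ofNat 6 (i / 4)) b = a then
    ((octPermSign (Fin.ofNat 6 (i / 4)) * octSign (Fin.ofNat 4 i) b : ℤ) : ZTheta) else 0

/-- A signed permutation matrix. -/
def signedPerm (σ : Equiv.Perm (Fin 3)) (ε : Fin 3 → ℤˣ) : Matrix (Fin 3) (Fin 3) ZTheta :=
  Matrix.of fun i j => if σ j = i then (((ε j : ℤˣ) : ℤ) : ZTheta) else 0

theorem toComplexMatrix_signedPerm (σ : Equiv.Perm (Fin 3)) (ε : Fin 3 → ℤˣ) :
    toComplexMatrix (signedPerm σ ε) =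
      Matrix.of fun i j => if σ j = i then (((ε j : ℤˣ) : ℤ) : ℂ) else 0 := by
  ext1 i j
  simp [toComplexMatrix, signedPerm, apply_ite toComplex]

/-- Rules out any rotation missing from the list of 24: a signed permutation matrix outside it has
determinant -1. -/
theorem signedPerm_det (σ : Equiv.Perm (Fin 3)) (ε : Fin 3 → ℤˣ) :
    (signedPerm σ ε).det = -1 ∨ ∃ i, signedPerm σ ε = octMatrix i := by
  revert σ ε
  decide +kernel

theorem octMatrix_eq (i : Fin 24) : (octMatrix i).det = 1 ∧ ∃ σ ε, octMatrix i = signedPerm σ ε := by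
  revert i
  decide +kernel

theorem mem_octahedralMatrices_iff {A : Matrix (Fin 3) (Fin 3) ℂ} :
    A ∈ octahedralMatrices ↔ ∃ i, A = toComplexMatrix (octMatrix i) := by
  constructor
  · rintro ⟨hA, σ, ε, h⟩
    rw [← toComplexMatrix_signedPerm] at h
    rcases signedPerm_det σ ε with h1 | ⟨i, hi⟩
    · have h2 : A.det = toComplex (signedPerm σ ε).det := by
        rw [h, RingHom.map_det]
        rfl
      rw [hA, h1] at h2
      norm_num at h2
    · exact ⟨i, by rw [h, hi]⟩
  · rintro ⟨i, rfl⟩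
    obtain ⟨h1, σ, ε, h2⟩ := octMatrix_eq i
    refine ⟨?_, σ, ε, by rw [h2, toComplexMatrix_signedPerm]⟩
    have h3 : (toComplexMatrix (octMatrix i)).det = toComplex (octMatrix i).det :=
      (RingHom.map_det _ _).symm
    rw [h3, h1, map_one]

theorem toComplexMatrix_injective : Function.Injective toComplexMatrix := fun A B h => by
  ext1 i j
  exact toComplex_injective (congrFun (congrFun h i) j)

theorem octahedralMatrices_mul {A B : Matrix (Fin 3) (Fin 3) ℂ} (hA : A ∈ octahedralMatrices)
    (hB : B ∈ octahedralMatrices) : A * B ∈ octahedralMatrices := by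
  obtain ⟨hA1, σ, ε, hA⟩ := hA
  obtain ⟨hB1, τ, δ, hB⟩ := hB
  refine ⟨by rw [Matrix.det_mul, hA1, hB1, mul_one], σ * τ, fun j => ε (τ j) * δ j, ?_⟩
  ext1 i j
  rw [hA, hB, Matrix.mul_apply, Finset.sum_eq_single (τ j)]
  · simp
  · intro b _ hb
    simp [Ne.symm hb]
  · simp

theorem octMatrix_mul (a b : Fin 24) : ∃ c, octMatrix a * octMatrix b = octMatrix c := by
  obtain ⟨c, hc⟩ := mem_octahedralMatrices_iff.mp (octahedralMatrices_mul
    (mem_octahedralMatrices_iff.mpr ⟨a, rfl⟩) (mem_octahedralMatrices_iff.mpr ⟨b, rfl⟩))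
  rw [← map_mul] at hc
  exact ⟨c, toComplexMatrix_injective hc⟩

theorem octMatrix_inv (a : Fin 24) : ∃ b, octMatrix b * octMatrix a = 1 := by
  revert a
  decide +kernel

theorem octMatrix_zero : octMatrix 0 = 1 := by decide +kernel

/-! ### The generator `Q` -/

/-- The matrix `2 Q`. -/
def twiceQ : Matrix (Fin 3) (Fin 3) ZTheta :=
  !![⟨1, 0⟩, ⟨1, 0⟩, ⟨0, -1⟩; ⟨1, 0⟩, ⟨1, 0⟩, ⟨0, 1⟩; ⟨1, -1⟩, ⟨-1, 1⟩, ⟨0, 0⟩]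

theorem toComplexMatrix_twiceQ : toComplexMatrix twiceQ = (2 : ℂ) • matrixQ := by
  ext i j
  fin_cases i <;> fin_cases j <;>
    simp [toComplexMatrix, twiceQ, matrixQ, toComplex_apply] <;> ring

theorem matrixQ_pow_four : matrixQ * matrixQ * matrixQ * matrixQ = 1 := by
  have h : twiceQ * twiceQ * twiceQ * twiceQ = 16 := by decide +kernel
  have h2 := congrArg toComplexMatrix h
  simp only [map_mul, toComplexMatrix_twiceQ, map_ofNat] at h2
  simp only [smul_mul_assoc, mul_smul_comm, smul_smul] at h2
  have h3 : (16 : Matrix (Fin 3) (Fin 3) ℂ) = (16 : ℂ) • 1 := by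
    rw [← Algebra.algebraMap_eq_smul_one, map_ofNat]
  rw [h3] at h2
  norm_num at h2
  exact h2

/-- The double coset decomposition of `Q A Q` for octahedral rotations `A`. -/
theorem twiceQ_mul_octMatrix_mul_twiceQ (i : Fin 24) :
    (∃ a, twiceQ * octMatrix i * twiceQ = 4 * octMatrix a) ∨
      ∃ a b, twiceQ * octMatrix i * twiceQ = 2 * (octMatrix a * twiceQ * octMatrix b) := by
  -- The first table serves both alternatives. The second is read only in the second alternative, so
  -- its other entries are arbitrary.
  have h (i : Fin 24) :
      twiceQ * octMatrix i * twiceQ = 4 * octMatrix (![11, 1, 1, 3, 12, 4, 4, 12, 8, 1, 1, 0,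
        13, 5, 5, 13, 12, 4, 4, 12, 13, 5, 5, 13] i) ∨
      twiceQ * octMatrix i * twiceQ = 2 * (octMatrix (![11, 1, 1, 3, 12, 4, 4, 12, 8, 1, 1, 0,
        13, 5, 5, 13, 12, 4, 4, 12, 13, 5, 5, 13] i) * twiceQ * octMatrix (![0, 10, 1, 0, 5, 18,
        5, 18, 0, 2, 9, 0, 13, 22, 13, 22, 6, 6, 17, 17, 14, 14, 21, 21] i)) := by
    revert i
    decide +kernel
  rcases h i with h | h
  · exact Or.inl ⟨_, h⟩
  · exact Or.inr ⟨_, _, h⟩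

/-! ### Reflections -/

/-- The roots, normalized to have squared length `4`. -/
def root : Fin 21 → Fin 3 → ZTheta :=
  ![![0, ⟨0, 1⟩, ⟨0, 1⟩], ![0, ⟨0, 1⟩, ⟨0, -1⟩], ![⟨0, 1⟩, 0, ⟨0, 1⟩], ![⟨0, 1⟩, 0, ⟨0, -1⟩],
    ![⟨0, 1⟩, ⟨0, 1⟩, 0], ![⟨0, 1⟩, ⟨0, -1⟩, 0], ![2, 0, 0], ![0, 2, 0], ![0, 0, 2],
    ![⟨1, -1⟩, 1, 1], ![⟨1, -1⟩, 1, -1], ![⟨1, -1⟩, -1, 1], ![⟨1, -1⟩, -1, -1],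
    ![1, ⟨1, -1⟩, 1], ![1, ⟨1, -1⟩, -1], ![-1, ⟨1, -1⟩, 1], ![-1, ⟨1, -1⟩, -1],
    ![1, 1, ⟨1, -1⟩], ![1, -1, ⟨1, -1⟩], ![-1, 1, ⟨1, -1⟩], ![-1, -1, ⟨1, -1⟩]]

/-- The complex conjugates of the roots. -/
def coroot (i : Fin 21) (j : Fin 3) : ZTheta :=
  ⟨(root i j).re + (root i j).im, -(root i j).im⟩

/-- Twice the reflection in a root. -/
def twiceRefl (i : Fin 21) : Matrix (Fin 3) (Fin 3) ZTheta :=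
  Matrix.vecMulVec (root i) (coroot i) - 2

theorem twiceRefl_mul_self (i : Fin 21) : twiceRefl i * twiceRefl i = 4 := by
  revert i
  decide +kernel

theorem twiceRefl_octahedral_or (i : Fin 21) : (∃ a, twiceRefl i = 2 * octMatrix a) ∨
    ∃ a b, twiceRefl i = octMatrix a * twiceQ * octMatrix b := by
  have h (i : Fin 21) : twiceRefl i = 2 * octMatrix (![5, 4, 22, 20, 11, 8, 1, 2, 3, 13, 12, 12,
        13, 5, 4, 4, 5, 1, 0, 0, 1] i) ∨
      twiceRefl i = octMatrix (![5, 4, 22, 20, 11, 8, 1, 2, 3, 13, 12, 12, 13, 5, 4, 4, 5, 1, 0,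
        0, 1] i) * twiceQ * octMatrix (![0, 0, 0, 0, 0, 0, 0, 0, 0, 19, 20, 17, 22, 7, 12, 6, 13,
        2, 8, 3, 9] i) := by
    revert i
    decide +kernel
  rcases h i with h | h
  · exact Or.inl ⟨_, h⟩
  · exact Or.inr ⟨_, _, h⟩

/-- Together with `twiceRefl_mul_eq_twiceQ` this writes every generator of the group as a product of
two reflections, so the reflections generate. -/
theorem exists_twiceRefl_mul_eq_octMatrix (i : Fin 24) :
    ∃ a b, twiceRefl a * twiceRefl b = 4 * octMatrix i := by
  have h (i : Fin 24) : twiceRefl (![0, 0, 2, 4, 0, 1, 0, 0, 4, 4, 4, 5, 1, 0, 1, 0, 1, 0, 0, 1, 2,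
      2, 3, 2] i) * twiceRefl (![0, 1, 3, 5, 6, 6, 8, 7, 8, 7, 6, 8, 3, 2, 2, 3, 5, 4, 5, 4, 7, 8,
      7, 6] i) = 4 * octMatrix i := by
    revert i
    decide +kernel
  exact ⟨_, _, h i⟩

theorem twiceRefl_mul_eq_twiceQ : twiceRefl 5 * twiceRefl 19 = 2 * twiceQ := by decide +kernel

/-- A product of two reflections conjugates reflection 0 to reflection i. The factor 4 comes from
the two doubled reflections. The sign s is needed because a root is determined by its reflection
only up to a unit. -/
theorem exists_twiceRefl_transitive (i : Fin 21) : ∃ a b, ∃ s : ℤˣ,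
    twiceRefl a * twiceRefl b * twiceRefl 0 = twiceRefl i * (twiceRefl a * twiceRefl b) ∧
      coroot i ᵥ* (twiceRefl a * twiceRefl b) = fun j => ((4 * s : ℤ) : ZTheta) * coroot 0 j := by
  have h (i : Fin 21) : ∃ s : ℤˣ,
      twiceRefl (![0, 0, 0, 0, 0, 0, 0, 4, 2, 2, 0, 0, 3, 2, 0, 3, 0, 2, 0, 3, 0] i) *
        twiceRefl (![0, 7, 2, 3, 4, 5, 9, 9, 9, 16, 15, 13, 14, 18, 14, 20, 16, 13, 18, 15, 20] i) *
          twiceRefl 0 = twiceRefl i *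
      (twiceRefl (![0, 0, 0, 0, 0, 0, 0, 4, 2, 2, 0, 0, 3, 2, 0, 3, 0, 2, 0, 3, 0] i) *
        twiceRefl (![0, 7, 2, 3, 4, 5, 9, 9, 9, 16, 15, 13, 14, 18, 14, 20, 16, 13, 18, 15, 20] i)) ∧
      coroot i ᵥ*
        (twiceRefl (![0, 0, 0, 0, 0, 0, 0, 4, 2, 2, 0, 0, 3, 2, 0, 3, 0, 2, 0, 3, 0] i) *
        twiceRefl (![0, 7, 2, 3, 4, 5, 9, 9, 9, 16, 15, 13, 14, 18, 14, 20, 16, 13, 18, 15, 20] i)) =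
          fun j => ((4 * s : ℤ) : ZTheta) * coroot 0 j := by
    revert i
    decide +kernel
  exact ⟨_, _, h i⟩

/-- A classification of rotations by their squares: those with nonscalar square are detected by an
entry, and the remaining nontrivial ones are half-turns, which are reflections in this sense. -/
theorem octMatrix_sq (i : Fin 24) : octMatrix i = 1 ∨
    (∃ a b, a ≠ b ∧ (octMatrix i * octMatrix i) a b ≠ 0) ∨
    (∃ a b, (octMatrix i * octMatrix i) a a ≠ (octMatrix i * octMatrix i) b b) ∨
    ∃ j, twiceRefl j = 2 * octMatrix i := by
  revert i
  decide +kernel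

/-- The same classification for the elements A Q. Up to conjugation by rotations these represent the
whole double coset of Q. -/
theorem octMatrix_mul_twiceQ_sq (i : Fin 24) :
    (∃ a b, a ≠ b ∧ (octMatrix i * twiceQ * (octMatrix i * twiceQ)) a b ≠ 0) ∨
    ∃ j : Fin 2, octMatrix i * twiceQ = twiceRefl (![18, 19] j) := by
  revert i
  decide +kernel

theorem octMatrix_conj_twiceRefl (i : Fin 24) (j : Fin 2) :
    ∃ k, octMatrix i * twiceRefl (![18, 19] j) = twiceRefl k * octMatrix i := by
  revert i j
  decide +kernel

theorem coroot_not_proportional (i j : Fin 21) (hij : i ≠ j) :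
    ∃ a b, coroot i a * coroot j b ≠ coroot i b * coroot j a := by
  revert i j
  decide +kernel

/-! ### The linear group in the octahedral coordinates -/

/-- The reflection in a root. -/
noncomputable def reflX (i : Fin 21) : Matrix (Fin 3) (Fin 3) ℂ :=
  (1 / 2 : ℂ) • toComplexMatrix (twiceRefl i)

theorem toComplexMatrix_natCast (n : ℕ) [n.AtLeastTwo] :
    toComplexMatrix (OfNat.ofNat n) = (OfNat.ofNat n : ℂ) • (1 : Matrix (Fin 3) (Fin 3) ℂ) := by
  rw [map_ofNat, ← Algebra.algebraMap_eq_smul_one, map_ofNat]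

theorem toComplexMatrix_twiceRefl (i : Fin 21) :
    toComplexMatrix (twiceRefl i) = (2 : ℂ) • reflX i := by
  rw [reflX, smul_smul]
  norm_num

theorem reflX_mul_self (i : Fin 21) : reflX i * reflX i = 1 := by
  have h := congrArg toComplexMatrix (twiceRefl_mul_self i)
  rw [map_mul, toComplexMatrix_natCast] at h
  rw [reflX, smul_mul_assoc, mul_smul_comm, h, smul_smul, smul_smul]
  norm_num

/-- The reflection in a root as an invertible matrix. -/
noncomputable def reflUnitX (i : Fin 21) : GL (Fin 3) ℂ :=
  ⟨reflX i, reflX i, reflX_mul_self i, reflX_mul_self i⟩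

/-- An octahedral rotation as an invertible matrix. -/
noncomputable def octUnit (i : Fin 24) : GL (Fin 3) ℂ :=
  Matrix.GeneralLinearGroup.mkOfDetNeZero (toComplexMatrix (octMatrix i)) (by
    rw [(mem_octahedralMatrices_iff.mpr ⟨i, rfl⟩ : _ ∈ octahedralMatrices).1]
    exact one_ne_zero)

/-- The matrix `Q` as an invertible matrix. -/
noncomputable def unitQ : GL (Fin 3) ℂ :=
  Matrix.GeneralLinearGroup.mkOfDetNeZero matrixQ (by rw [matrixQ_det]; exact one_ne_zero)

theorem octUnit_mem (i : Fin 24) : octUnit i ∈ linearGroupX :=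
  Subgroup.subset_closure (Or.inl (mem_octahedralMatrices_iff.mpr ⟨i, rfl⟩))

theorem unitQ_mem : unitQ ∈ linearGroupX := Subgroup.subset_closure (Or.inr rfl)

theorem reflUnitX_mem (i : Fin 21) : reflUnitX i ∈ linearGroupX := by
  rcases twiceRefl_octahedral_or i with ⟨a, h⟩ | ⟨a, b, h⟩
  · have h1 : reflUnitX i = octUnit a := by
      ext1
      change reflX i = toComplexMatrix (octMatrix a)
      rw [reflX, h, map_mul, toComplexMatrix_natCast, smul_mul_assoc, one_mul, smul_smul]
      norm_num
    rw [h1]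
    exact octUnit_mem a
  · have h1 : reflUnitX i = octUnit a * unitQ * octUnit b := by
      ext1
      change reflX i = toComplexMatrix (octMatrix a) * matrixQ * toComplexMatrix (octMatrix b)
      rw [reflX, h, map_mul, map_mul, toComplexMatrix_twiceQ, mul_smul_comm, smul_mul_assoc,
        smul_smul]
      norm_num
    rw [h1]
    exact mul_mem (mul_mem (octUnit_mem a) unitQ_mem) (octUnit_mem b)

theorem linearGroupX_le_closure_reflUnitX :
    linearGroupX ≤ Subgroup.closure (Set.range reflUnitX) := by
  refine (Subgroup.closure_le _).mpr ?_
  have key (g : GL (Fin 3) ℂ) (a b : Fin 21) (h : g.1 = reflX a * reflX b) :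
      g ∈ Subgroup.closure (Set.range reflUnitX) := by
    have h1 : g = reflUnitX a * reflUnitX b := by
      ext1
      exact h
    rw [h1]
    exact mul_mem (Subgroup.subset_closure ⟨a, rfl⟩) (Subgroup.subset_closure ⟨b, rfl⟩)
  rintro g (hg | hg)
  · obtain ⟨i, hi⟩ := mem_octahedralMatrices_iff.mp hg
    obtain ⟨a, b, h⟩ := exists_twiceRefl_mul_eq_octMatrix i
    refine key g a b ?_
    rw [hi, reflX, reflX, smul_mul_assoc, mul_smul_comm, ← map_mul, h, map_mul,
      toComplexMatrix_natCast, smul_mul_assoc, one_mul, smul_smul, smul_smul]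
    norm_num
  · refine key g 5 19 ?_
    rw [hg, reflX, reflX, smul_mul_assoc, mul_smul_comm, ← map_mul, twiceRefl_mul_eq_twiceQ,
      map_mul, toComplexMatrix_natCast, toComplexMatrix_twiceQ, smul_mul_assoc, one_mul, smul_smul,
      smul_smul, smul_smul]
    norm_num

/-! ### The group as a union of two double cosets -/

/-- The matrices `A` and `A Q B` with octahedral rotations `A` and `B`. -/
def IsInDoubleCosets (m : Matrix (Fin 3) (Fin 3) ℂ) : Prop :=
  (∃ a, m = toComplexMatrix (octMatrix a)) ∨
    ∃ a b, m = toComplexMatrix (octMatrix a) * matrixQ * toComplexMatrix (octMatrix b)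

theorem IsInDoubleCosets.octMatrix_mul {m : Matrix (Fin 3) (Fin 3) ℂ} (h : IsInDoubleCosets m)
    (i : Fin 24) : IsInDoubleCosets (toComplexMatrix (octMatrix i) * m) := by
  rcases h with ⟨a, rfl⟩ | ⟨a, b, rfl⟩
  · obtain ⟨c, hc⟩ := KleinHeptic.octMatrix_mul i a
    exact Or.inl ⟨c, by rw [← hc, map_mul]⟩
  · obtain ⟨c, hc⟩ := KleinHeptic.octMatrix_mul i a
    exact Or.inr ⟨c, b, by rw [← hc, map_mul]; simp only [mul_assoc]⟩

theorem IsInDoubleCosets.mul_octMatrix {m : Matrix (Fin 3) (Fin 3) ℂ} (h : IsInDoubleCosets m)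
    (i : Fin 24) : IsInDoubleCosets (m * toComplexMatrix (octMatrix i)) := by
  rcases h with ⟨a, rfl⟩ | ⟨a, b, rfl⟩
  · obtain ⟨c, hc⟩ := KleinHeptic.octMatrix_mul a i
    exact Or.inl ⟨c, by rw [← hc, map_mul]⟩
  · obtain ⟨c, hc⟩ := KleinHeptic.octMatrix_mul b i
    exact Or.inr ⟨a, c, by rw [← hc, map_mul]; simp only [mul_assoc]⟩

theorem IsInDoubleCosets.matrixQ_mul {m : Matrix (Fin 3) (Fin 3) ℂ} (h : IsInDoubleCosets m) :
    IsInDoubleCosets (matrixQ * m) := by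
  rcases h with ⟨a, rfl⟩ | ⟨a, b, rfl⟩
  · refine Or.inr ⟨0, a, ?_⟩
    rw [octMatrix_zero, map_one, one_mul]
  · have h1 : IsInDoubleCosets (matrixQ * toComplexMatrix (octMatrix a) * matrixQ) := by
      have h2 : toComplexMatrix (twiceQ * octMatrix a * twiceQ) =
          (4 : ℂ) • (matrixQ * toComplexMatrix (octMatrix a) * matrixQ) := by
        rw [map_mul, map_mul, toComplexMatrix_twiceQ, smul_mul_assoc, smul_mul_assoc,
          mul_smul_comm, smul_smul]
        norm_num
      rcases twiceQ_mul_octMatrix_mul_twiceQ a with ⟨c, hc⟩ | ⟨c, d, hc⟩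
      · refine Or.inl ⟨c, ?_⟩
        rw [hc, map_mul, toComplexMatrix_natCast, smul_mul_assoc, one_mul] at h2
        exact (smul_right_injective _ (by norm_num : (4 : ℂ) ≠ 0) h2).symm
      · refine Or.inr ⟨c, d, ?_⟩
        rw [hc, map_mul, map_mul, map_mul, toComplexMatrix_natCast, toComplexMatrix_twiceQ,
          smul_mul_assoc, one_mul, mul_smul_comm, smul_mul_assoc, smul_smul] at h2
        norm_num at h2
        exact h2.symm
    have h3 := h1.mul_octMatrix b
    simp only [mul_assoc] at h3 ⊢
    exact h3

/-- The set consisting of all A and A Q B contains 1 and is stable under left multiplication by the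
generators and their inverses, where Q⁻¹ = Q³. It therefore contains the generated group, which
leaves finitely many matrices to inspect. -/
theorem isInDoubleCosets_of_mem {g : GL (Fin 3) ℂ} (hg : g ∈ linearGroupX) :
    IsInDoubleCosets g.1 := by
  refine Subgroup.closure_induction_left (p := fun g _ => IsInDoubleCosets g.1) ?_ ?_ ?_ hg
  · exact Or.inl ⟨0, by rw [octMatrix_zero, map_one]; rfl⟩
  · rintro x (hx | hx) y - hy
    · obtain ⟨i, hi⟩ := mem_octahedralMatrices_iff.mp hx
      rw [Units.val_mul, hi]
      exact hy.octMatrix_mul i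
    · rw [Units.val_mul, hx]
      exact hy.matrixQ_mul
  · rintro x (hx | hx) y - hy
    · obtain ⟨i, hi⟩ := mem_octahedralMatrices_iff.mp hx
      obtain ⟨j, hj⟩ := octMatrix_inv i
      have h1 : (x⁻¹).1 = toComplexMatrix (octMatrix j) := by
        rw [← mul_one (toComplexMatrix (octMatrix j)), ← x.mul_inv, ← mul_assoc, hi, ← map_mul, hj,
          map_one, one_mul]
      rw [Units.val_mul, h1]
      exact hy.octMatrix_mul j
    · have h1 : (x⁻¹).1 = matrixQ * matrixQ * matrixQ := by
        have h2 : matrixQ * matrixQ * matrixQ * x.1 = 1 := by rw [hx, matrixQ_pow_four]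
        rw [← mul_one (matrixQ * matrixQ * matrixQ), ← x.mul_inv, ← mul_assoc, h2, one_mul]
      rw [Units.val_mul, h1, mul_assoc, mul_assoc]
      exact hy.matrixQ_mul.matrixQ_mul.matrixQ_mul

theorem toComplexMatrix_ne_scalar_of_apply_ne_zero {A : Matrix (Fin 3) (Fin 3) ZTheta} {a b : Fin 3}
    (hab : a ≠ b) (hA : A a b ≠ 0) (c : ℂ) : toComplexMatrix A ≠ c • 1 := by
  intro h
  have h1 := congrFun (congrFun h a) b
  rw [Matrix.smul_apply, Matrix.one_apply_ne hab, smul_zero] at h1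
  exact hA (toComplex_injective (h1.trans (map_zero _).symm))

theorem toComplexMatrix_ne_scalar_of_apply_ne {A : Matrix (Fin 3) (Fin 3) ZTheta} {a b : Fin 3}
    (hA : A a a ≠ A b b) (c : ℂ) : toComplexMatrix A ≠ c • 1 := by
  intro h
  have h1 := congrFun (congrFun h a) a
  have h2 := congrFun (congrFun h b) b
  rw [Matrix.smul_apply, Matrix.one_apply_eq] at h1 h2
  exact hA (toComplex_injective (h1.trans h2.symm))

/-- The involutions in the projective group come from reflections. -/
theorem eq_one_or_reflX_of_sq_scalar {g : GL (Fin 3) ℂ} (hg : g ∈ linearGroupX) {c : ℂ}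
    (hc : g.1 * g.1 = c • 1) : g = 1 ∨ ∃ j, g = reflUnitX j := by
  rcases isInDoubleCosets_of_mem hg with ⟨a, ha⟩ | ⟨a, b, hab⟩
  · rw [ha, ← map_mul] at hc
    rcases octMatrix_sq a with h | ⟨i, j, hij, h⟩ | ⟨i, j, h⟩ | ⟨j, h⟩
    · left
      ext1
      rw [ha, h, map_one]
      rfl
    · exact absurd hc (toComplexMatrix_ne_scalar_of_apply_ne_zero hij h c)
    · exact absurd hc (toComplexMatrix_ne_scalar_of_apply_ne h c)
    · right
      refine ⟨j, ?_⟩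
      ext1
      change g.1 = reflX j
      rw [ha, reflX, h, map_mul, toComplexMatrix_natCast, smul_mul_assoc, one_mul, smul_smul]
      norm_num
  · right
    -- Conjugation by B turns A Q B into (B A) Q without affecting whether the square is scalar.
    -- Only 24 matrices remain.
    obtain ⟨d, hd⟩ := octMatrix_mul b a
    obtain ⟨e, he⟩ := octMatrix_inv b
    have he1 : toComplexMatrix (octMatrix e) * toComplexMatrix (octMatrix b) = 1 := by
      rw [← map_mul, he, map_one]
    have he2 := mul_eq_one_comm.mp he1
    have h1 : g.1 = toComplexMatrix (octMatrix e) * (toComplexMatrix (octMatrix d) * matrixQ) *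
        toComplexMatrix (octMatrix b) := by
      rw [hab, ← hd, map_mul]
      simp only [← mul_assoc]
      rw [he1, one_mul]
    have h2 : toComplexMatrix (octMatrix d * twiceQ * (octMatrix d * twiceQ)) = (4 * c) • 1 := by
      have h3 : toComplexMatrix (octMatrix b) * (g.1 * g.1) * toComplexMatrix (octMatrix e) =
          (toComplexMatrix (octMatrix d) * matrixQ) * (toComplexMatrix (octMatrix d) * matrixQ) := by
        rw [h1]
        calc _ = (toComplexMatrix (octMatrix b) * toComplexMatrix (octMatrix e)) *
              (toComplexMatrix (octMatrix d) * matrixQ) *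
              (toComplexMatrix (octMatrix b) * toComplexMatrix (octMatrix e)) *
              (toComplexMatrix (octMatrix d) * matrixQ) *
              (toComplexMatrix (octMatrix b) * toComplexMatrix (octMatrix e)) := by
              simp only [mul_assoc]
          _ = _ := by rw [he2]; simp only [one_mul, mul_one]
      rw [hc, mul_smul_comm, mul_one, smul_mul_assoc, he2] at h3
      rw [map_mul, map_mul, toComplexMatrix_twiceQ, mul_smul_comm, smul_mul_assoc, mul_smul_comm,
        ← h3, smul_smul, smul_smul]
      norm_num
    rcases octMatrix_mul_twiceQ_sq d with ⟨i, j, hij, h⟩ | ⟨j, h⟩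
    · exact absurd h2 (toComplexMatrix_ne_scalar_of_apply_ne_zero hij h _)
    · obtain ⟨k, hk⟩ := octMatrix_conj_twiceRefl e j
      refine ⟨k, ?_⟩
      ext1
      change g.1 = reflX k
      have h4 : toComplexMatrix (octMatrix d) * matrixQ = reflX (![18, 19] j) := by
        rw [reflX, ← h, map_mul, toComplexMatrix_twiceQ, mul_smul_comm, smul_smul]
        norm_num
      have h5 : toComplexMatrix (octMatrix e) * reflX (![18, 19] j) =
          reflX k * toComplexMatrix (octMatrix e) := by
        rw [reflX, reflX, mul_smul_comm, smul_mul_assoc, ← map_mul, ← map_mul, hk]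
      rw [h1, h4, h5, mul_assoc, he1, mul_one]

/-! ### Reflections in the coordinates `y` -/

/-- The reflection in a root, in the coordinates `y`. -/
noncomputable def refl (i : Fin 21) : GL (Fin 3) ℂ := coordChange⁻¹ * reflUnitX i * coordChange

/-- The linear form that defines the line of a reflection. -/
noncomputable def reflForm (i : Fin 21) : Fin 3 → ℂ :=
  (fun j => toComplex (coroot i j)) ᵥ* coordChange.1

/-- The isolated fixed point of a reflection. -/
noncomputable def reflCenter (i : Fin 21) : Fin 3 → ℂ :=
  (coordChange⁻¹).1 *ᵥ fun j => toComplex (root i j)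

theorem mem_linearGroup_iff {g : GL (Fin 3) ℂ} :
    g ∈ linearGroup ↔ coordChange * g * coordChange⁻¹ ∈ linearGroupX := Iff.rfl

theorem refl_mem (i : Fin 21) : refl i ∈ linearGroup := by
  rw [mem_linearGroup_iff, refl]
  simpa [mul_assoc] using reflUnitX_mem i

theorem refl_mul_self (i : Fin 21) : refl i * refl i = 1 := by
  have h : reflUnitX i * reflUnitX i = 1 := by
    ext1
    exact reflX_mul_self i
  calc refl i * refl i = coordChange⁻¹ * (reflUnitX i * reflUnitX i) * coordChange := by
        simp only [refl]
        group
    _ = 1 := by rw [h]; group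

theorem linearGroup_le_closure_refl : linearGroup ≤ Subgroup.closure (Set.range refl) := by
  intro g hg
  have h1 := linearGroupX_le_closure_reflUnitX hg
  have h2 : Subgroup.closure (Set.range reflUnitX) ≤
      (Subgroup.closure (Set.range refl)).comap (MulAut.conj coordChange⁻¹).toMonoidHom := by
    refine (Subgroup.closure_le _).mpr ?_
    rintro _ ⟨i, rfl⟩
    refine Subgroup.subset_closure ⟨i, ?_⟩
    simp [refl]
  have h3 := h2 h1
  simpa [Subgroup.mem_comap, mul_assoc] using h3

/-- The reflection in a root r of squared length 4 is x ↦ (1/2)⟨r, x⟩ r - x. It fixes r and is -1 on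
the orthogonal plane, hence has determinant 1 and fixes a projective line pointwise. -/
theorem refl_eq (i : Fin 21) :
    (refl i).1 = (1 / 2 : ℂ) • Matrix.vecMulVec (reflCenter i) (reflForm i) - 1 := by
  have h1 : reflX i = (1 / 2 : ℂ) • Matrix.vecMulVec (fun j => toComplex (root i j))
      (fun j => toComplex (coroot i j)) - 1 := by
    rw [reflX, twiceRefl, map_sub, toComplexMatrix_natCast, smul_sub, smul_smul]
    congr 1
    · congr 1
      ext1 j k
      simp [toComplexMatrix, Matrix.vecMulVec_apply]
    · norm_num
  have h2 : (refl i).1 = (coordChange⁻¹).1 * reflX i * coordChange.1 := rfl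
  rw [h2, h1, mul_sub, sub_mul, mul_one, Units.inv_mul, mul_smul_comm, smul_mul_assoc,
    Matrix.mul_vecMulVec, Matrix.vecMulVec_mul]
  rfl

theorem coroot_dot_root (i : Fin 21) : coroot i ⬝ᵥ root i = 4 := by
  revert i
  decide +kernel

theorem reflForm_dot_reflCenter (i : Fin 21) : reflForm i ⬝ᵥ reflCenter i = 4 := by
  rw [reflForm, reflCenter, ← Matrix.dotProduct_mulVec, Matrix.mulVec_mulVec, Units.mul_inv,
    Matrix.one_mulVec]
  have h := congrArg toComplex (coroot_dot_root i)
  rw [map_ofNat] at h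
  simpa [dotProduct] using h

theorem reflForm_ne_zero (i : Fin 21) : reflForm i ≠ 0 := by
  intro h
  have h1 := reflForm_dot_reflCenter i
  rw [h, zero_dotProduct] at h1
  norm_num at h1

theorem refl_mulVec (i : Fin 21) (v : Fin 3 → ℂ) :
    (refl i).1 *ᵥ v = ((1 / 2 : ℂ) * (reflForm i ⬝ᵥ v)) • reflCenter i - v := by
  rw [refl_eq, Matrix.sub_mulVec, Matrix.one_mulVec, Matrix.smul_mulVec, Matrix.vecMulVec_mulVec,
    op_smul_eq_smul, smul_smul]

/-- The reflections are conjugate in the group. -/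
theorem exists_conj_refl (i : Fin 21) : ∃ k ∈ linearGroup, ∃ s : ℂ, s ≠ 0 ∧
    k * refl 0 = refl i * k ∧ reflForm i ᵥ* k.1 = s • reflForm 0 := by
  obtain ⟨a, b, s, h1, h2⟩ := exists_twiceRefl_transitive i
  refine ⟨refl a * refl b, mul_mem (refl_mem a) (refl_mem b), (s : ℤ), ?_, ?_, ?_⟩
  · exact_mod_cast s.ne_zero
  · have h3 : reflUnitX a * reflUnitX b * reflUnitX 0 =
        reflUnitX i * (reflUnitX a * reflUnitX b) := by
      ext1
      change reflX a * reflX b * reflX 0 = reflX i * (reflX a * reflX b)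
      have h4 := congrArg toComplexMatrix h1
      simp only [map_mul, toComplexMatrix_twiceRefl, smul_mul_assoc, mul_smul_comm,
        smul_smul] at h4
      norm_num at h4
      exact h4
    calc refl a * refl b * refl 0
        = coordChange⁻¹ * (reflUnitX a * reflUnitX b * reflUnitX 0) * coordChange := by
          simp only [refl]
          group
      _ = refl i * (refl a * refl b) := by
          rw [h3]
          simp only [refl]
          group
  · have h3 : (refl a * refl b).1 =
        (coordChange⁻¹).1 * (reflX a * reflX b) * coordChange.1 := by
      have : refl a * refl b = coordChange⁻¹ * (reflUnitX a * reflUnitX b) * coordChange := by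
        simp only [refl]
        group
      rw [this]
      rfl
    have h4 : (fun j => toComplex (coroot i j)) ᵥ* (reflX a * reflX b) =
        ((s : ℤ) : ℂ) • fun j => toComplex (coroot 0 j) := by
      have h5 : reflX a * reflX b =
          (1 / 4 : ℂ) • (twiceRefl a * twiceRefl b).map toComplex := by
        rw [reflX, reflX, smul_mul_assoc, mul_smul_comm, ← map_mul, smul_smul]
        norm_num
        rfl
      rw [h5, Matrix.vecMul_smul]
      funext j
      have h6 := congrArg toComplex (congrFun h2 j)
      have h7 : ((fun j => toComplex (coroot i j)) ᵥ*
          (twiceRefl a * twiceRefl b).map toComplex) j =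
          toComplex ((coroot i ᵥ* (twiceRefl a * twiceRefl b)) j) := by
        rw [RingHom.map_vecMul]
        rfl
      rw [Pi.smul_apply, h7, h6, map_mul, map_intCast]
      simp
      ring
    rw [h3, reflForm, Matrix.vecMul_vecMul, ← mul_assoc, ← mul_assoc, Units.mul_inv, one_mul,
      ← Matrix.vecMul_vecMul, h4, Matrix.smul_vecMul]
    rfl

/-! ### Involutions and the lines they fix -/

theorem eq_smul_of_mul_eq_mul {a b : Fin 3 → ℂ} (hb : b ≠ 0)
    (h : ∀ i j, a i * b j = a j * b i) : ∃ s : ℂ, a = s • b := by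
  obtain ⟨j, hj⟩ := Function.ne_iff.mp hb
  simp only [Pi.zero_apply] at hj
  refine ⟨a j / b j, funext fun i => ?_⟩
  rw [Pi.smul_apply, smul_eq_mul, div_mul_eq_mul_div, eq_div_iff hj]
  exact h i j

/-- The vector with a i in position j and -a j in position i lies in the kernel of a; applying b to
it gives the identity. -/
theorem mul_eq_mul_of_ker_le {a b : Fin 3 → ℂ}
    (h : ∀ v, v ≠ 0 → a ⬝ᵥ v = 0 → b ⬝ᵥ v = 0) (i j : Fin 3) : a i * b j = a j * b i := by
  have h' (v : Fin 3 → ℂ) (hv : a ⬝ᵥ v = 0) : b ⬝ᵥ v = 0 := by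
    by_cases h0 : v = 0
    · rw [h0, dotProduct_zero]
    · exact h v h0 hv
  have h1 := h' (Pi.single j (a i) - Pi.single i (a j)) (by
    rw [dotProduct_sub, dotProduct_single, dotProduct_single]
    ring)
  rw [dotProduct_sub, dotProduct_single, dotProduct_single] at h1
  linear_combination h1

theorem reflForm_not_proportional {i j : Fin 21} (hij : i ≠ j) (s : ℂ) :
    reflForm i ≠ s • reflForm j := by
  intro h
  obtain ⟨a, b, hab⟩ := coroot_not_proportional i j hij
  have h1 : (fun k => toComplex (coroot i k)) = s • fun k => toComplex (coroot j k) := by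
    have h2 := congrArg (fun v => v ᵥ* (coordChange⁻¹).1) h
    simpa [reflForm, Matrix.smul_vecMul, Matrix.vecMul_vecMul, ← Units.val_mul] using h2
  apply hab
  apply toComplex_injective
  have ha := congrFun h1 a
  have hb := congrFun h1 b
  simp only [Pi.smul_apply, smul_eq_mul] at ha hb
  rw [map_mul, map_mul, ha, hb]
  ring

theorem mk_mem_projLine {a v : Fin 3 → ℂ} (hv : v ≠ 0) :
    Projectivization.mk ℂ v hv ∈ projLine a ↔ a ⬝ᵥ v = 0 := by
  obtain ⟨c, hc⟩ := Projectivization.exists_smul_eq_mk_rep ℂ v hv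
  change a ⬝ᵥ (Projectivization.mk ℂ v hv).rep = 0 ↔ _
  rw [← hc, Units.smul_def, dotProduct_smul, smul_eq_mul]
  simp

theorem projLine_smul {s : ℂ} (hs : s ≠ 0) (a : Fin 3 → ℂ) : projLine (s • a) = projLine a := by
  ext p
  change (s • a) ⬝ᵥ p.rep = 0 ↔ a ⬝ᵥ p.rep = 0
  rw [smul_dotProduct, smul_eq_mul]
  simp [hs]

theorem refl_smul_mk {i : Fin 21} {v : Fin 3 → ℂ} (hv : v ≠ 0) (h : reflForm i ⬝ᵥ v = 0) :
    Matrix.ProjGenLinGroup.mk (refl i) • Projectivization.mk ℂ v hv =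
      Projectivization.mk ℂ v hv := by
  rw [Projectivization.PGL.mk_smul_mk, Projectivization.mk_eq_mk_iff']
  refine ⟨-1, ?_⟩
  change _ = (refl i).1 *ᵥ v
  rw [refl_mulVec, h]
  simp

/-- A scalar matrix would have a single eigenvalue, but the centre has eigenvalue 1 and vectors on
the reflection line have eigenvalue -1. -/
theorem mk_refl_ne_one (i : Fin 21) : Matrix.ProjGenLinGroup.mk (refl i) ≠ 1 := by
  intro h
  rw [Matrix.ProjGenLinGroup.mk_eq_one, Matrix.GeneralLinearGroup.center_eq_range_scalar] at h
  obtain ⟨u, hu⟩ := h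
  have h1 (v : Fin 3 → ℂ) : (refl i).1 *ᵥ v = u.1 • v := by
    rw [← hu]
    simp [← Matrix.smul_one_eq_diagonal, Matrix.smul_mulVec]
  have hn : reflCenter i ≠ 0 := fun h0 => by
    have := reflForm_dot_reflCenter i
    rw [h0, dotProduct_zero] at this
    norm_num at this
  have h2 : u.1 = 1 := by
    have h3 := h1 (reflCenter i)
    rw [refl_mulVec, reflForm_dot_reflCenter] at h3
    have h4 : (1 : ℂ) • reflCenter i = u.1 • reflCenter i := by
      rw [← h3]
      module
    exact (smul_left_injective ℂ hn h4).symm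
  have h3 (v : Fin 3 → ℂ) : ((1 / 2 : ℂ) * (reflForm i ⬝ᵥ v)) • reflCenter i = (2 : ℂ) • v := by
    have h4 := h1 v
    rw [refl_mulVec, h2, sub_eq_iff_eq_add] at h4
    rw [h4]
    module
  obtain ⟨v, hv, hv0⟩ : ∃ v : Fin 3 → ℂ, v ≠ 0 ∧ reflForm i ⬝ᵥ v = 0 := by
    by_contra! hcon
    have h5 (b : Fin 3 → ℂ) (k l : Fin 3) : reflForm i k * b l = reflForm i l * b k :=
      mul_eq_mul_of_ker_le (fun v hv hv0 => absurd hv0 (hcon v hv)) k l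
    obtain ⟨k, hk⟩ := Function.ne_iff.mp (reflForm_ne_zero i)
    -- Addition in `Fin 3` is cyclic, so k + 1 ≠ k and this basis vector has k-th entry 0.
    have h6 := h5 (Pi.single (k + 1) 1) k (k + 1)
    rw [Pi.single_eq_same, Pi.single_eq_of_ne (by fin_cases k <;> decide)] at h6
    simp at h6
    exact hk h6
  have h4 := h3 v
  rw [hv0, mul_zero, zero_smul] at h4
  exact hv ((smul_eq_zero.mp h4.symm).resolve_left two_ne_zero)

theorem isReflectionForm_smul_reflForm (i : Fin 21) {s : ℂ} (hs : s ≠ 0) :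
    IsReflectionForm (s • reflForm i) := by
  refine ⟨smul_ne_zero hs (reflForm_ne_zero i), Matrix.ProjGenLinGroup.mk (refl i),
    ⟨refl i, refl_mem i, rfl⟩, mk_refl_ne_one i, ?_, ?_⟩
  · rw [← map_mul, refl_mul_self, map_one]
  · intro p hp
    induction p using Projectivization.ind with | h v hv =>
    rw [projLine_smul hs, mk_mem_projLine] at hp
    exact refl_smul_mk hv hp

/-- A lift of an involution has scalar square, so it is one of the 21 reflections. The fixed points
of a reflection are its line and one isolated centre, so the only line fixed pointwise is its own.
-/
theorem isReflectionForm_iff {a : Fin 3 → ℂ} :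
    IsReflectionForm a ↔ ∃ i, ∃ s : ℂ, s ≠ 0 ∧ a = s • reflForm i := by
  constructor
  · rintro ⟨ha, T, ⟨g, hg, rfl⟩, hT1, hT2, hfix⟩
    rw [← map_mul, Matrix.ProjGenLinGroup.mk_eq_one,
      Matrix.GeneralLinearGroup.center_eq_range_scalar] at hT2
    obtain ⟨u, hu⟩ := hT2
    have hsq : (coordChange * g * coordChange⁻¹).1 * (coordChange * g * coordChange⁻¹).1 =
        u.1 • 1 := by
      have h1 : (g * g).1 = u.1 • 1 := by
        rw [← hu]
        simp [← Matrix.smul_one_eq_diagonal]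
      have h2 : coordChange * g * coordChange⁻¹ * (coordChange * g * coordChange⁻¹) =
          coordChange * (g * g) * coordChange⁻¹ := by group
      rw [← Units.val_mul, h2, Units.val_mul, Units.val_mul, h1, mul_smul_comm, mul_one,
        smul_mul_assoc, Units.mul_inv]
    rcases eq_one_or_reflX_of_sq_scalar hg hsq with h | ⟨j, hj⟩
    · exfalso
      apply hT1
      have h1 : g = 1 := by simpa [mul_inv_eq_one] using h
      rw [h1, map_one]
    · have hgj : g = refl j := by
        rw [refl, ← hj]
        simp [mul_assoc]
      subst hgj
      -- A fixed point off the line of the reflection is its centre.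
      have hpar (v : Fin 3 → ℂ) (hav : a ⬝ᵥ v = 0) (hv : reflForm j ⬝ᵥ v ≠ 0) :
          ∃ c : ℂ, c • v = reflCenter j := by
        have hv0 : v ≠ 0 := by
          rintro rfl
          simp at hv
        have h1 := hfix _ ((mk_mem_projLine hv0).mpr hav)
        rw [Projectivization.PGL.mk_smul_mk, Projectivization.mk_eq_mk_iff'] at h1
        obtain ⟨c, hc⟩ := h1
        change c • v = (refl j).1 *ᵥ v at hc
        rw [refl_mulVec, eq_sub_iff_add_eq] at hc
        have hc' : (c + 1) • v = ((1 / 2 : ℂ) * (reflForm j ⬝ᵥ v)) • reflCenter j := by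
          rw [← hc]
          module
        refine ⟨((1 / 2 : ℂ) * (reflForm j ⬝ᵥ v))⁻¹ * (c + 1), ?_⟩
        rw [mul_smul, hc', smul_smul, inv_mul_cancel₀ (mul_ne_zero (by norm_num) hv), one_smul]
      have key : ∀ k l, a k * reflForm j l = a l * reflForm j k := by
        by_cases hall : ∀ v, v ≠ 0 → a ⬝ᵥ v = 0 → reflForm j ⬝ᵥ v = 0
        · exact mul_eq_mul_of_ker_le hall
        · push Not at hall
          obtain ⟨v, -, hav, hv⟩ := hall
          obtain ⟨c, hc⟩ := hpar v hav hv
          -- If w lies in both kernels, then v and v + w both represent the centre; comparing their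
          -- values under `reflForm j` forces w = 0.
          have h0 (w : Fin 3 → ℂ) (haw : a ⬝ᵥ w = 0) (hw : reflForm j ⬝ᵥ w = 0) : w = 0 := by
            have h1 : reflForm j ⬝ᵥ (v + w) ≠ 0 := by rwa [dotProduct_add, hw, add_zero]
            obtain ⟨d, hd⟩ := hpar (v + w) (by rw [dotProduct_add, hav, haw, add_zero]) h1
            have hd0 : d ≠ 0 := by
              rintro rfl
              have h4 := reflForm_dot_reflCenter j
              rw [← hd] at h4
              simp at h4
            have h2 : c = d := by
              have h3 := congrArg (fun x => reflForm j ⬝ᵥ x) (hc.trans hd.symm)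
              simp only [dotProduct_smul, dotProduct_add, hw, add_zero, smul_eq_mul] at h3
              exact mul_right_cancel₀ hv h3
            have h3 := hc.trans hd.symm
            rw [h2, smul_add, left_eq_add] at h3
            exact (smul_eq_zero.mp h3).resolve_left hd0
          -- The cross product lies in both kernels, so it vanishes, which is exactly
          -- proportionality of the two forms.
          have h5 := h0 ![a 1 * reflForm j 2 - a 2 * reflForm j 1,
            a 2 * reflForm j 0 - a 0 * reflForm j 2, a 0 * reflForm j 1 - a 1 * reflForm j 0]
            (by simp [dotProduct, Fin.sum_univ_three]; ring)
            (by simp [dotProduct, Fin.sum_univ_three]; ring)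
          have e0 := congrFun h5 0
          have e1 := congrFun h5 1
          have e2 := congrFun h5 2
          simp at e0 e1 e2
          intro k l
          fin_cases k <;> fin_cases l <;> simp <;>
            first | ring1 | linear_combination e0 | linear_combination -e0 | linear_combination e1 |
              linear_combination -e1 | linear_combination e2 | linear_combination -e2
      obtain ⟨s, hs⟩ := eq_smul_of_mul_eq_mul (reflForm_ne_zero j) key
      refine ⟨j, s, ?_, hs⟩
      rintro rfl
      rw [zero_smul] at hs
      exact ha hs
  · rintro ⟨i, s, hs, rfl⟩
    exact isReflectionForm_smul_reflForm i hs

theorem reflectionLines_eq : reflectionLines = Set.range fun i => projLine (reflForm i) := by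
  ext L
  constructor
  · rintro ⟨a, ha, rfl⟩
    obtain ⟨i, s, hs, rfl⟩ := isReflectionForm_iff.mp ha
    exact ⟨i, (projLine_smul hs _).symm⟩
  · rintro ⟨i, rfl⟩
    exact ⟨reflForm i, isReflectionForm_iff.mpr ⟨i, 1, one_ne_zero, (one_smul _ _).symm⟩, rfl⟩

theorem projLine_reflForm_injective : Function.Injective fun i => projLine (reflForm i) := by
  intro i j h
  by_contra hij
  have h1 : ∀ v, v ≠ 0 → reflForm i ⬝ᵥ v = 0 → reflForm j ⬝ᵥ v = 0 := by
    intro v hv hiv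
    have h2 := (mk_mem_projLine hv).mpr hiv
    simp only at h
    rw [h] at h2
    exact (mk_mem_projLine hv).mp h2
  obtain ⟨s, hs⟩ := eq_smul_of_mul_eq_mul (reflForm_ne_zero j) (mul_eq_mul_of_ker_le h1)
  exact reflForm_not_proportional hij s hs

theorem reflectionLines_ncard : reflectionLines.ncard = 21 := by
  rw [reflectionLines_eq, ← Set.image_univ,
    Set.ncard_image_of_injective _ projLine_reflForm_injective, Set.ncard_univ]
  simp

end KleinHeptic

namespace KleinHeptic

open MvPolynomial

/-! ### Explicit derivatives -/

/-- The partial derivative of a term. -/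
def derivTerm (i : Fin 3) (t : ℤ × ℕ × ℕ × ℕ) : ℤ × ℕ × ℕ × ℕ :=
  ![(t.1 * t.2.1, t.2.1 - 1, t.2.2.1, t.2.2.2), (t.1 * t.2.2.1, t.2.1, t.2.2.1 - 1, t.2.2.2),
    (t.1 * t.2.2.2, t.2.1, t.2.2.1, t.2.2.2 - 1)] i

theorem pderiv_ofTerms (i : Fin 3) (L : List (ℤ × ℕ × ℕ × ℕ)) :
    pderiv i (ofTerms L) = ofTerms (L.map (derivTerm i)) := by
  induction L with
  | nil => simp [ofTerms]
  | cons t L ih =>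
    rw [ofTerms] at ih ⊢
    have h : ofTerms (List.map (derivTerm i) (t :: L)) =
        ofTerms [derivTerm i t] + ofTerms (L.map (derivTerm i)) := by simp [ofTerms]
    rw [List.map_cons, List.sum_cons, map_add, ih, h]
    congr 1
    rw [ofTerms]
    fin_cases i <;> simp [derivTerm, pderiv_X] <;> ring

theorem eval_ofTerms (v : Fin 3 → ℂ) (L : List (ℤ × ℕ × ℕ × ℕ)) :
    eval v (ofTerms L) =
      (L.map fun t => (t.1 : ℂ) * v 0 ^ t.2.1 * v 1 ^ t.2.2.1 * v 2 ^ t.2.2.2).sum := by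
  induction L with
  | nil => simp [ofTerms]
  | cons t L ih =>
    rw [ofTerms] at ih ⊢
    rw [List.map_cons, List.sum_cons, map_add, ih, List.map_cons, List.sum_cons]
    simp

theorem eval_polyF (v : Fin 3 → ℂ) : eval v polyF = 3 * (v 0 ^ 4 + v 1 ^ 4) - 49 * v 2 ^ 4 -
    14 * v 0 ^ 3 * v 2 + 6 * v 0 ^ 2 * v 1 ^ 2 - 21 * (v 0 ^ 2 + v 1 ^ 2) * v 2 ^ 2 +
    42 * v 0 * v 1 ^ 2 * v 2 := by
  rw [polyF, eval_ofTerms]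
  simp
  ring

theorem gradient_polyF (v : Fin 3 → ℂ) : (fun i => eval v (gradient polyF i)) =
    ![12 * v 0 ^ 3 - 42 * v 0 ^ 2 * v 2 + 12 * v 0 * v 1 ^ 2 - 42 * v 0 * v 2 ^ 2 +
        42 * v 1 ^ 2 * v 2,
      12 * v 1 ^ 3 + 12 * v 0 ^ 2 * v 1 - 42 * v 1 * v 2 ^ 2 + 84 * v 0 * v 1 * v 2,
      -196 * v 2 ^ 3 - 14 * v 0 ^ 3 - 42 * v 0 ^ 2 * v 2 - 42 * v 1 ^ 2 * v 2 +
        42 * v 0 * v 1 ^ 2] := by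
  funext i
  rw [gradient, polyF, pderiv_ofTerms, eval_ofTerms]
  fin_cases i <;> simp [derivTerm] <;> ring

theorem hessian_polyF (v : Fin 3 → ℂ) : (hessian polyF).map (eval v) =
    !![36 * v 0 ^ 2 - 84 * v 0 * v 2 + 12 * v 1 ^ 2 - 42 * v 2 ^ 2,
        24 * v 0 * v 1 + 84 * v 1 * v 2,
        -42 * v 0 ^ 2 - 84 * v 0 * v 2 + 42 * v 1 ^ 2;
      24 * v 0 * v 1 + 84 * v 1 * v 2,
        36 * v 1 ^ 2 + 12 * v 0 ^ 2 - 42 * v 2 ^ 2 + 84 * v 0 * v 2,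
        -84 * v 1 * v 2 + 84 * v 0 * v 1;
      -42 * v 0 ^ 2 - 84 * v 0 * v 2 + 42 * v 1 ^ 2,
        -84 * v 1 * v 2 + 84 * v 0 * v 1,
        -588 * v 2 ^ 2 - 42 * v 0 ^ 2 - 42 * v 1 ^ 2] := by
  ext i j
  rw [Matrix.map_apply, hessian, Matrix.of_apply, polyF, pderiv_ofTerms, pderiv_ofTerms,
    eval_ofTerms]
  fin_cases i <;> fin_cases j <;> simp [derivTerm] <;> ring

theorem eval_det {n : Type*} [Fintype n] [DecidableEq n] (v : Fin 3 → ℂ) (A : Matrix n n Poly3) :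
    eval v A.det = (A.map (eval v)).det :=
  (eval v).map_det A

theorem polyPhi_eq : polyPhi = ofTerms [(26, 6, 0, 0), (210, 5, 0, 1), (330, 4, 2, 0),
    (315, 4, 0, 2), (-420, 3, 2, 1), (980, 3, 0, 3), (-90, 2, 4, 0), (630, 2, 2, 2),
    (-3675, 2, 0, 4), (-630, 1, 4, 1), (-2940, 1, 2, 3), (54, 0, 6, 0), (315, 0, 4, 2),
    (-3675, 0, 2, 4), (686, 0, 0, 6)] := by
  apply MvPolynomial.funext
  intro v
  have h : hessianF = hessian polyF := rfl
  rw [polyPhi, map_mul, eval_C, h, eval_det, hessian_polyF, eval_ofTerms, Matrix.det_fin_three]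
  simp
  ring

theorem eval_polyPhi (v : Fin 3 → ℂ) : eval v polyPhi = 26 * v 0 ^ 6 + 210 * v 0 ^ 5 * v 2 +
    330 * v 0 ^ 4 * v 1 ^ 2 + 315 * v 0 ^ 4 * v 2 ^ 2 - 420 * v 0 ^ 3 * v 1 ^ 2 * v 2 +
    980 * v 0 ^ 3 * v 2 ^ 3 - 90 * v 0 ^ 2 * v 1 ^ 4 + 630 * v 0 ^ 2 * v 1 ^ 2 * v 2 ^ 2 -
    3675 * v 0 ^ 2 * v 2 ^ 4 - 630 * v 0 * v 1 ^ 4 * v 2 - 2940 * v 0 * v 1 ^ 2 * v 2 ^ 3 +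
    54 * v 1 ^ 6 + 315 * v 1 ^ 4 * v 2 ^ 2 - 3675 * v 1 ^ 2 * v 2 ^ 4 + 686 * v 2 ^ 6 := by
  rw [polyPhi_eq, eval_ofTerms]
  simp
  ring

theorem gradient_polyPhi (v : Fin 3 → ℂ) : (fun i => eval v (gradient polyPhi i)) =
    ![156 * v 0 ^ 5 + 1050 * v 0 ^ 4 * v 2 + 1320 * v 0 ^ 3 * v 1 ^ 2 +
        1260 * v 0 ^ 3 * v 2 ^ 2 - 1260 * v 0 ^ 2 * v 1 ^ 2 * v 2 + 2940 * v 0 ^ 2 * v 2 ^ 3 -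
        180 * v 0 * v 1 ^ 4 + 1260 * v 0 * v 1 ^ 2 * v 2 ^ 2 - 7350 * v 0 * v 2 ^ 4 -
        630 * v 1 ^ 4 * v 2 - 2940 * v 1 ^ 2 * v 2 ^ 3,
      660 * v 0 ^ 4 * v 1 - 840 * v 0 ^ 3 * v 1 * v 2 - 360 * v 0 ^ 2 * v 1 ^ 3 +
        1260 * v 0 ^ 2 * v 1 * v 2 ^ 2 - 2520 * v 0 * v 1 ^ 3 * v 2 -
        5880 * v 0 * v 1 * v 2 ^ 3 + 324 * v 1 ^ 5 + 1260 * v 1 ^ 3 * v 2 ^ 2 -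
        7350 * v 1 * v 2 ^ 4,
      210 * v 0 ^ 5 + 630 * v 0 ^ 4 * v 2 - 420 * v 0 ^ 3 * v 1 ^ 2 +
        2940 * v 0 ^ 3 * v 2 ^ 2 + 1260 * v 0 ^ 2 * v 1 ^ 2 * v 2 - 14700 * v 0 ^ 2 * v 2 ^ 3 -
        630 * v 0 * v 1 ^ 4 - 8820 * v 0 * v 1 ^ 2 * v 2 ^ 2 + 630 * v 1 ^ 4 * v 2 -
        14700 * v 1 ^ 2 * v 2 ^ 3 + 4116 * v 2 ^ 5] := by
  funext i
  rw [gradient, polyPhi_eq, pderiv_ofTerms, eval_ofTerms]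
  fin_cases i <;> simp [derivTerm] <;> ring

theorem evalMap_adjHessianGradient (p q : Poly3) (v : Fin 3 → ℂ) :
    evalMap (adjHessianGradient p q) v =
      ((hessian p).map (eval v)).adjugate *ᵥ fun i => eval v (gradient q i) := by
  have h : ((hessian p).map (eval v)).adjugate = (hessian p).adjugate.map (eval v) :=
    ((eval v).map_adjugate (hessian p)).symm
  rw [h]
  funext i
  simp [evalMap, adjHessianGradient, Matrix.mulVec, dotProduct]

-- The explicit coefficients of g₉ hide the covariant adj(H(F)) ∇Φ, corrected by the trivial
-- equivariant F² id. Equivariance can be read off from this form.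
set_option maxHeartbeats 2000000 in
theorem mapG9_eq (v : Fin 3 → ℂ) : evalMap mapG9 v =
    (1 / 756 : ℂ) • evalMap (adjHessianGradient polyF polyPhi) v - (eval v polyF) ^ 2 • v := by
  rw [evalMap_adjHessianGradient, hessian_polyF, gradient_polyPhi, Matrix.adjugate_fin_three_of,
    eval_polyF]
  funext i
  rw [evalMap, mapG9]
  fin_cases i <;> simp [eval_ofTerms] <;> ring

theorem hessian_polyPhi (v : Fin 3 → ℂ) : (hessian polyPhi).map (eval v) =
    !![780 * v 0 ^ 4 + 4200 * v 0 ^ 3 * v 2 + 3960 * v 0 ^ 2 * v 1 ^ 2 + 3780 * v 0 ^ 2 * v 2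
          ^ 2 - 2520 * v 0 * v 1 ^ 2 * v 2 + 5880 * v 0 * v 2 ^ 3 - 180 * v 1 ^ 4 + 1260 * v 1 ^
          2 * v 2 ^ 2 - 7350 * v 2 ^ 4,
        2640 * v 0 ^ 3 * v 1 - 2520 * v 0 ^ 2 * v 1 * v 2 - 720 * v 0 * v 1 ^ 3 + 2520 * v 0 *
          v 1 * v 2 ^ 2 - 2520 * v 1 ^ 3 * v 2 - 5880 * v 1 * v 2 ^ 3,
        1050 * v 0 ^ 4 + 2520 * v 0 ^ 3 * v 2 - 1260 * v 0 ^ 2 * v 1 ^ 2 + 8820 * v 0 ^ 2 * v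
          2 ^ 2 + 2520 * v 0 * v 1 ^ 2 * v 2 - 29400 * v 0 * v 2 ^ 3 - 630 * v 1 ^ 4 - 8820 * v
          1 ^ 2 * v 2 ^ 2;
      2640 * v 0 ^ 3 * v 1 - 2520 * v 0 ^ 2 * v 1 * v 2 - 720 * v 0 * v 1 ^ 3 + 2520 * v 0 *
          v 1 * v 2 ^ 2 - 2520 * v 1 ^ 3 * v 2 - 5880 * v 1 * v 2 ^ 3,
        660 * v 0 ^ 4 - 840 * v 0 ^ 3 * v 2 - 1080 * v 0 ^ 2 * v 1 ^ 2 + 1260 * v 0 ^ 2 * v 2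
          ^ 2 - 7560 * v 0 * v 1 ^ 2 * v 2 - 5880 * v 0 * v 2 ^ 3 + 1620 * v 1 ^ 4 + 3780 * v 1
          ^ 2 * v 2 ^ 2 - 7350 * v 2 ^ 4,
        -840 * v 0 ^ 3 * v 1 + 2520 * v 0 ^ 2 * v 1 * v 2 - 2520 * v 0 * v 1 ^ 3 - 17640 * v 0
          * v 1 * v 2 ^ 2 + 2520 * v 1 ^ 3 * v 2 - 29400 * v 1 * v 2 ^ 3;
      1050 * v 0 ^ 4 + 2520 * v 0 ^ 3 * v 2 - 1260 * v 0 ^ 2 * v 1 ^ 2 + 8820 * v 0 ^ 2 * v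
          2 ^ 2 + 2520 * v 0 * v 1 ^ 2 * v 2 - 29400 * v 0 * v 2 ^ 3 - 630 * v 1 ^ 4 - 8820 * v
          1 ^ 2 * v 2 ^ 2,
        -840 * v 0 ^ 3 * v 1 + 2520 * v 0 ^ 2 * v 1 * v 2 - 2520 * v 0 * v 1 ^ 3 - 17640 * v 0
          * v 1 * v 2 ^ 2 + 2520 * v 1 ^ 3 * v 2 - 29400 * v 1 * v 2 ^ 3,
        630 * v 0 ^ 4 + 5880 * v 0 ^ 3 * v 2 + 1260 * v 0 ^ 2 * v 1 ^ 2 - 44100 * v 0 ^ 2 * v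
          2 ^ 2 - 17640 * v 0 * v 1 ^ 2 * v 2 + 630 * v 1 ^ 4 - 44100 * v 1 ^ 2 * v 2 ^ 2 +
          20580 * v 2 ^ 4] := by
  ext i j
  rw [Matrix.map_apply, hessian, Matrix.of_apply, polyPhi_eq, pderiv_ofTerms, pderiv_ofTerms,
    eval_ofTerms]
  fin_cases i <;> fin_cases j <;> simp [derivTerm] <;> ring

-- As for g₉, with the roles of F and Φ exchanged and the correction 47 F Φ id.
set_option maxHeartbeats 4000000 in
theorem mapG11_eq (v : Fin 3 → ℂ) : evalMap mapG11 v =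
    (1 / 6300 : ℂ) • evalMap (adjHessianGradient polyPhi polyF) v -
      (47 * eval v polyF * eval v polyPhi) • v := by
  rw [evalMap_adjHessianGradient, hessian_polyPhi, gradient_polyF, Matrix.adjugate_fin_three_of,
    eval_polyF, eval_polyPhi]
  funext i
  rw [evalMap, mapG11]
  fin_cases i <;> simp [eval_ofTerms] <;> ring

/-! ### Invariance under the group -/

/-- Klein's quartic in the octahedral coordinates. -/
noncomputable def octForm (x : Fin 3 → ℂ) : ℂ :=
  (1 - (3 * theta - 3) / 2) * ∑ i, x i ^ 4 + (3 * theta - 3) / 2 * (∑ i, x i ^ 2) ^ 2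

theorem octForm_octahedral {A : Matrix (Fin 3) (Fin 3) ℂ} (hA : A ∈ octahedralMatrices)
    (x : Fin 3 → ℂ) : octForm (A *ᵥ x) = octForm x := by
  obtain ⟨-, σ, ε, rfl⟩ := hA
  set A : Matrix (Fin 3) (Fin 3) ℂ :=
    Matrix.of fun i j => if σ j = i then (((ε j : ℤˣ) : ℤ) : ℂ) else 0 with hA
  have h (j : Fin 3) : (A *ᵥ x) (σ j) = (((ε j : ℤˣ) : ℤ) : ℂ) * x j := by
    rw [Matrix.mulVec, dotProduct, Finset.sum_eq_single j]
    · simp [hA]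
    · intro b _ hb
      simp [hA, hb]
    · simp
  have h2 (j : Fin 3) : (A *ᵥ x) (σ j) ^ 2 = x j ^ 2 := by
    rw [h, mul_pow]
    rcases Int.units_eq_one_or (ε j) with h1 | h1 <;> simp [h1]
  have h4 (j : Fin 3) : (A *ᵥ x) (σ j) ^ 4 = x j ^ 4 := by
    linear_combination ((A *ᵥ x) (σ j) ^ 2 + x j ^ 2) * h2 j
  rw [octForm, octForm, ← Equiv.sum_comp σ fun i => (A *ᵥ x) i ^ 4,
    ← Equiv.sum_comp σ fun i => (A *ᵥ x) i ^ 2]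
  simp only [h2, h4]

theorem octForm_matrixQ (x : Fin 3 → ℂ) : octForm (matrixQ *ᵥ x) = octForm x := by
  have h := theta_sq
  have h0 : (matrixQ *ᵥ x) 0 = (x 0 + x 1 - theta * x 2) / 2 := by
    simp [matrixQ, Matrix.mulVec, dotProduct, Fin.sum_univ_three]
    ring
  have h1 : (matrixQ *ᵥ x) 1 = (x 0 + x 1 + theta * x 2) / 2 := by
    simp [matrixQ, Matrix.mulVec, dotProduct, Fin.sum_univ_three]
    ring
  have h2 : (matrixQ *ᵥ x) 2 = ((1 - theta) * x 0 + (theta - 1) * x 1) / 2 := by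
    simp [matrixQ, Matrix.mulVec, dotProduct, Fin.sum_univ_three]
    ring
  simp only [octForm, Fin.sum_univ_three, h0, h1, h2]
  generalize theta = θ at *
  generalize x 0 = x0 at *
  generalize x 1 = x1 at *
  generalize x 2 = x2 at *
  clear h0 h1 h2
  grind

/-- In the coordinates x the quartic is symmetric and even in each variable, so octahedral
invariance is visible and only Q needs a computation. -/
theorem eval_polyF_eq_octForm (v : Fin 3 → ℂ) :
    eval v polyF = (2 - 3 * theta) / 48 * octForm (matrixM *ᵥ v) := by
  have h := theta_sq
  have h3 : ((Real.sqrt 3 : ℝ) : ℂ) ^ 2 = 3 := by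
    rw [← Complex.ofReal_pow, Real.sq_sqrt (by norm_num)]
    norm_num
  have h0 : (matrixM *ᵥ v) 0 = 2 * v 0 + (5 - 3 * theta) / 2 * v 2 := by
    simp [matrixM, Matrix.mulVec, dotProduct, Fin.sum_univ_three]
  have h1 : (matrixM *ᵥ v) 1 = v 0 + (Real.sqrt 3 : ℂ) * v 1 - (5 - 3 * theta) / 2 * v 2 := by
    simp [matrixM, Matrix.mulVec, dotProduct, Fin.sum_univ_three]
    ring
  have h2 : (matrixM *ᵥ v) 2 = -v 0 + (Real.sqrt 3 : ℂ) * v 1 + (5 - 3 * theta) / 2 * v 2 := by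
    simp [matrixM, Matrix.mulVec, dotProduct, Fin.sum_univ_three]
  rw [eval_polyF]
  simp only [octForm, Fin.sum_univ_three, h0, h1, h2]
  generalize theta = θ at *
  generalize ((Real.sqrt 3 : ℝ) : ℂ) = s at *
  generalize v 0 = x at *
  generalize v 1 = y at *
  generalize v 2 = z at *
  clear h0 h1 h2
  grind

theorem evalMap_mapH (v : Fin 3 → ℂ) : evalMap mapH v =
    (827 / 14 * eval v polyF ^ 2 * eval v polyPhi + 99 / 49 * eval v polyPsi) • v +
      (11 / 98 * eval v polyPhi) • evalMap mapG9 v +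
      (9 / 49 * eval v polyF) • evalMap mapG11 v := by
  funext i
  simp [evalMap, mapH]

/-- Every ingredient of h is a covariant of F under matrices of determinant 1, so invariance of F
alone suffices. -/
theorem mem_commutant_mapH {g : GL (Fin 3) ℂ} (hg : g.1.det = 1)
    (hF : ∀ v, eval (g.1 *ᵥ v) polyF = eval v polyF) : g ∈ commutant mapH := by
  have hF' : subst g.1 polyF = polyF := MvPolynomial.funext fun v => by rw [eval_subst, hF]
  have hPhi' : subst g.1 polyPhi = polyPhi := by
    rw [polyPhi, map_mul, subst_C]
    congr 1
    exact subst_hessian_det hg hF'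
  have hPsi' : subst g.1 polyPsi = polyPsi := by
    rw [polyPsi, map_mul, subst_C]
    congr 1
    exact subst_bordered_det hg hF' hPhi'
  have hPhi (v) : eval (g.1 *ᵥ v) polyPhi = eval v polyPhi := by
    rw [← eval_subst, hPhi']
  have hPsi (v) : eval (g.1 *ᵥ v) polyPsi = eval v polyPsi := by
    rw [← eval_subst, hPsi']
  have h9 (v) : evalMap mapG9 (g.1 *ᵥ v) = g.1 *ᵥ evalMap mapG9 v := by
    have h := mem_commutant.mp (mem_commutant_iff_subst.mpr
      (subst_adjHessianGradient hg hF' hPhi')) v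
    rw [mapG9_eq, mapG9_eq, hF, h, Matrix.mulVec_sub, Matrix.mulVec_smul, Matrix.mulVec_smul]
  have h11 (v) : evalMap mapG11 (g.1 *ᵥ v) = g.1 *ᵥ evalMap mapG11 v := by
    have h := mem_commutant.mp (mem_commutant_iff_subst.mpr
      (subst_adjHessianGradient hg hPhi' hF')) v
    rw [mapG11_eq, mapG11_eq, hF, hPhi, h, Matrix.mulVec_sub, Matrix.mulVec_smul,
      Matrix.mulVec_smul]
  rw [mem_commutant]
  intro v
  rw [evalMap_mapH, evalMap_mapH, hF, hPhi, hPsi, h9, h11]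
  simp only [Matrix.mulVec_add, Matrix.mulVec_smul]

theorem linearGroup_le_commutant_mapH : linearGroup ≤ commutant mapH := by
  have h1 : linearGroupX ≤ (commutant mapH).comap (MulAut.conj coordChange⁻¹).toMonoidHom := by
    refine (Subgroup.closure_le _).mpr ?_
    intro s hs
    have hdet : s.1.det = 1 := by
      rcases hs with hs | hs
      · exact hs.1
      · rw [hs, matrixQ_det]
    have hf (x) : octForm (s.1 *ᵥ x) = octForm x := by
      rcases hs with hs | hs
      · exact octForm_octahedral hs x
      · rw [hs, octForm_matrixQ]
    change coordChange⁻¹ * s * (coordChange⁻¹)⁻¹ ∈ commutant mapH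
    rw [inv_inv]
    refine mem_commutant_mapH ?_ fun v => ?_
    · rw [Units.val_mul, Units.val_mul, Matrix.det_mul, Matrix.det_mul, hdet, mul_one,
        ← Matrix.det_mul, Units.inv_mul, Matrix.det_one]
    · have h2 : matrixM *ᵥ ((coordChange⁻¹ * s * coordChange).1 *ᵥ v) =
          s.1 *ᵥ (matrixM *ᵥ v) := by
        have h3 : coordChange * (coordChange⁻¹ * s * coordChange) = s * coordChange := by group
        have h4 := congrArg (fun g : GL (Fin 3) ℂ => g.1 *ᵥ v) h3
        simp only [Units.val_mul, ← Matrix.mulVec_mulVec] at h4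
        rw [Units.val_mul, Units.val_mul, ← Matrix.mulVec_mulVec, ← Matrix.mulVec_mulVec]
        exact h4
      rw [eval_polyF_eq_octForm, eval_polyF_eq_octForm, h2, hf]
  intro g hg
  have h2 := h1 hg
  simpa [Subgroup.mem_comap, mul_assoc] using h2

/-! ### The reflection line `y₂ = 0` -/

theorem coordChange_mulVec (v : Fin 3 → ℂ) : coordChange.1 *ᵥ v = matrixM *ᵥ v := rfl

theorem matrixM_mulVec (v : Fin 3 → ℂ) : matrixM *ᵥ v =
    ![2 * v 0 + (5 - 3 * theta) / 2 * v 2,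
      v 0 + (Real.sqrt 3 : ℂ) * v 1 - (5 - 3 * theta) / 2 * v 2,
      -v 0 + (Real.sqrt 3 : ℂ) * v 1 + (5 - 3 * theta) / 2 * v 2] := by
  funext i
  fin_cases i <;> simp [matrixM, Matrix.mulVec, dotProduct, Fin.sum_univ_three]
  ring

theorem reflForm_dotProduct (i : Fin 21) (v : Fin 3 → ℂ) :
    reflForm i ⬝ᵥ v = (fun j => toComplex (coroot i j)) ⬝ᵥ (matrixM *ᵥ v) := by
  rw [reflForm, ← Matrix.dotProduct_mulVec, coordChange_mulVec]

theorem reflCenter_eq {i : Fin 21} {w : Fin 3 → ℂ}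
    (h : matrixM *ᵥ w = fun j => toComplex (root i j)) : reflCenter i = w := by
  rw [reflCenter, ← h, ← coordChange_mulVec, Matrix.mulVec_mulVec, Units.inv_mul, Matrix.one_mulVec]

theorem sqrt_three_ne_zero : (Real.sqrt 3 : ℂ) ≠ 0 := by
  exact_mod_cast (Real.sqrt_pos.mpr (by norm_num : (0 : ℝ) < 3)).ne'

theorem reflForm_zero : reflForm 0 = (2 * Real.sqrt 3 * (1 - theta) : ℂ) • Pi.single 1 1 := by
  have h (v : Fin 3 → ℂ) : reflForm 0 ⬝ᵥ v = 2 * Real.sqrt 3 * (1 - theta) * v 1 := by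
    rw [reflForm_dotProduct, matrixM_mulVec]
    simp [dotProduct, Fin.sum_univ_three, coroot, root, toComplex_apply]
    ring
  funext j
  have h1 := h (Pi.single j 1)
  rw [dotProduct_single, mul_one] at h1
  rw [h1]
  simp [Pi.single_apply, eq_comm]

theorem one_sub_theta_ne_zero : (1 - theta : ℂ) ≠ 0 := by
  intro h
  have h1 := theta_sq
  rw [← sub_eq_zero.mp h] at h1
  norm_num at h1

theorem theta_ne_zero : theta ≠ 0 := by
  intro h
  have h1 := theta_sq
  rw [h] at h1
  norm_num at h1

theorem five_sub_theta_ne_zero : (5 - 3 * theta : ℂ) ≠ 0 := by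
  intro h
  have ht : theta = 5 / 3 := by linear_combination (-1 / 3 : ℂ) * h
  have := theta_sq
  rw [ht] at this
  norm_num at this

theorem reflForm_zero_scalar_ne_zero : (2 * Real.sqrt 3 * (1 - theta) : ℂ) ≠ 0 :=
  mul_ne_zero (mul_ne_zero two_ne_zero sqrt_three_ne_zero) one_sub_theta_ne_zero

/-- The coordinates y put one reflection in diagonal form, so that its line is y₂ = 0 and the
tangency conditions concern a single variable. -/
theorem refl_zero_mulVec (v : Fin 3 → ℂ) : (refl 0).1 *ᵥ v = ![-v 0, v 1, -v 2] := by
  have h3 : ((Real.sqrt 3 : ℝ) : ℂ) ^ 2 = 3 := by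
    rw [← Complex.ofReal_pow, Real.sq_sqrt (by norm_num)]
    norm_num
  have hc : reflCenter 0 = ![0, theta * Real.sqrt 3 / 3, 0] := by
    apply reflCenter_eq
    rw [matrixM_mulVec]
    funext j
    fin_cases j <;> simp [root, toComplex_apply] <;> linear_combination theta / 3 * h3
  have ht := theta_sq
  rw [refl_mulVec, hc, reflForm_zero, smul_dotProduct, single_dotProduct]
  funext j
  fin_cases j
  · simp
  · simp
    linear_combination (theta - theta ^ 2) * v 1 / 3 * h3 - v 1 * ht
  · simp

/-- A fixed point of `refl 6` on the line `y₂ = 0`. -/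
noncomputable def lineVecE : Fin 3 → ℂ := ![1, 0, 2 / (5 - 3 * theta)]

/-- The other fixed point of `refl 6` on the line `y₂ = 0`. -/
noncomputable def lineVecF : Fin 3 → ℂ := ![1, 0, -4 / (5 - 3 * theta)]

theorem matrixM_lineVecE : matrixM *ᵥ lineVecE = ![3, 0, 0] := by
  have h := five_sub_theta_ne_zero
  rw [matrixM_mulVec, lineVecE]
  funext j
  fin_cases j <;> simp <;> field_simp <;> norm_num

theorem matrixM_lineVecF : matrixM *ᵥ lineVecF = ![0, 3, -3] := by
  have h := five_sub_theta_ne_zero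
  rw [matrixM_mulVec, lineVecF]
  funext j
  fin_cases j <;> simp <;> field_simp <;> norm_num

theorem toComplex_root_six : (fun j => toComplex (root 6 j)) = ![2, 0, 0] := by
  have h : root 6 = ![⟨2, 0⟩, ⟨0, 0⟩, ⟨0, 0⟩] := by decide +kernel
  rw [h]
  funext j
  fin_cases j <;> simp [toComplex_apply]

theorem toComplex_coroot_six : (fun j => toComplex (coroot 6 j)) = ![2, 0, 0] := by
  have h : coroot 6 = ![⟨2, 0⟩, ⟨0, 0⟩, ⟨0, 0⟩] := by decide +kernel
  rw [h]
  funext j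
  fin_cases j <;> simp [toComplex_apply]

theorem toComplex_root_ten : (fun j => toComplex (root 10 j)) = ![1 - theta, 1, -1] := by
  have h : root 10 = ![⟨1, -1⟩, ⟨1, 0⟩, ⟨-1, 0⟩] := by decide +kernel
  rw [h]
  funext j
  fin_cases j
  · simp [toComplex_apply]
    ring
  · simp [toComplex_apply]
  · simp [toComplex_apply]

theorem toComplex_coroot_ten : (fun j => toComplex (coroot 10 j)) = ![theta, 1, -1] := by
  have h : coroot 10 = ![⟨0, 1⟩, ⟨1, 0⟩, ⟨-1, 0⟩] := by decide +kernel
  rw [h]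
  funext j
  fin_cases j <;> simp [toComplex_apply]

theorem reflCenter_six : reflCenter 6 = (2 / 3 : ℂ) • lineVecE := by
  apply reflCenter_eq
  rw [Matrix.mulVec_smul, matrixM_lineVecE, toComplex_root_six]
  funext j
  fin_cases j <;> simp

theorem reflCenter_ten :
    reflCenter 10 = ((1 - theta) / 3 : ℂ) • lineVecE + (1 / 3 : ℂ) • lineVecF := by
  apply reflCenter_eq
  rw [Matrix.mulVec_add, Matrix.mulVec_smul, Matrix.mulVec_smul, matrixM_lineVecE,
    matrixM_lineVecF, toComplex_root_ten]
  funext j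
  fin_cases j <;> simp

theorem refl_six_lineVecE : (refl 6).1 *ᵥ lineVecE = lineVecE := by
  rw [refl_mulVec, reflForm_dotProduct, matrixM_lineVecE, reflCenter_six, toComplex_coroot_six]
  simp [dotProduct, Fin.sum_univ_three]
  module

theorem refl_six_lineVecF : (refl 6).1 *ᵥ lineVecF = -lineVecF := by
  rw [refl_mulVec, reflForm_dotProduct, matrixM_lineVecF, reflCenter_six, toComplex_coroot_six]
  simp [dotProduct, Fin.sum_univ_three]

theorem refl_ten_lineVecE : (refl 10).1 *ᵥ lineVecE = (theta / 2) • lineVecF := by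
  have h : (fun j => toComplex (coroot 10 j)) ⬝ᵥ ![3, 0, 0] = 3 * theta := by
    rw [toComplex_coroot_ten]
    simp [dotProduct, Fin.sum_univ_three]
    ring
  rw [refl_mulVec, reflForm_dotProduct, matrixM_lineVecE, reflCenter_ten, h, smul_add, smul_smul,
    smul_smul]
  have h2 : (1 / 2 * (3 * theta) * ((1 - theta) / 3) : ℂ) = 1 := by
    linear_combination (-1 / 2 : ℂ) * theta_sq
  rw [h2]
  module

/-- With `refl_ten_lineVecE` this shows that `refl 10` exchanges the two fixed points of `refl 6` on
the line. The two reflections therefore have no common fixed point there. -/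
theorem refl_ten_lineVecF : (refl 10).1 *ᵥ lineVecF = (1 - theta) • lineVecE := by
  have h : (fun j => toComplex (coroot 10 j)) ⬝ᵥ ![0, 3, -3] = 6 := by
    rw [toComplex_coroot_ten]
    simp [dotProduct, Fin.sum_univ_three]
    norm_num
  rw [refl_mulVec, reflForm_dotProduct, matrixM_lineVecF, reflCenter_ten, h]
  module

theorem exists_lineVec {v : Fin 3 → ℂ} (hv : v 1 = 0) :
    ∃ s t : ℂ, v = s • lineVecE + t • lineVecF := by
  have h := five_sub_theta_ne_zero
  refine ⟨2 / 3 * v 0 + (5 - 3 * theta) / 6 * v 2, 1 / 3 * v 0 - (5 - 3 * theta) / 6 * v 2, ?_⟩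
  funext j
  fin_cases j
  · simp [lineVecE, lineVecF]
    ring
  · simp [lineVecE, lineVecF, hv]
  · simp [lineVecE, lineVecF]
    field_simp
    ring

/-! ### Polynomials that vanish on the line -/

theorem X_dvd_iff_eval {p : Poly3} :
    X 1 ∣ p ↔ ∀ v : Fin 3 → ℂ, v 1 = 0 → eval v p = 0 := by
  constructor
  · rintro ⟨q, rfl⟩ v hv
    simp [hv]
  · intro h
    -- The substitution ρ sets y₂ = 0. Every q is congruent to ρ q modulo y₂, and ρ p = 0 since all
    -- its values vanish.
    set ρ : Poly3 →ₐ[ℂ] Poly3 := aeval (Function.update X 1 0) with hρ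
    have h1 (q : Poly3) : X 1 ∣ q - ρ q := by
      induction q using MvPolynomial.induction_on with
      | C a => simp [hρ]
      | add p q hp hq =>
        rw [map_add, add_sub_add_comm]
        exact dvd_add hp hq
      | mul_X p i hp =>
        have h2 : X 1 ∣ X i - ρ (X i) := by
          by_cases hi : i = 1
          · subst hi
            simp [hρ]
          · simp [hρ, hi]
        rw [map_mul]
        have h3 : p * X i - ρ p * ρ (X i) = (p - ρ p) * X i + ρ p * (X i - ρ (X i)) := by ring
        rw [h3]
        exact dvd_add (hp.mul_right _) (h2.mul_left _)
    have h4 : ρ p = 0 := by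
      apply MvPolynomial.funext
      intro v
      have h5 : (eval v).comp ρ.toRingHom = eval (Function.update v 1 0) := by
        apply MvPolynomial.ringHom_ext
        · intro r
          simp
        · intro i
          by_cases hi : i = 1
          · subst hi
            simp [hρ]
          · simp [hρ, hi]
      have h6 : eval v (ρ p) = eval (Function.update v 1 0) p :=
        congrArg (fun f : Poly3 →+* ℂ => f p) h5
      rw [h6, map_zero]
      exact h _ (by simp)
    have h6 := h1 p
    rwa [h4, sub_zero] at h6

/-! ### Restriction of equivariant maps to the line `y₂ = 0` -/

/-- For nonzero a and b the top coefficient of X(ab' - a'b) is (deg b - deg a) times the product of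
the leading coefficients. The degrees would then be equal, although one is even and the other odd.
-/
theorem eq_zero_or_eq_zero_of_wronskian {a b : Polynomial ℂ} (ha : a.comp (-Polynomial.X) = a)
    (hb : b.comp (-Polynomial.X) = -b)
    (h : a * Polynomial.derivative b = Polynomial.derivative a * b) : a = 0 ∨ b = 0 := by
  by_contra! hab
  obtain ⟨ha0, hb0⟩ := hab
  have hcomp (p : Polynomial ℂ) (n : ℕ) :
      (p.comp (-Polynomial.X)).coeff n = p.coeff n * (-1) ^ n := by
    have h1 : (-Polynomial.X : Polynomial ℂ) = Polynomial.C (-1) * Polynomial.X := by simp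
    rw [h1, Polynomial.comp_C_mul_X_coeff]
  have hla : a.leadingCoeff ≠ 0 := Polynomial.leadingCoeff_ne_zero.mpr ha0
  have hlb : b.leadingCoeff ≠ 0 := Polynomial.leadingCoeff_ne_zero.mpr hb0
  have ha2 : Even a.natDegree := by
    by_contra hodd
    rw [Nat.not_even_iff_odd] at hodd
    have h1 := congrArg (fun p => p.coeff a.natDegree) ha
    simp only [hcomp, hodd.neg_one_pow] at h1
    apply hla
    rw [Polynomial.leadingCoeff]
    linear_combination (-1 / 2 : ℂ) * h1
  have hb2 : Odd b.natDegree := by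
    by_contra heven
    rw [Nat.not_odd_iff_even] at heven
    have h1 := congrArg (fun p => p.coeff b.natDegree) hb
    simp only [hcomp, heven.neg_one_pow, Polynomial.coeff_neg] at h1
    apply hlb
    rw [Polynomial.leadingCoeff]
    linear_combination (1 / 2 : ℂ) * h1
  set m := a.natDegree with hm
  set n := b.natDegree with hn
  -- The factor X restores the degree lost by differentiation, so constant polynomials need no
  -- separate degree count.
  have hcoef (p q : Polynomial ℂ) : ((Polynomial.X * Polynomial.derivative q) * p).coeff
      (q.natDegree + p.natDegree) = q.natDegree * q.leadingCoeff * p.leadingCoeff := by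
    have h2 : (Polynomial.X * Polynomial.derivative q).natDegree ≤ q.natDegree := by
      by_cases h0 : q.natDegree = 0
      · rw [Polynomial.eq_C_of_natDegree_eq_zero h0]
        simp
      · refine Polynomial.natDegree_mul_le.trans ?_
        have := Polynomial.natDegree_derivative_le q
        rw [Polynomial.natDegree_X]
        omega
    rw [Polynomial.coeff_mul_add_eq_of_natDegree_le h2 le_rfl]
    congr 1
    rcases Nat.eq_zero_or_pos q.natDegree with h0 | h0
    · rw [h0]
      simp
    · obtain ⟨k, hk⟩ := Nat.exists_eq_succ_of_ne_zero h0.ne'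
      rw [hk, Polynomial.coeff_X_mul, Polynomial.coeff_derivative, Polynomial.leadingCoeff, hk]
      push_cast
      ring
  have h1 := hcoef a b
  have h2 := hcoef b a
  have h3 : Polynomial.X * Polynomial.derivative b * a =
      Polynomial.X * Polynomial.derivative a * b := by
    linear_combination Polynomial.X * h
  rw [h3, add_comm, h2] at h1
  have h4 : (m : ℂ) = n := by
    have h5 : (m : ℂ) * (a.leadingCoeff * b.leadingCoeff) =
        n * (a.leadingCoeff * b.leadingCoeff) := by
      linear_combination h1
    exact mul_right_cancel₀ (mul_ne_zero hla hlb) h5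
  have h5 : m = n := by exact_mod_cast h4
  rw [h5] at ha2
  exact (Nat.not_even_iff_odd.mpr hb2) ha2

/-- The restriction of a polynomial to the affine line `e + t f`. -/
noncomputable def restrictLine (e f : Fin 3 → ℂ) : Poly3 →ₐ[ℂ] Polynomial ℂ :=
  aeval fun i => Polynomial.C (e i) + Polynomial.X * Polynomial.C (f i)

theorem eval_restrictLine (e f : Fin 3 → ℂ) (p : Poly3) (t : ℂ) :
    (restrictLine e f p).eval t = eval (e + t • f) p := by
  induction p using MvPolynomial.induction_on with
  | C a => simp [restrictLine]
  | add p q hp hq => simp [hp, hq]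
  | mul_X p i hp =>
    rw [map_mul, Polynomial.eval_mul, hp, map_mul, eval_X]
    congr 1
    simp [restrictLine]
    exact mul_comm _ _

theorem derivative_restrictLine (e f : Fin 3 → ℂ) (p : Poly3) :
    Polynomial.derivative (restrictLine e f p) =
      ∑ i, Polynomial.C (f i) * restrictLine e f (pderiv i p) := by
  induction p using MvPolynomial.induction_on with
  | C a => simp [restrictLine]
  | add p q hp hq => simp [hp, hq, mul_add, Finset.sum_add_distrib]
  | mul_X p i hp =>
    have h1 : Polynomial.derivative (restrictLine e f (X i)) = Polynomial.C (f i) := by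
      simp [restrictLine]
    have h2 (k : Fin 3) : Polynomial.C (f k) * restrictLine e f (pderiv k (p * X i)) =
        Polynomial.C (f k) * restrictLine e f (pderiv k p) * restrictLine e f (X i) +
          if k = i then restrictLine e f p * Polynomial.C (f i) else 0 := by
      rw [pderiv_mul, pderiv_X, map_add, map_mul (restrictLine e f) (pderiv k p)]
      by_cases hk : k = i
      · subst hk
        simp
        ring
      · simp [hk, Ne.symm hk]
        ring
    rw [map_mul, Polynomial.derivative_mul, h1, hp, Finset.sum_congr rfl fun k _ => h2 k,
      Finset.sum_add_distrib, Finset.sum_ite_eq' Finset.univ i, Finset.sum_mul]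
    simp

theorem evalMap_smul {R : Fin 3 → Poly3} {n : ℕ} (hR : ∀ i, (R i).IsHomogeneous n) (c : ℂ)
    (v : Fin 3 → ℂ) : evalMap R (c • v) = c ^ n • evalMap R v := by
  funext i
  simp only [evalMap, Pi.smul_apply, smul_eq_mul, eval_eq', Finset.mul_sum]
  refine Finset.sum_congr rfl fun d hd => ?_
  have h1 : ∏ j, (c * v j) ^ d j = c ^ n * ∏ j, v j ^ d j := by
    have h2 := hR i (mem_support_iff.mp hd)
    have h3 : Finsupp.weight (1 : Fin 3 → ℕ) d = d.degree := by
      rw [Finsupp.degree_eq_weight_one]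
      rfl
    rw [h3, Finsupp.degree_eq_sum] at h2
    simp only [mul_pow, Finset.prod_mul_distrib, Finset.prod_pow_eq_pow_sum, h2]
  rw [h1]
  ring

theorem euler {p : Poly3} {n : ℕ} (hp : p.IsHomogeneous n) (v : Fin 3 → ℂ) :
    n * eval v p = v 0 * eval v (pderiv 0 p) + v 1 * eval v (pderiv 1 p) +
      v 2 * eval v (pderiv 2 p) := by
  have h := congrArg (eval v) hp.sum_X_mul_pderiv
  simp [Fin.sum_univ_three] at h
  exact h.symm

/-- The Jacobian determinant of the restriction to the line `y₂ = 0`. -/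
noncomputable def lineJacobian (R : Fin 3 → Poly3) : Poly3 :=
  pderiv 0 (R 0) * pderiv 2 (R 2) - pderiv 2 (R 0) * pderiv 0 (R 2)

/-- On the line the reflection acts as -1. Since n is odd, the value of R is also a -1 eigenvector,
so its second component vanishes. -/
theorem evalMap_one_eq_zero {R : Fin 3 → Poly3} {n : ℕ} (hn : Odd n)
    (hR : ∀ i, (R i).IsHomogeneous n) (hG : linearGroup ≤ commutant R) {v : Fin 3 → ℂ}
    (hv : v 1 = 0) : eval v (R 1) = 0 := by
  have h1 := mem_commutant.mp (hG (refl_mem 0)) v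
  have h2 : (refl 0).1 *ᵥ v = (-1 : ℂ) • v := by
    rw [refl_zero_mulVec]
    funext j
    fin_cases j <;> simp [hv]
  rw [h2, evalMap_smul hR, hn.neg_one_pow, refl_zero_mulVec] at h1
  have h3 := congrFun h1 1
  simp [evalMap] at h3
  linear_combination (-1 / 2 : ℂ) * h3

theorem lineVec_ext {x y x' y' : ℂ}
    (h : x • lineVecE + y • lineVecF = x' • lineVecE + y' • lineVecF) : x = x' ∧ y = y' := by
  have hk := five_sub_theta_ne_zero
  have h0 := congrFun h 0
  have h2 := congrFun h 2
  simp [lineVecE, lineVecF] at h0 h2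
  field_simp at h2
  constructor
  · linear_combination (2 / 3 : ℂ) * h0 + (1 / 6 : ℂ) * h2
  · linear_combination (1 / 3 : ℂ) * h0 - (1 / 6 : ℂ) * h2

/-- An equivariant map contracts the line `y₂ = 0` only if it vanishes there. -/
theorem evalMap_eq_zero_of_lineJacobian {R : Fin 3 → Poly3} {n : ℕ} (hn : Odd n)
    (hR : ∀ i, (R i).IsHomogeneous n) (hG : linearGroup ≤ commutant R)
    (hJ : ∀ v : Fin 3 → ℂ, v 1 = 0 → eval v (lineJacobian R) = 0) {v : Fin 3 → ℂ} (hv : v 1 = 0) :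
    evalMap R v = 0 := by
  have hk := five_sub_theta_ne_zero
  have hn0 : (n : ℂ) ≠ 0 := by exact_mod_cast hn.pos.ne'
  set k : ℂ := 5 - 3 * theta with hkdef
  set e := lineVecE with he
  set f := lineVecF with hf
  have he0 : e 0 = 1 := rfl
  have he1 : e 1 = 0 := rfl
  have he2 : e 2 = 2 / k := rfl
  have hf0 : f 0 = 1 := rfl
  have hf1 : f 1 = 0 := rfl
  have hf2 : f 2 = -4 / k := rfl
  have hline (s t : ℂ) : (s • e + t • f) 1 = 0 := by simp [he1, hf1]
  have hline' (t : ℂ) : (e + t • f) 1 = 0 := by simp [he1, hf1]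
  set r0 := restrictLine e f (R 0) with hr0
  set r2 := restrictLine e f (R 2) with hr2
  -- Up to the factor 6, a and b are the coordinates of R(e + t f) in the basis e, f.
  set a : Polynomial ℂ := 4 * r0 + Polynomial.C k * r2 with ha
  set b : Polynomial ℂ := 2 * r0 - Polynomial.C k * r2 with hb
  have hvec (t : ℂ) : (6 : ℂ) • evalMap R (e + t • f) = a.eval t • e + b.eval t • f := by
    have h1 := evalMap_one_eq_zero hn hR hG (hline' t)
    have h0 : r0.eval t = eval (e + t • f) (R 0) := eval_restrictLine _ _ _ _
    have h2 : r2.eval t = eval (e + t • f) (R 2) := eval_restrictLine _ _ _ _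
    funext j
    fin_cases j
    · simp [ha, hb, evalMap, h0, he0, hf0]
      ring
    · simp [evalMap, h1, he1, hf1]
    · simp [ha, hb, evalMap, h0, h2, he2, hf2]
      field_simp
      ring
  -- `refl 6` fixes e and negates f, so it acts on the parameter as t ↦ -t.
  have hparity (t : ℂ) : a.eval (-t) = a.eval t ∧ b.eval (-t) = -b.eval t := by
    have h1 : (refl 6).1 *ᵥ (e + t • f) = e + (-t) • f := by
      rw [Matrix.mulVec_add, Matrix.mulVec_smul, he, hf, refl_six_lineVecE, refl_six_lineVecF]
      module
    have h2 := mem_commutant.mp (hG (refl_mem 6)) (e + t • f)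
    have h3 : (6 : ℂ) • evalMap R (e + (-t) • f) = a.eval t • e + (-b.eval t) • f := by
      rw [← h1, h2, ← Matrix.mulVec_smul, hvec, Matrix.mulVec_add, Matrix.mulVec_smul,
        Matrix.mulVec_smul, he, hf, refl_six_lineVecE, refl_six_lineVecF]
      module
    rw [hvec] at h3
    exact lineVec_ext h3
  -- Euler's identity in the plane y₂ = 0 expresses n times the Wronskian of r0 and r2 as the
  -- determinant of (e + t f, f) times J₀.
  have hw : r0 * Polynomial.derivative r2 = Polynomial.derivative r0 * r2 := by
    apply Polynomial.funext
    intro t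
    rw [hr0, hr2, derivative_restrictLine, derivative_restrictLine]
    simp only [Fin.sum_univ_three, Polynomial.eval_mul, Polynomial.eval_add, Polynomial.eval_C,
      eval_restrictLine, hf1]
    have h1 := euler (hR 0) (e + t • f)
    have h2 := euler (hR 2) (e + t • f)
    have h3 := hJ (e + t • f) (hline' t)
    simp only [lineJacobian, map_sub, map_mul] at h3
    rw [hline' t] at h1 h2
    set w0 := (e + t • f) 0 with hw0
    set w2 := (e + t • f) 2 with hw2
    apply mul_left_cancel₀ hn0
    linear_combination
      (f 0 * eval (e + t • f) (pderiv 0 (R 2)) + f 2 * eval (e + t • f) (pderiv 2 (R 2))) * h1 -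
      (f 0 * eval (e + t • f) (pderiv 0 (R 0)) + f 2 * eval (e + t • f) (pderiv 2 (R 0))) * h2 +
      (w0 * f 2 - w2 * f 0) * h3
  have hab : a * Polynomial.derivative b = Polynomial.derivative a * b := by
    have hd1 : Polynomial.derivative a =
        4 * Polynomial.derivative r0 + Polynomial.C k * Polynomial.derivative r2 := by
      simp [ha, Polynomial.derivative_mul]
    have hd2 : Polynomial.derivative b =
        2 * Polynomial.derivative r0 - Polynomial.C k * Polynomial.derivative r2 := by
      simp [hb, Polynomial.derivative_mul]
    rw [hd1, hd2, ha, hb]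
    linear_combination (-6 * Polynomial.C k) * hw
  have hzero : a = 0 ∨ b = 0 := by
    refine eq_zero_or_eq_zero_of_wronskian ?_ ?_ hab
    · apply Polynomial.funext
      intro t
      simp [(hparity t).1]
    · apply Polynomial.funext
      intro t
      simp [(hparity t).2]
  have hscale (s t : ℂ) (hs : s ≠ 0) : (6 : ℂ) • evalMap R (s • e + t • f) =
      (s ^ n * a.eval (t / s)) • e + (s ^ n * b.eval (t / s)) • f := by
    have h1 : s • e + t • f = s • (e + (t / s) • f) := by
      rw [smul_add, smul_smul, mul_div_cancel₀ _ hs]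
    rw [h1, evalMap_smul hR, smul_comm, hvec]
    module
  -- `refl 10` exchanges the directions e and f, so the vanishing of one of a, b carries over to the
  -- other.
  have hswap (t : ℂ) (ht : t ≠ 0) :
      (t * (1 - theta)) ^ n * a.eval (theta / 2 / (t * (1 - theta))) = b.eval t * (1 - theta) ∧
      (t * (1 - theta)) ^ n * b.eval (theta / 2 / (t * (1 - theta))) = a.eval t * (theta / 2) := by
    have h1 : (refl 10).1 *ᵥ (e + t • f) = (t * (1 - theta)) • e + (theta / 2) • f := by
      rw [Matrix.mulVec_add, Matrix.mulVec_smul, he, hf, refl_ten_lineVecE, refl_ten_lineVecF]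
      module
    have h2 := mem_commutant.mp (hG (refl_mem 10)) (e + t • f)
    have h3 := hscale (t * (1 - theta)) (theta / 2) (mul_ne_zero ht one_sub_theta_ne_zero)
    rw [← h1, h2, ← Matrix.mulVec_smul, hvec, Matrix.mulVec_add, Matrix.mulVec_smul,
      Matrix.mulVec_smul, he, hf, refl_ten_lineVecE, refl_ten_lineVecF] at h3
    refine lineVec_ext (h3.symm.trans ?_)
    module
  have hpoly (p : Polynomial ℂ) (hp : ∀ t, t ≠ 0 → p.eval t = 0) : p = 0 := by
    have h1 : Polynomial.X * p = 0 := by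
      apply Polynomial.funext
      intro t
      by_cases ht : t = 0
      · simp [ht]
      · simp [hp t ht]
    exact (mul_eq_zero.mp h1).resolve_left Polynomial.X_ne_zero
  have hboth : a = 0 ∧ b = 0 := by
    rcases hzero with h | h
    · refine ⟨h, hpoly b fun t ht => ?_⟩
      have h1 := (hswap t ht).1
      rw [h, Polynomial.eval_zero, mul_zero] at h1
      exact (mul_eq_zero.mp h1.symm).resolve_right one_sub_theta_ne_zero
    · refine ⟨hpoly a fun t ht => ?_, h⟩
      have h1 := (hswap t ht).2
      rw [h, Polynomial.eval_zero, mul_zero] at h1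
      exact (mul_eq_zero.mp h1.symm).resolve_right (div_ne_zero theta_ne_zero two_ne_zero)
  have h6 : (6 : ℂ) ≠ 0 := by norm_num
  have hE (s t : ℂ) (hs : s ≠ 0) : evalMap R (s • e + t • f) = 0 := by
    have h1 := hscale s t hs
    rw [hboth.1, hboth.2] at h1
    simpa using h1
  -- The multiples of f are missing from the chart e + t f; for t ≠ 0 they are images under `refl
  -- 10` of multiples of e.
  have hF (t : ℂ) : evalMap R (t • f) = 0 := by
    have h1 := mem_commutant.mp (hG (refl_mem 10)) ((2 * t / theta) • e)
    have h2 := hE (2 * t / theta) 0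
    by_cases ht : t = 0
    · rw [ht, zero_smul]
      have h3 := evalMap_smul hR 0 (0 : Fin 3 → ℂ)
      rw [smul_zero, zero_pow hn.pos.ne', zero_smul] at h3
      exact h3
    · rw [zero_smul, add_zero] at h2
      rw [h2 (div_ne_zero (mul_ne_zero two_ne_zero ht) theta_ne_zero), Matrix.mulVec_zero,
        Matrix.mulVec_smul, he, refl_ten_lineVecE, smul_smul] at h1
      have h4 : 2 * t / theta * (theta / 2) = t := by
        field_simp [theta_ne_zero]
      rwa [h4] at h1
  obtain ⟨s, t, rfl⟩ := exists_lineVec hv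
  by_cases hs : s = 0
  · rw [hs, zero_smul, zero_add]
    exact hF t
  · exact hE s t hs

/-! ### The product of the reflection lines -/

/-- The substitution by an invertible matrix as an automorphism. -/
noncomputable def substEquiv (g : GL (Fin 3) ℂ) : Poly3 ≃ₐ[ℂ] Poly3 :=
  AlgEquiv.ofAlgHom (subst g.1) (subst (g⁻¹).1)
    (by
      apply AlgHom.ext
      intro p
      rw [AlgHom.comp_apply, subst_subst, Units.inv_mul, subst_one]
      rfl)
    (by
      apply AlgHom.ext
      intro p
      rw [AlgHom.comp_apply, subst_subst, Units.mul_inv, subst_one]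
      rfl)

theorem substEquiv_apply (g : GL (Fin 3) ℂ) (p : Poly3) : substEquiv g p = subst g.1 p := rfl

theorem linearForm_smul (s : ℂ) (a : Fin 3 → ℂ) : linearForm (s • a) = C s * linearForm a := by
  apply MvPolynomial.funext
  intro v
  simp [eval_linearForm]

theorem linearForm_single : linearForm (Pi.single 1 1) = X 1 := by
  apply MvPolynomial.funext
  intro v
  simp [eval_linearForm]

/-- The linear forms of the reflection lines are equivalent to `y₂` under the group. -/
theorem exists_subst_linearForm (i : Fin 21) : ∃ k ∈ linearGroup, ∃ s : ℂ, s ≠ 0 ∧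
    k * refl 0 = refl i * k ∧ subst k.1 (linearForm (reflForm i)) = C s * X 1 := by
  obtain ⟨k, hk, s, hs, h1, h2⟩ := exists_conj_refl i
  refine ⟨k, hk, s * (2 * Real.sqrt 3 * (1 - theta)), mul_ne_zero hs reflForm_zero_scalar_ne_zero,
    h1, ?_⟩
  rw [subst_linearForm, h2, reflForm_zero, smul_smul, linearForm_smul, linearForm_single]

theorem isUnit_C {s : ℂ} (hs : s ≠ 0) : IsUnit (C s : Poly3) := (IsUnit.mk0 s hs).map C

theorem pow_dvd_iff_subst {i : Fin 21} {k : GL (Fin 3) ℂ} {s : ℂ} (hs : s ≠ 0)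
    (hk : subst k.1 (linearForm (reflForm i)) = C s * X 1) (n : ℕ) (p : Poly3) :
    linearForm (reflForm i) ^ n ∣ p ↔ X 1 ^ n ∣ subst k.1 p := by
  rw [← map_dvd_iff (substEquiv k), map_pow, substEquiv_apply, substEquiv_apply, hk, mul_pow]
  exact ((isUnit_C hs).pow n).mul_left_dvd

theorem prime_linearForm (i : Fin 21) : Prime (linearForm (reflForm i)) := by
  obtain ⟨k, -, s, hs, -, hk⟩ := exists_subst_linearForm i
  rw [← MulEquiv.prime_iff (substEquiv k).toMulEquiv]
  change Prime (subst k.1 (linearForm (reflForm i)))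
  rw [hk]
  exact (associated_unit_mul_left (X 1) _ (isUnit_C hs)).symm.prime (X_prime)

theorem not_linearForm_dvd {i j : Fin 21} (hij : i ≠ j) :
    ¬ linearForm (reflForm i) ∣ linearForm (reflForm j) := by
  rintro ⟨q, hq⟩
  have h1 : ∀ v, v ≠ 0 → reflForm i ⬝ᵥ v = 0 → reflForm j ⬝ᵥ v = 0 := by
    intro v _ hv
    rw [← eval_linearForm, hq, map_mul, eval_linearForm, hv, zero_mul]
  obtain ⟨s, hs⟩ := eq_smul_of_mul_eq_mul (reflForm_ne_zero j) (mul_eq_mul_of_ker_le h1)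
  exact reflForm_not_proportional hij s hs

/-- The product of the linear forms of the reflection lines. -/
noncomputable def lineProduct : Poly3 := ∏ i, linearForm (reflForm i)

theorem lineProduct_ne_zero : lineProduct ≠ 0 :=
  Finset.prod_ne_zero_iff.mpr fun i _ => (prime_linearForm i).ne_zero

theorem isHomogeneous_lineProduct : lineProduct.IsHomogeneous 21 := by
  have h := IsHomogeneous.prod Finset.univ (fun i => linearForm (reflForm i)) (fun _ => 1)
    fun i _ => isHomogeneous_linearForm (reflForm i)
  simpa [lineProduct] using h

/-- The 21 linear forms are pairwise nonassociated primes, so divisibility can be tested one line at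
a time. -/
theorem lineProduct_pow_dvd {p : Poly3} (n : ℕ) (h : ∀ i, linearForm (reflForm i) ^ n ∣ p) :
    lineProduct ^ n ∣ p := by
  rw [lineProduct, ← Finset.prod_pow]
  refine Finset.prod_dvd_of_isRelPrime ?_ fun i _ => h i
  intro i _ j _ hij
  refine IsRelPrime.pow ?_
  rw [(prime_linearForm i).irreducible.isRelPrime_iff_not_dvd]
  exact not_linearForm_dvd hij

theorem eq_C_mul_of_dvd_of_isHomogeneous {p q : Poly3} {n : ℕ} (hp : p.IsHomogeneous n)
    (hq : q.IsHomogeneous n) (hq0 : q ≠ 0) (h : q ∣ p) : ∃ c : ℂ, p = C c * q := by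
  obtain ⟨r, rfl⟩ := h
  by_cases hr : r = 0
  · exact ⟨0, by simp [hr]⟩
  · have h1 := totalDegree_mul_of_isDomain hq0 hr
    rw [hp.totalDegree (mul_ne_zero hq0 hr), hq.totalDegree hq0] at h1
    have h2 : r.totalDegree = 0 := by omega
    rw [totalDegree_eq_zero_iff_eq_C] at h2
    exact ⟨_, by rw [h2, mul_comm]⟩

theorem eq_zero_of_lineProduct_dvd {p : Poly3} {n : ℕ} (hp : p.IsHomogeneous n) (hn : n < 21)
    (h : lineProduct ∣ p) : p = 0 := by
  by_contra hp0
  obtain ⟨r, rfl⟩ := h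
  have h1 := totalDegree_mul_of_isDomain (left_ne_zero_of_mul hp0) (right_ne_zero_of_mul hp0)
  rw [hp.totalDegree hp0, isHomogeneous_lineProduct.totalDegree lineProduct_ne_zero] at h1
  omega

theorem isHomogeneous_jacobianDet {R : Fin 3 → Poly3} {n : ℕ}
    (hR : ∀ i, (R i).IsHomogeneous n) : (jacobianDet R).IsHomogeneous (3 * (n - 1)) := by
  have h (i j : Fin 3) : (pderiv j (R i)).IsHomogeneous (n - 1) := (hR i).pderiv
  have h3 (a b c d e f : Fin 3) :
      (pderiv a (R b) * pderiv c (R d) * pderiv e (R f)).IsHomogeneous (3 * (n - 1)) := by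
    have := ((h b a).mul (h d c)).mul (h f e)
    convert this using 1
    ring
  rw [jacobianDet, Matrix.det_fin_three]
  simp only [Matrix.of_apply]
  exact (((((h3 _ _ _ _ _ _).sub (h3 _ _ _ _ _ _)).sub (h3 _ _ _ _ _ _)).add
    (h3 _ _ _ _ _ _)).add (h3 _ _ _ _ _ _)).sub (h3 _ _ _ _ _ _)

/-! ### Equivariant maps with given critical set -/

/-- In the gradient of R 1 only the derivative along `X 1` loses a factor `X 1`; the other two
entries contribute only to w. Modulo `X 1`, the cofactor of the surviving entry is `lineJacobian R`.
-/
theorem jacobianDet_of_eq_X_pow_mul {R : Fin 3 → Poly3} {k : ℕ} {u : Poly3}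
    (h : R 1 = X 1 ^ (k + 1) * u) : ∃ w, jacobianDet R =
      X 1 ^ k * (C (k + 1 : ℂ) * u * lineJacobian R + X 1 * w) := by
  have hd0 : pderiv 0 (R 1) = X 1 ^ (k + 1) * pderiv 0 u := by
    rw [h, pderiv_mul, pderiv_pow, pderiv_X_of_ne (by decide)]
    ring
  have hd2 : pderiv 2 (R 1) = X 1 ^ (k + 1) * pderiv 2 u := by
    rw [h, pderiv_mul, pderiv_pow, pderiv_X_of_ne (by decide)]
    ring
  have hd1 : pderiv 1 (R 1) = X 1 ^ k * (C (k + 1 : ℂ) * u) + X 1 ^ (k + 1) * pderiv 1 u := by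
    rw [h, pderiv_mul, pderiv_pow, pderiv_X_self]
    simp
    ring
  refine ⟨pderiv 1 u * lineJacobian R -
    pderiv 0 u * (pderiv 1 (R 0) * pderiv 2 (R 2) - pderiv 2 (R 0) * pderiv 1 (R 2)) -
    pderiv 2 u * (pderiv 0 (R 0) * pderiv 1 (R 2) - pderiv 1 (R 0) * pderiv 0 (R 2)), ?_⟩
  rw [jacobianDet, Matrix.det_fin_three, lineJacobian]
  simp only [Matrix.of_apply, hd0, hd1, hd2]
  ring

theorem X_pow_dvd_jacobianDet {R : Fin 3 → Poly3} (h : X 1 ^ 3 ∣ R 1) :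
    X 1 ^ 2 ∣ jacobianDet R := by
  obtain ⟨u, hu⟩ := h
  obtain ⟨w, hw⟩ := jacobianDet_of_eq_X_pow_mul (k := 2) hu
  exact ⟨_, hw⟩

theorem lineProduct_sq_dvd_jacobianDet {R : Fin 3 → Poly3} (hG : linearGroup ≤ commutant R)
    (h : X 1 ^ 3 ∣ R 1) : lineProduct ^ 2 ∣ jacobianDet R := by
  refine lineProduct_pow_dvd 2 fun i => ?_
  obtain ⟨k, hk, s, hs, -, h1⟩ := exists_subst_linearForm i
  rw [pow_dvd_iff_subst hs h1, subst_jacobianDet (hG hk)]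
  exact X_pow_dvd_jacobianDet h

theorem evalMap_eq_zero_of_X_dvd_lineJacobian {R : Fin 3 → Poly3} {n : ℕ} (hn : Odd n)
    (hR : ∀ i, (R i).IsHomogeneous n) (hG : linearGroup ≤ commutant R)
    (hJ : X 1 ∣ lineJacobian R) {v : Fin 3 → ℂ} (hv : v 1 = 0) : evalMap R v = 0 :=
  evalMap_eq_zero_of_lineJacobian hn hR hG (fun _ hv => X_dvd_iff_eval.mp hJ _ hv) hv

theorem exists_eq_X_pow_mul {p : Poly3} (hp : p ≠ 0) (h : X 1 ∣ p) :
    ∃ k u, p = X 1 ^ (k + 1) * u ∧ ¬ X 1 ∣ u := by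
  obtain ⟨u, hu, hu2⟩ := (FiniteMultiplicity.of_prime_left (X_prime (i := (1 : Fin 3)) (R := ℂ))
    hp).exists_eq_pow_mul_and_not_dvd
  set m := multiplicity (X 1) p with hm
  rcases Nat.eq_zero_or_pos m with h0 | h0
  · rw [h0, pow_zero, one_mul] at hu
    rw [hu] at h
    exact absurd h hu2
  · obtain ⟨k, hk⟩ := Nat.exists_eq_succ_of_ne_zero h0.ne'
    exact ⟨k, u, by rw [hu, hk], hu2⟩

theorem X_dvd_lineJacobian {u J w : Poly3} {k : ℕ} (hu : ¬ X 1 ∣ u)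
    (h : X 1 ∣ C (k + 1 : ℂ) * u * J + X 1 * w) : X 1 ∣ J := by
  have h1 : X 1 ∣ C (k + 1 : ℂ) * u * J := (dvd_add_left (dvd_mul_right _ _)).mp h
  rw [mul_assoc, (isUnit_C (by exact_mod_cast k.succ_ne_zero)).dvd_mul_left] at h1
  exact (X_prime.dvd_or_dvd h1).resolve_left hu

theorem toComplex_coroot_seven : (fun j => toComplex (coroot 7 j)) = ![0, 2, 0] := by
  have h : coroot 7 = ![⟨0, 0⟩, ⟨2, 0⟩, ⟨0, 0⟩] := by decide +kernel
  rw [h]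
  funext j
  fin_cases j <;> simp [toComplex_apply]

theorem toComplex_coroot_eight : (fun j => toComplex (coroot 8 j)) = ![0, 0, 2] := by
  have h : coroot 8 = ![⟨0, 0⟩, ⟨0, 0⟩, ⟨2, 0⟩] := by decide +kernel
  rw [h]
  funext j
  fin_cases j <;> simp [toComplex_apply]

/-- An equivariant map of small odd degree with vanishing Jacobian determinant vanishes. -/
theorem eq_zero_of_jacobianDet_eq_zero {R : Fin 3 → Poly3} {n : ℕ} (hn : Odd n) (hn21 : n < 21)
    (hR : ∀ i, (R i).IsHomogeneous n) (hG : linearGroup ≤ commutant R) (hJ : jacobianDet R = 0)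
    (i : Fin 3) : R i = 0 := by
  by_cases h1 : R 1 = 0
  · have h2 (i : Fin 21) (v : Fin 3 → ℂ) : reflForm i ⬝ᵥ evalMap R v = 0 := by
      obtain ⟨k, hk, s, -, -, h3⟩ := exists_conj_refl i
      have h4 := mem_commutant.mp (hG hk) ((k⁻¹).1 *ᵥ v)
      rw [Matrix.mulVec_mulVec, Units.mul_inv, Matrix.one_mulVec] at h4
      rw [h4, Matrix.dotProduct_mulVec, h3, reflForm_zero, smul_smul, smul_dotProduct,
        single_dotProduct]
      simp [evalMap, h1]
    have h3 (v : Fin 3 → ℂ) : matrixM *ᵥ evalMap R v = 0 := by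
      have h6 := h2 6 v
      have h7 := h2 7 v
      have h8 := h2 8 v
      rw [reflForm_dotProduct] at h6 h7 h8
      rw [toComplex_coroot_six] at h6
      rw [toComplex_coroot_seven] at h7
      rw [toComplex_coroot_eight] at h8
      simp [dotProduct, Fin.sum_univ_three] at h6 h7 h8
      funext j
      fin_cases j
      · exact h6
      · exact h7
      · exact h8
    apply MvPolynomial.funext
    intro v
    rw [map_zero]
    have h4 : evalMap R v = 0 := by
      have h5 := congrArg (fun w => (coordChange⁻¹).1 *ᵥ w) (h3 v)
      simp only [← coordChange_mulVec, Matrix.mulVec_zero] at h5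
      rwa [Matrix.mulVec_mulVec, Units.inv_mul, Matrix.one_mulVec] at h5
    exact congrFun h4 i
  · have h2 : X 1 ∣ R 1 := X_dvd_iff_eval.mpr fun v hv => evalMap_one_eq_zero hn hR hG hv
    obtain ⟨k, u, hk, hu⟩ := exists_eq_X_pow_mul h1 h2
    obtain ⟨w, hw⟩ := jacobianDet_of_eq_X_pow_mul hk
    rw [hJ] at hw
    have h3 := (mul_eq_zero.mp hw.symm).resolve_left (pow_ne_zero _ (X_ne_zero _))
    have h4 : X 1 ∣ lineJacobian R := X_dvd_lineJacobian hu (by rw [h3]; exact dvd_zero _)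
    have h5 (j : Fin 3) : X 1 ∣ R j := X_dvd_iff_eval.mpr fun v hv =>
      congrFun (evalMap_eq_zero_of_X_dvd_lineJacobian hn hR hG h4 hv) j
    refine eq_zero_of_lineProduct_dvd (hR i) hn21 ?_
    rw [← pow_one lineProduct]
    -- Vanishing on y₂ = 0 spreads by equivariance to all 21 lines, and the degree of R is below 21.
    refine lineProduct_pow_dvd 1 fun l => ?_
    obtain ⟨g, hg, s, hs, -, h6⟩ := exists_subst_linearForm l
    rw [pow_dvd_iff_subst hs h6, pow_one, mem_commutant_iff_subst.mp (hG hg)]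
    rw [Matrix.mulVec, dotProduct]
    exact Finset.dvd_sum fun j _ => (h5 j).mul_left _

/-- A doubly critical equivariant map is tangent to the third order to the line `y₂ = 0`. -/
theorem X_pow_dvd_of_dvd_jacobianDet {R : Fin 3 → Poly3} {n : ℕ} (hn : Odd n)
    (hR : ∀ i, (R i).IsHomogeneous n) (hG : linearGroup ≤ commutant R)
    (h0 : ∃ v : Fin 3 → ℂ, v 1 = 0 ∧ evalMap R v ≠ 0) (hJ : X 1 ^ 2 ∣ jacobianDet R) :
    X 1 ^ 3 ∣ R 1 := by
  by_cases h1 : R 1 = 0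
  · rw [h1]
    exact dvd_zero _
  have h2 : X 1 ∣ R 1 := X_dvd_iff_eval.mpr fun v hv => evalMap_one_eq_zero hn hR hG hv
  obtain ⟨k, u, hk, hu⟩ := exists_eq_X_pow_mul h1 h2
  by_cases hk2 : 2 ≤ k
  · rw [hk]
    exact (pow_dvd_pow _ (by omega)).mul_right _
  exfalso
  obtain ⟨w, hw⟩ := jacobianDet_of_eq_X_pow_mul hk
  -- Here k ≤ 1, so y₂² already supplies one factor y₂ beyond y₂^k. As y₂ does not divide u, it must
  -- divide `lineJacobian R`.
  have h3 : X 1 ^ (k + 1) ∣ X 1 ^ k * (C (k + 1 : ℂ) * u * lineJacobian R + X 1 * w) := by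
    rw [← hw]
    exact (pow_dvd_pow _ (by omega)).trans hJ
  rw [pow_succ] at h3
  have h4 := (mul_dvd_mul_iff_left (pow_ne_zero k (X_ne_zero (R := ℂ) (1 : Fin 3)))).mp h3
  obtain ⟨v, hv, hv0⟩ := h0
  exact hv0 (evalMap_eq_zero_of_X_dvd_lineJacobian hn hR hG (X_dvd_lineJacobian hu h4) hv)

/-! ### The map `h` -/

theorem isHomogeneous_ofTerms {L : List (ℤ × ℕ × ℕ × ℕ)} {n : ℕ}
    (h : ∀ t ∈ L, t.2.1 + t.2.2.1 + t.2.2.2 = n) : (ofTerms L).IsHomogeneous n := by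
  induction L with
  | nil => exact isHomogeneous_zero _ _ _
  | cons t L ih =>
    have h1 : ofTerms (t :: L) = C (t.1 : ℂ) * X 0 ^ t.2.1 * X 1 ^ t.2.2.1 * X 2 ^ t.2.2.2 +
        ofTerms L := rfl
    rw [h1]
    refine IsHomogeneous.add ?_ (ih fun t ht => h t (List.mem_cons_of_mem _ ht))
    rw [← h t List.mem_cons_self]
    have h2 := (((isHomogeneous_C (Fin 3) (t.1 : ℂ)).mul (isHomogeneous_X_pow (R := ℂ) (0 : Fin 3)
      t.2.1)).mul (isHomogeneous_X_pow (R := ℂ) (1 : Fin 3) t.2.2.1)).mul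
      (isHomogeneous_X_pow (R := ℂ) (2 : Fin 3) t.2.2.2)
    rwa [zero_add] at h2

theorem isHomogeneous_det {n : Type*} [Fintype n] [DecidableEq n] {A : Matrix n n Poly3} {d : n → ℕ}
    (h : ∀ i j, (A i j).IsHomogeneous (d i + d j)) : A.det.IsHomogeneous (2 * ∑ i, d i) := by
  rw [Matrix.det_apply]
  refine IsHomogeneous.sum _ _ _ fun σ _ => ?_
  have h1 := IsHomogeneous.prod Finset.univ (fun i => A (σ i) i) (fun i => d (σ i) + d i)
    fun i _ => h (σ i) i
  rw [Finset.sum_add_distrib, Equiv.sum_comp σ d, ← two_mul] at h1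
  rcases Int.units_eq_one_or (Equiv.Perm.sign σ) with h2 | h2 <;> rw [h2]
  · simpa using h1
  · simpa using h1.neg

theorem isHomogeneous_polyF : polyF.IsHomogeneous 4 := isHomogeneous_ofTerms (by decide)

theorem isHomogeneous_polyPhi : polyPhi.IsHomogeneous 6 := by
  rw [polyPhi_eq]
  exact isHomogeneous_ofTerms (by decide)

theorem isHomogeneous_polyPsi : polyPsi.IsHomogeneous 14 := by
  have h : borderedHessian.det.IsHomogeneous 14 := by
    -- The weights are 1 for the variables and 4 for the border: Hessian entries have degree 1 + 1,
    -- border entries 1 + 4, and the determinant 2(3 + 4) = 14. The zero corner has every degree.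
    have h1 := isHomogeneous_det (A := borderedHessian) (d := Sum.elim (fun _ => 1) fun _ => 4) (by
      rintro (i | i) (j | j)
      · exact isHomogeneous_polyF.pderiv.pderiv
      · exact isHomogeneous_polyPhi.pderiv
      · exact isHomogeneous_polyPhi.pderiv
      · exact isHomogeneous_zero _ _ _)
    simpa using h1
  rw [polyPsi, ← zero_add 14]
  exact (isHomogeneous_C _ _).mul h

theorem isHomogeneous_mapH (i : Fin 3) : (mapH i).IsHomogeneous 15 := by
  have h9 : (mapG9 i).IsHomogeneous 9 := by
    fin_cases i <;> exact isHomogeneous_ofTerms (by decide)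
  have h11 : (mapG11 i).IsHomogeneous 11 := by
    fin_cases i <;> exact isHomogeneous_ofTerms (by decide)
  have hC (c : ℂ) := isHomogeneous_C (Fin 3) c
  have h1 : (C (827 / 14) * polyF ^ 2 * polyPhi).IsHomogeneous 14 :=
    ((hC _).mul (isHomogeneous_polyF.pow 2)).mul isHomogeneous_polyPhi
  have h2 : (C (99 / 49) * polyPsi).IsHomogeneous 14 := by
    have := (hC (99 / 49)).mul isHomogeneous_polyPsi
    rwa [zero_add] at this
  have h3 : (C (11 / 98) * polyPhi * mapG9 i).IsHomogeneous 15 :=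
    ((hC _).mul isHomogeneous_polyPhi).mul h9
  have h4 : (C (9 / 49) * polyF * mapG11 i).IsHomogeneous 15 :=
    ((hC _).mul isHomogeneous_polyF).mul h11
  exact (((h1.add h2).mul (isHomogeneous_X ℂ i)).add h3).add h4

/-! ### Restriction of h to the line y₂ = 0 -/

/-- The index equivalence for the bordered Hessian. -/
def finFourEquiv : Fin 4 ≃ Fin 3 ⊕ Unit where
  toFun := ![Sum.inl 0, Sum.inl 1, Sum.inl 2, Sum.inr ()]
  invFun := Sum.elim ![0, 1, 2] fun _ => 3
  left_inv := by decide
  right_inv := by decide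

theorem det_bordered (H : Matrix (Fin 3) (Fin 3) ℂ) (g : Fin 3 → ℂ) :
    (Matrix.fromBlocks H (Matrix.of fun i (_ : Unit) => g i) (Matrix.of fun (_ : Unit) j => g j)
      0).det = -(g ⬝ᵥ (H.adjugate *ᵥ g)) := by
  have h : (Matrix.fromBlocks H (Matrix.of fun i (_ : Unit) => g i)
      (Matrix.of fun (_ : Unit) j => g j) 0).submatrix finFourEquiv finFourEquiv =
      !![H 0 0, H 0 1, H 0 2, g 0; H 1 0, H 1 1, H 1 2, g 1; H 2 0, H 2 1, H 2 2, g 2;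
        g 0, g 1, g 2, 0] := by
    ext i j
    fin_cases i <;> fin_cases j <;> rfl
  rw [← Matrix.det_submatrix_equiv_self finFourEquiv, h, Matrix.det_succ_row_zero]
  simp [Fin.sum_univ_succ, Matrix.det_fin_three, Fin.succAbove, Matrix.adjugate_fin_three,
    Matrix.mulVec, dotProduct]
  ring

/-- All explicit computations with h take place on the line, so the full expansion of Ψ in three
variables is never needed. -/
theorem eval_polyPsi_line {v : Fin 3 → ℂ} (hv : v 1 = 0) : eval v polyPsi =
    4388 * v 0 ^ 14 + 62916 * v 0 ^ 13 * v 2 + 378574 * v 0 ^ 12 * v 2 ^ 2 + 853384 * v 0 ^ 11 * v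
    2 ^ 3 - 4618152 * v 0 ^ 10 * v 2 ^ 4 - 26185306 * v 0 ^ 9 * v 2 ^ 5 - 48569829 * v 0 ^ 8 * v 2
    ^ 6 + 70186032 * v 0 ^ 7 * v 2 ^ 7 - 90656958 * v 0 ^ 6 * v 2 ^ 8 + 156473170 * v 0 ^ 5 * v 2
    ^ 9 + 237533331 * v 0 ^ 4 * v 2 ^ 10 - 448007392 * v 0 ^ 3 * v 2 ^ 11 + 130119794 * v 0 ^ 2 *
    v 2 ^ 12 + 3294172 * v 2 ^ 14 := by
  have h1 : (borderedHessian.map (eval v)) = Matrix.fromBlocks ((hessian polyF).map (eval v))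
      (Matrix.of fun i (_ : Unit) => (fun i => eval v (gradient polyPhi i)) i)
      (Matrix.of fun (_ : Unit) j => (fun i => eval v (gradient polyPhi i)) j) 0 := by
    ext (i | i) (j | j) <;> simp [borderedHessian, gradient, hessian, hessianF]
  rw [polyPsi, map_mul, eval_C, eval_det, h1, det_bordered, hessian_polyF, gradient_polyPhi,
    Matrix.adjugate_fin_three_of]
  simp [hv, Matrix.mulVec, dotProduct, Fin.sum_univ_three]
  ring

/-- The second factor of the first form (degree 11) and the second form (degree 15) are coprime, and
coprime forms of these degrees generate all binary forms of degree 11 + 15 - 1 = 25. The large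
cofactors express a multiple of z^25. The cases x = 0 and z = 0 then follow from the nonzero
coefficients of z^15 and x^15. -/
theorem eq_zero_of_binary_eq_zero {x z : ℂ}
    (hA : x ^ 4 * (22032 * x ^ 11 + 113400 * x ^ 10 * z + 45360 * x ^ 9 * z ^ 2 + 2619540 * x ^ 8 * z ^ 3 -
      8989785 * x ^ 7 * z ^ 4 - 25671492 * x ^ 6 * z ^ 5 - 73347120 * x ^ 5 * z ^ 6 + 64178730 * x
      ^ 4 * z ^ 7 - 32089365 * x ^ 3 * z ^ 8 + 299500740 * x ^ 2 * z ^ 9 + 209650518 * x * z ^ 10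
      - 1048252590 * z ^ 11) = 0)
    (hB : -704 * x ^ 15 + 36960 * x ^ 14 * z + 221760 * x ^ 13 * z ^ 2 + 560560 * x ^ 12 * z ^ 3 +
      2651880 * x ^ 11 * z ^ 4 - 7844067 * x ^ 10 * z ^ 5 - 23185085 * x ^ 9 * z ^ 6 - 68083785 *
      x ^ 8 * z ^ 7 + 121226490 * x ^ 7 * z ^ 8 - 187914265 * x ^ 6 * z ^ 9 + 202440315 * x ^ 5 *
      z ^ 10 + 150506685 * x ^ 4 * z ^ 11 - 767071480 * x ^ 3 * z ^ 12 - 141178800 * x ^ 2 * z ^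
      13 + 105413504 * z ^ 15 = 0) :
    x = 0 ∧ z = 0 := by
  rcases mul_eq_zero.mp hA with h | h
  · have hx : x = 0 := pow_eq_zero_iff (by norm_num) |>.mp h
    rw [hx] at hB
    refine ⟨hx, pow_eq_zero_iff (n := 15) (by norm_num) |>.mp ?_⟩
    linear_combination (1 / 105413504 : ℂ) * hB
  · have hz : z = 0 := by
      refine pow_eq_zero_iff (n := 25) (by norm_num) |>.mp ?_
      linear_combination (1 / 14266723535563307584699478016 : ℂ) *
        ((-3287894945984 * x ^ 14 + 161643507109920 * x ^ 13 * z + 1601027596155680 * x ^ 12 * z ^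
          2 + 6610144564192400 * x ^ 11 * z ^ 3 + 25606095327424920 * x ^ 10 * z ^ 4 +
          21308641210752973 * x ^ 9 * z ^ 5 - 163293263846224050 * x ^ 8 * z ^ 6 -
          683469741343695075 * x ^ 7 * z ^ 7 - 973036431838636935 * x ^ 6 * z ^ 8 -
          862951437597927370 * x ^ 5 * z ^ 9 - 3579627683318998311 * x ^ 4 * z ^ 10 +
          1203940459933519000 * x ^ 3 * z ^ 11 - 3937083765393805040 * x ^ 2 * z ^ 12 -
          2601001125542225280 * x * z ^ 13 - 13941941017017032320 * z ^ 14) * h +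
        (-102896166832272 * x ^ 10 - 872954352769320 * x ^ 9 * z - 2311892109462600 * x ^ 8 * z ^
          2 - 15344820053006220 * x ^ 7 * z ^ 3 - 3814947960942195 * x ^ 6 * z ^ 4 +
          213909372686656647 * x ^ 5 * z ^ 5 + 788481023815058805 * x ^ 4 * z ^ 6 +
          1424482549162211385 * x ^ 3 * z ^ 7 + 1212910630640838360 * x ^ 2 * z ^ 8 +
          1863413910427594140 * x * z ^ 9 - 3300831790507889946 * z ^ 10) * hB)
    rw [hz] at hB
    refine ⟨pow_eq_zero_iff (n := 15) (by norm_num) |>.mp ?_, hz⟩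
    linear_combination (1 / (-704) : ℂ) * hB

theorem eval_mapH_zero_line {v : Fin 3 → ℂ} (hv : v 1 = 0) : eval v (mapH 0) =
    v 0 ^ 4 * (22032 * v 0 ^ 11 + 113400 * v 0 ^ 10 * v 2 + 45360 * v 0 ^ 9 * v 2 ^ 2 + 2619540 * v 0 ^ 8 *
      v 2 ^ 3 - 8989785 * v 0 ^ 7 * v 2 ^ 4 - 25671492 * v 0 ^ 6 * v 2 ^ 5 - 73347120 * v 0 ^ 5 *
      v 2 ^ 6 + 64178730 * v 0 ^ 4 * v 2 ^ 7 - 32089365 * v 0 ^ 3 * v 2 ^ 8 + 299500740 * v 0 ^ 2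
      * v 2 ^ 9 + 209650518 * v 0 * v 2 ^ 10 - 1048252590 * v 2 ^ 11) := by
  have h0 : mapG9 0 = ofTerms _ := rfl
  have h1 : mapG11 0 = ofTerms _ := rfl
  rw [mapH, h0, h1]
  simp only [map_add, map_mul, map_pow, eval_C, eval_X, eval_ofTerms, eval_polyF, eval_polyPhi,
    eval_polyPsi_line hv, hv]
  simp
  ring

theorem eval_mapH_two_line {v : Fin 3 → ℂ} (hv : v 1 = 0) : eval v (mapH 2) =
    -704 * v 0 ^ 15 + 36960 * v 0 ^ 14 * v 2 + 221760 * v 0 ^ 13 * v 2 ^ 2 + 560560 * v 0 ^ 12 *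
      v 2 ^ 3 + 2651880 * v 0 ^ 11 * v 2 ^ 4 - 7844067 * v 0 ^ 10 * v 2 ^ 5 - 23185085 * v 0 ^ 9 *
      v 2 ^ 6 - 68083785 * v 0 ^ 8 * v 2 ^ 7 + 121226490 * v 0 ^ 7 * v 2 ^ 8 - 187914265 * v 0 ^ 6
      * v 2 ^ 9 + 202440315 * v 0 ^ 5 * v 2 ^ 10 + 150506685 * v 0 ^ 4 * v 2 ^ 11 - 767071480 * v
      0 ^ 3 * v 2 ^ 12 - 141178800 * v 0 ^ 2 * v 2 ^ 13 + 105413504 * v 2 ^ 15 := by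
  have h0 : mapG9 2 = ofTerms _ := rfl
  have h1 : mapG11 2 = ofTerms _ := rfl
  rw [mapH, h0, h1]
  simp only [map_add, map_mul, map_pow, eval_C, eval_X, eval_ofTerms, eval_polyF, eval_polyPhi,
    eval_polyPsi_line hv, hv]
  simp
  ring

theorem X_pow_three_dvd_mapH : X 1 ^ 3 ∣ mapH 1 := by
  have hdvd : X 1 ∣ mapH 1 := X_dvd_iff_eval.mpr fun v hv =>
    evalMap_one_eq_zero (by decide) isHomogeneous_mapH linearGroup_le_commutant_mapH hv
  -- This is where the coefficients of h matter: they make this derivative cancel on the line. The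
  -- derivative of Ψ enters only with a factor y₂, so the values of Ψ on the line suffice.
  have hderiv {v : Fin 3 → ℂ} (hv : v 1 = 0) : eval v (pderiv 1 (mapH 1)) = 0 := by
    have h0 : mapG9 1 = ofTerms _ := rfl
    have h1 : mapG11 1 = ofTerms _ := rfl
    rw [mapH, h0, h1]
    simp only [map_add, pderiv_mul, pderiv_C, pderiv_X_self, pderiv_ofTerms, map_mul, map_pow,
      eval_C, eval_X, eval_ofTerms, eval_polyF, eval_polyPhi, eval_polyPsi_line hv, hv]
    simp [derivTerm]
    ring
  by_cases h0 : mapH 1 = 0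
  · rw [h0]
    exact dvd_zero _
  obtain ⟨k, u, hk, hu⟩ := exists_eq_X_pow_mul h0 hdvd
  by_cases hk2 : 2 ≤ k
  · rw [hk]
    exact (pow_dvd_pow _ (by omega)).mul_right _
  exfalso
  apply hu
  rw [X_dvd_iff_eval]
  intro v hv
  obtain rfl | rfl : k = 0 ∨ k = 1 := by omega
  · have h1 := hderiv hv
    rw [hk] at h1
    simpa [pderiv_mul, hv] using h1
  -- If y₂² were the exact power, oddness of the second component of h would make u odd in y₂, so u
  -- would vanish on the line after all.
  · have h1 (w : Fin 3 → ℂ) (hw : w 1 ≠ 0) : eval ![w 0, -w 1, w 2] u = -eval w u := by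
      have h2 := mem_commutant.mp (linearGroup_le_commutant_mapH (refl_mem 0)) w
      have h3 : (refl 0).1 *ᵥ w = (-1 : ℂ) • ![w 0, -w 1, w 2] := by
        rw [refl_zero_mulVec]
        funext j
        fin_cases j <;> simp
      rw [refl_zero_mulVec (evalMap mapH w), h3, evalMap_smul isHomogeneous_mapH] at h2
      have h4 := congrFun h2 1
      simp [evalMap, hk] at h4
      have h5 : w 1 ^ 2 ≠ 0 := pow_ne_zero 2 hw
      apply mul_left_cancel₀ h5
      linear_combination -h4
    have h5 : subst (Matrix.diagonal ![1, -1, 1]) u = -u := by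
      -- Parity of u is known only where y₂ ≠ 0; multiplying by y₂ makes the identity hold
      -- everywhere, and the factor cancels in the polynomial ring.
      apply mul_left_cancel₀ (X_ne_zero (R := ℂ) (1 : Fin 3))
      apply MvPolynomial.funext
      intro w
      have h6 : Matrix.diagonal ![(1 : ℂ), -1, 1] *ᵥ w = ![w 0, -w 1, w 2] := by
        funext j
        fin_cases j <;> simp [Matrix.mulVec_diagonal]
      rw [map_mul, map_mul, eval_X, eval_subst, h6, map_neg]
      by_cases hw : w 1 = 0
      · rw [hw, zero_mul, zero_mul]
      · rw [h1 w hw]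
    have h7 := congrArg (eval v) h5
    have h8 : Matrix.diagonal ![(1 : ℂ), -1, 1] *ᵥ v = v := by
      funext j
      fin_cases j <;> simp [Matrix.mulVec_diagonal, hv]
    rw [eval_subst, h8, map_neg] at h7
    linear_combination (1 / 2 : ℂ) * h7

/-! ### Jacobian determinant and common zeros of h -/

/-- The components of `h` have no common zeros on the line `y₂ = 0`. -/
theorem eq_zero_of_evalMap_mapH_line {v : Fin 3 → ℂ} (hv : v 1 = 0) (h : evalMap mapH v = 0) :
    v = 0 := by
  have h0 : eval v (mapH 0) = 0 := congrFun h 0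
  have h2 : eval v (mapH 2) = 0 := congrFun h 2
  rw [eval_mapH_zero_line hv] at h0
  rw [eval_mapH_two_line hv] at h2
  obtain ⟨hx, hz⟩ := eq_zero_of_binary_eq_zero h0 h2
  funext j
  fin_cases j
  · exact hx
  · exact hv
  · exact hz

/-- Both sides have degree 3 · 14 = 2 · 21, so the quotient is constant. It is not 0, since a
vanishing Jacobian determinant would make h identically zero, against its having no zeros on the
line. -/
theorem jacobianDet_mapH : ∃ c : ℂ, c ≠ 0 ∧ jacobianDet mapH = C c * lineProduct ^ 2 := by
  obtain ⟨c, hc⟩ := eq_C_mul_of_dvd_of_isHomogeneous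
    (isHomogeneous_jacobianDet isHomogeneous_mapH) (isHomogeneous_lineProduct.pow 2)
    (pow_ne_zero 2 lineProduct_ne_zero)
    (lineProduct_sq_dvd_jacobianDet linearGroup_le_commutant_mapH X_pow_three_dvd_mapH)
  refine ⟨c, ?_, hc⟩
  rintro rfl
  rw [C_0, zero_mul] at hc
  have h1 := eq_zero_of_jacobianDet_eq_zero (by decide) (by decide) isHomogeneous_mapH
    linearGroup_le_commutant_mapH hc
  have h2 : (Pi.single 0 1 : Fin 3 → ℂ) = 0 :=
    eq_zero_of_evalMap_mapH_line (by simp) (by funext j; simp [evalMap, h1])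
  have h3 := congrFun h2 0
  simp at h3

/-- By Euler's identity J(R)(v) v = n R(v) = 0, so v is in the kernel of the Jacobian matrix. -/
theorem eval_jacobianDet_eq_zero {R : Fin 3 → Poly3} {n : ℕ} (hR : ∀ i, (R i).IsHomogeneous n)
    {v : Fin 3 → ℂ} (hv : v ≠ 0) (h : evalMap R v = 0) : eval v (jacobianDet R) = 0 := by
  rw [jacobianDet_eq, eval_det]
  refine Matrix.exists_mulVec_eq_zero_iff.mp ⟨v, hv, ?_⟩
  funext i
  have h1 := euler (hR i) v
  have h2 : eval v (R i) = 0 := congrFun h i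
  rw [h2, mul_zero] at h1
  simp [jacobian, Matrix.mulVec, dotProduct, Fin.sum_univ_three]
  linear_combination -h1

theorem eval_lineProduct_eq_zero_iff {v : Fin 3 → ℂ} :
    eval v lineProduct = 0 ↔ ∃ i, reflForm i ⬝ᵥ v = 0 := by
  simp [lineProduct, Finset.prod_eq_zero_iff, eval_linearForm]

theorem eq_zero_of_evalMap_mapH {v : Fin 3 → ℂ} (h : evalMap mapH v = 0) : v = 0 := by
  by_contra hv
  have h1 := eval_jacobianDet_eq_zero isHomogeneous_mapH hv h
  obtain ⟨c, hc, hJ⟩ := jacobianDet_mapH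
  rw [hJ, map_mul, eval_C, map_pow] at h1
  have h2 := eq_zero_of_pow_eq_zero ((mul_eq_zero.mp h1).resolve_left hc)
  obtain ⟨i, hi⟩ := eval_lineProduct_eq_zero_iff.mp h2
  obtain ⟨k, hk, s, hs, -, h3⟩ := exists_conj_refl i
  set w := (k⁻¹).1 *ᵥ v with hw
  have h4 : v = k.1 *ᵥ w := by rw [hw, Matrix.mulVec_mulVec, Units.mul_inv, Matrix.one_mulVec]
  have h5 : w 1 = 0 := by
    rw [h4, Matrix.dotProduct_mulVec, h3, reflForm_zero, smul_smul, smul_dotProduct,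
      single_dotProduct, one_mul, smul_eq_mul] at hi
    exact (mul_eq_zero.mp hi).resolve_left (mul_ne_zero hs reflForm_zero_scalar_ne_zero)
  have h6 : evalMap mapH w = 0 := by
    have h7 := mem_commutant.mp (linearGroup_le_commutant_mapH (inv_mem hk)) v
    rw [h, Matrix.mulVec_zero] at h7
    exact h7
  apply hv
  rw [h4, eq_zero_of_evalMap_mapH_line h5 h6, Matrix.mulVec_zero]

/-! ### Parallel triples of polynomials -/

/-- The components of b have no common root, so they generate the unit ideal. A Bezout relation then
turns pointwise proportionality into a = e b with a polynomial e. A root of e would be a common zero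
of a, so e is constant. -/
theorem exists_eq_C_mul_of_parallel {a b : Fin 3 → Polynomial ℂ}
    (ha : ∀ t, ∃ i, (a i).eval t ≠ 0) (hb : ∀ t, ∃ i, (b i).eval t ≠ 0)
    (h : ∀ t, ∃ c, ∀ i, (a i).eval t = c * (b i).eval t) :
    ∃ c, ∀ i, a i = Polynomial.C c * b i := by
  have hpar (i j : Fin 3) : a i * b j = a j * b i := by
    apply Polynomial.funext
    intro t
    obtain ⟨c, hc⟩ := h t
    rw [Polynomial.eval_mul, Polynomial.eval_mul, hc, hc]
    ring
  have htop : Ideal.span (Set.range b) = ⊤ := by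
    obtain ⟨p, hp⟩ := (IsPrincipalIdealRing.principal (Ideal.span (Set.range b))).principal
    rw [Ideal.submodule_span_eq] at hp
    rw [hp, Ideal.span_singleton_eq_top]
    have hdvd (i : Fin 3) : p ∣ b i := by
      rw [← Ideal.mem_span_singleton, ← hp]
      exact Ideal.subset_span ⟨i, rfl⟩
    rw [Polynomial.isUnit_iff_degree_eq_zero]
    by_contra hdeg
    obtain ⟨t, ht⟩ := IsAlgClosed.exists_root p hdeg
    obtain ⟨i, hi⟩ := hb t
    exact hi (ht.dvd (hdvd i))
  rw [Ideal.eq_top_iff_one, Ideal.mem_span_range_iff_exists_fun] at htop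
  obtain ⟨u, hu⟩ := htop
  set e := ∑ i, u i * a i with he
  have hae (j : Fin 3) : a j = e * b j := by
    rw [he, Finset.sum_mul]
    calc a j = a j * ∑ i, u i * b i := by rw [hu, mul_one]
      _ = ∑ i, u i * a i * b j := by
        rw [Finset.mul_sum]
        exact Finset.sum_congr rfl fun i _ => by linear_combination (-u i) * hpar i j
  have hdeg : e.degree = 0 := by
    by_contra hdeg
    obtain ⟨t, ht⟩ := IsAlgClosed.exists_root e hdeg
    obtain ⟨i, hi⟩ := ha t
    apply hi
    rw [hae, Polynomial.eval_mul, ht.eq_zero, zero_mul]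
  rw [Polynomial.eq_C_of_degree_eq_zero hdeg] at hae
  exact ⟨_, hae⟩

theorem exists_evalMap_eq_smul_on_line {A B : Fin 3 → Poly3} (hA : ∀ v, v ≠ 0 → evalMap A v ≠ 0)
    (hB : ∀ v, v ≠ 0 → evalMap B v ≠ 0)
    (h : ∀ v, v ≠ 0 → ∃ c : ℂ, evalMap A v = c • evalMap B v) {v w : Fin 3 → ℂ}
    (hvw : ∀ t : ℂ, v + t • w ≠ 0) :
    ∃ c : ℂ, ∀ t : ℂ, evalMap A (v + t • w) = c • evalMap B (v + t • w) := by
  obtain ⟨c, hc⟩ := exists_eq_C_mul_of_parallel (a := fun i => restrictLine v w (A i))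
    (b := fun i => restrictLine v w (B i))
    (fun t => by
      simp only [eval_restrictLine]
      exact Function.ne_iff.mp (hA _ (hvw t)))
    (fun t => by
      simp only [eval_restrictLine]
      exact Function.ne_iff.mp (hB _ (hvw t)))
    (fun t => by
      simp only [eval_restrictLine]
      obtain ⟨c, hc⟩ := h _ (hvw t)
      exact ⟨c, fun i => congrFun hc i⟩)
  refine ⟨c, fun t => funext fun i => ?_⟩
  have h1 := congrArg (Polynomial.eval t) (hc i)
  rwa [Polynomial.eval_mul, Polynomial.eval_C, eval_restrictLine, eval_restrictLine] at h1

/-- Two lifts of the same map are proportional. -/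
theorem exists_evalMap_eq_smul {A B : Fin 3 → Poly3} {n : ℕ}
    (hAn : ∀ (c : ℂ) v, evalMap A (c • v) = c ^ n • evalMap A v)
    (hBn : ∀ (c : ℂ) v, evalMap B (c • v) = c ^ n • evalMap B v)
    (hA : ∀ v, v ≠ 0 → evalMap A v ≠ 0) (hB : ∀ v, v ≠ 0 → evalMap B v ≠ 0)
    (h : ∀ v, v ≠ 0 → ∃ c : ℂ, evalMap A v = c • evalMap B v) :
    ∃ c : ℂ, ∀ v, evalMap A v = c • evalMap B v := by
  set v₀ : Fin 3 → ℂ := Pi.single 0 1 with hv₀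
  have hv₀0 : v₀ ≠ 0 := by simp [hv₀]
  obtain ⟨c, hc⟩ := h v₀ hv₀0
  refine ⟨c, fun w => ?_⟩
  by_cases hw : ∃ s : ℂ, w = s • v₀
  · obtain ⟨s, rfl⟩ := hw
    rw [hAn, hBn, hc, smul_comm]
  have h1 (t : ℂ) : w + t • v₀ ≠ 0 := fun ht =>
    hw ⟨-t, by rw [neg_smul]; exact eq_neg_of_add_eq_zero_left ht⟩
  have h2 (t : ℂ) : v₀ + t • w ≠ 0 := by
    intro ht
    by_cases ht0 : t = 0
    · rw [ht0, zero_smul, add_zero] at ht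
      exact hv₀0 ht
    · refine hw ⟨-t⁻¹, ?_⟩
      rw [eq_neg_of_add_eq_zero_left ht, neg_smul, smul_neg, neg_neg, smul_smul,
        inv_mul_cancel₀ ht0, one_smul]
  -- The factor is constant on two affine lines, one through v₀ and one through w, which meet at v₀
  -- + w. Hence the factor at w equals the factor at v₀.
  obtain ⟨k, hk⟩ := exists_evalMap_eq_smul_on_line hA hB h h2
  obtain ⟨l, hl⟩ := exists_evalMap_eq_smul_on_line hA hB h h1
  have h3 {x y : ℂ} {v : Fin 3 → ℂ} (hv : v ≠ 0) (hx : evalMap A v = x • evalMap B v)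
      (hy : evalMap A v = y • evalMap B v) : x = y :=
    smul_left_injective ℂ (hB v hv) (hx.symm.trans hy)
  have hk0 := hk 0
  have hl0 := hl 0
  have hk1 := hk 1
  have hl1 := hl 1
  rw [zero_smul, add_zero] at hk0 hl0
  have hw1 := h1 1
  rw [one_smul] at hk1 hl1 hw1
  rw [add_comm] at hk1
  rw [hl0, h3 hv₀0 hc hk0, h3 hw1 hk1 hl1]

/-! ### Lifts -/

theorem exists_isLift {P : Fin 3 → Poly3} {n : ℕ} (hP : ∀ i, (P i).IsHomogeneous n)
    (h0 : ∀ v, evalMap P v = 0 → v = 0) : ∃ f, IsLift n P f := by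
  refine ⟨Projectivization.lift
    (fun v => Projectivization.mk ℂ (evalMap P v.1) fun h => v.2 (h0 _ h)) ?_, hP, ?_⟩
  · intro a b t hab
    rw [Projectivization.mk_eq_mk_iff']
    exact ⟨t ^ n, by rw [hab, evalMap_smul hP]⟩
  · intro v hv
    exact ⟨fun h => hv (h0 _ h), rfl⟩

theorem IsLift.evalMap_ne_zero {n : ℕ} {P : Fin 3 → Poly3} {f : CP2 → CP2} (h : IsLift n P f)
    {v : Fin 3 → ℂ} (hv : v ≠ 0) : evalMap P v ≠ 0 := (h.2 v hv).1

theorem IsLift.apply_mk {n : ℕ} {P : Fin 3 → Poly3} {f : CP2 → CP2} (h : IsLift n P f)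
    {v : Fin 3 → ℂ} (hv : v ≠ 0) :
    f (Projectivization.mk ℂ v hv) = Projectivization.mk ℂ (evalMap P v) (h.evalMap_ne_zero hv) :=
  (h.2 v hv).2

theorem IsLift.eq_of_evalMap_eq_smul {m n : ℕ} {P Q : Fin 3 → Poly3} {f g : CP2 → CP2}
    (hf : IsLift m P f) (hg : IsLift n Q g) (c : ℂ) (h : ∀ v, evalMap P v = c • evalMap Q v) :
    f = g := by
  funext p
  induction p using Projectivization.ind with
  | h v hv =>
    rw [hf.apply_mk, hg.apply_mk, Projectivization.mk_eq_mk_iff']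
    exact ⟨c, (h v).symm⟩

theorem mulVec_ne_zero (g : GL (Fin 3) ℂ) {v : Fin 3 → ℂ} (hv : v ≠ 0) : g.1 *ᵥ v ≠ 0 := by
  intro h
  apply hv
  rw [← Matrix.one_mulVec v, ← Units.inv_mul g, ← Matrix.mulVec_mulVec, h, Matrix.mulVec_zero]

theorem mk_smul_mk_eq (g : GL (Fin 3) ℂ) {v : Fin 3 → ℂ} (hv : v ≠ 0) :
    (Matrix.ProjGenLinGroup.mk g : PGL(3, ℂ)) • Projectivization.mk ℂ v hv =
      Projectivization.mk ℂ (g.1 *ᵥ v) (mulVec_ne_zero g hv) := rfl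

theorem IsLift.isEquivariant {n : ℕ} {P : Fin 3 → Poly3} {f : CP2 → CP2} (h : IsLift n P f)
    (hG : linearGroup ≤ commutant P) : IsEquivariant f := by
  rintro _ ⟨g, hg, rfl⟩ p
  induction p using Projectivization.ind with
  | h v hv =>
    rw [mk_smul_mk_eq, h.apply_mk, h.apply_mk, mk_smul_mk_eq]
    congr 1
    exact mem_commutant.mp (hG hg) v

/-- Both P ∘ g and g ∘ P lift the same projective map, so they differ by one constant, independent
of the point. -/
theorem IsLift.exists_evalMap_mulVec {n : ℕ} {P : Fin 3 → Poly3} {f : CP2 → CP2}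
    (h : IsLift n P f) (hf : IsEquivariant f) {g : GL (Fin 3) ℂ} (hg : g ∈ linearGroup) :
    ∃ c : ℂ, ∀ v, evalMap P (g.1 *ᵥ v) = c • g.1 *ᵥ evalMap P v := by
  have hA (v : Fin 3 → ℂ) : evalMap (fun i => subst g.1 (P i)) v = evalMap P (g.1 *ᵥ v) := by
    funext i
    exact eval_subst _ _ _
  have hB (v : Fin 3 → ℂ) : evalMap ((g.1.map C) *ᵥ P) v = g.1 *ᵥ evalMap P v := by
    funext i
    simp [evalMap, Matrix.mulVec, dotProduct]
  have hmain := exists_evalMap_eq_smul (A := fun i => subst g.1 (P i)) (B := (g.1.map C) *ᵥ P) (n := n)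
  simp only [hA, hB] at hmain
  refine hmain ?_ ?_ ?_ ?_ ?_
  · intro c v
    rw [Matrix.mulVec_smul, evalMap_smul h.1]
  · intro c v
    rw [evalMap_smul h.1, Matrix.mulVec_smul]
  · exact fun v hv => h.evalMap_ne_zero (mulVec_ne_zero g hv)
  · exact fun v hv => mulVec_ne_zero g (h.evalMap_ne_zero hv)
  · intro v hv
    have h1 := hf _ ⟨g, hg, rfl⟩ (Projectivization.mk ℂ v hv)
    rw [mk_smul_mk_eq, h.apply_mk, h.apply_mk, mk_smul_mk_eq, Projectivization.mk_eq_mk_iff'] at h1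
    obtain ⟨c, hc⟩ := h1
    exact ⟨c, hc.symm⟩

/-! ### The critical set -/

theorem eval_smul_of_isHomogeneous {p : Poly3} {n : ℕ} (hp : p.IsHomogeneous n) (c : ℂ)
    (v : Fin 3 → ℂ) : eval (c • v) p = c ^ n * eval v p :=
  congrFun (evalMap_smul (R := fun _ => p) (fun _ => hp) c v) 0

theorem mk_mem_sUnion_reflectionLines {v : Fin 3 → ℂ} (hv : v ≠ 0) :
    Projectivization.mk ℂ v hv ∈ ⋃₀ reflectionLines ↔ ∃ i, reflForm i ⬝ᵥ v = 0 := by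
  rw [reflectionLines_eq]
  simp [mk_mem_projLine hv]

theorem zeroSet_eq_iff {p : Poly3} {n : ℕ} (hp : p.IsHomogeneous n) :
    {x : CP2 | eval x.rep p = 0} = ⋃₀ reflectionLines ↔
      ∀ v : Fin 3 → ℂ, v ≠ 0 → (eval v p = 0 ↔ ∃ i, reflForm i ⬝ᵥ v = 0) := by
  rw [Set.ext_iff]
  have h (v : Fin 3 → ℂ) (hv : v ≠ 0) :
      eval (Projectivization.mk ℂ v hv).rep p = 0 ↔ eval v p = 0 := by
    obtain ⟨c, hc⟩ := Projectivization.exists_smul_eq_mk_rep ℂ v hv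
    rw [← hc, Units.smul_def, eval_smul_of_isHomogeneous hp]
    simp
  constructor
  · intro h1 v hv
    rw [← h v hv, ← mk_mem_sUnion_reflectionLines hv, ← h1]
    rfl
  · intro h1 x
    induction x using Projectivization.ind with
    | h v hv =>
      rw [mk_mem_sUnion_reflectionLines hv, ← h1 v hv, ← h v hv]
      rfl

theorem linearForm_dvd_lineProduct (i : Fin 21) : linearForm (reflForm i) ∣ lineProduct :=
  Finset.dvd_prod_of_mem _ (Finset.mem_univ i)

theorem eval_zero_lineProduct : eval 0 lineProduct = 0 :=
  eval_lineProduct_eq_zero_iff.mpr ⟨0, dotProduct_zero _⟩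

theorem not_linearForm_pow_three_dvd (i : Fin 21) :
    ¬ linearForm (reflForm i) ^ 3 ∣ lineProduct ^ 2 := by
  rw [lineProduct, ← Finset.mul_prod_erase _ _ (Finset.mem_univ i), mul_pow, pow_succ,
    mul_dvd_mul_iff_left (pow_ne_zero 2 (prime_linearForm i).ne_zero)]
  intro h
  obtain ⟨j, hj, h1⟩ := (prime_linearForm i).exists_mem_finset_dvd
    ((prime_linearForm i).dvd_of_dvd_pow h)
  exact not_linearForm_dvd (Finset.ne_of_mem_erase hj).symm h1

theorem emultiplicity_linearForm_mul_lineProduct_sq {c : ℂ} (hc : c ≠ 0) {a : Fin 3 → ℂ}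
    (ha : IsReflectionForm a) : emultiplicity (linearForm a) (C c * lineProduct ^ 2) = 2 := by
  obtain ⟨i, s, hs, rfl⟩ := isReflectionForm_iff.mp ha
  rw [linearForm_smul]
  refine emultiplicity_eq_of_dvd_of_not_dvd (k := 2) ?_ ?_
  · rw [mul_pow, ((isUnit_C hs).pow 2).mul_left_dvd, (isUnit_C hc).dvd_mul_left]
    exact pow_dvd_pow_of_dvd (linearForm_dvd_lineProduct i) 2
  · rw [mul_pow, ((isUnit_C hs).pow _).mul_left_dvd, (isUnit_C hc).dvd_mul_left]
    exact not_linearForm_pow_three_dvd i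

theorem isDoublyCritical_of_isLift_mapH {f : CP2 → CP2} (h : IsLift 15 mapH f) :
    IsDoublyCriticalAtReflectionLines f := by
  obtain ⟨c, hc, hJ⟩ := jacobianDet_mapH
  refine ⟨15, mapH, h, ?_, ?_⟩
  · rw [zeroSet_eq_iff (isHomogeneous_jacobianDet isHomogeneous_mapH)]
    intro v _
    rw [← eval_lineProduct_eq_zero_iff, hJ, map_mul, eval_C, map_pow]
    simp [hc]
  · intro a ha
    rw [hJ]
    exact emultiplicity_linearForm_mul_lineProduct_sq hc ha

/-- A polynomial that vanishes exactly on the reflection lines, to the second order, is a multiple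
of the square of the product of the lines. -/
theorem eq_C_mul_lineProduct_sq {p : Poly3}
    (hp : ∀ v : Fin 3 → ℂ, v ≠ 0 → (eval v p = 0 ↔ ∃ i, reflForm i ⬝ᵥ v = 0))
    (hm : ∀ i, emultiplicity (linearForm (reflForm i)) p = 2) :
    ∃ c : ℂ, c ≠ 0 ∧ p = C c * lineProduct ^ 2 := by
  have h2 (i : Fin 21) : linearForm (reflForm i) ^ 2 ∣ p :=
    pow_dvd_of_le_emultiplicity (hm i).ge
  have h3 (i : Fin 21) : ¬ linearForm (reflForm i) ^ 3 ∣ p := by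
    intro h
    have h4 := le_emultiplicity_of_pow_dvd h
    rw [hm i] at h4
    exact absurd h4 (by decide)
  obtain ⟨q, rfl⟩ := lineProduct_pow_dvd 2 h2
  have hq0 : q ≠ 0 := by
    rintro rfl
    exact h3 0 (by simp)
  have hq (i : Fin 21) : ¬ linearForm (reflForm i) ∣ q := fun h => h3 i (by
    rw [pow_succ]
    exact mul_dvd_mul (pow_dvd_pow_of_dvd (linearForm_dvd_lineProduct i) 2) h)
  -- An irreducible factor r of q vanishes only on reflection lines. By the Nullstellensatz r
  -- divides a power of L, so r is one of the linear forms, which would then have multiplicity at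
  -- least 3.
  have hunit : IsUnit q := by
    by_contra hq1
    obtain ⟨r, hr, hrq⟩ := WfDvdMonoid.exists_irreducible_factor hq1 hq0
    have h4 : lineProduct ∈ (Ideal.span {r}).radical := by
      rw [← vanishingIdeal_zeroLocus_eq_radical (K := ℂ), mem_vanishingIdeal_iff]
      intro v hv
      have h5 : eval v r = 0 := hv r (Ideal.mem_span_singleton_self r)
      change eval v lineProduct = 0
      by_cases hv0 : v = 0
      · rw [hv0, eval_zero_lineProduct]
      · rw [eval_lineProduct_eq_zero_iff, ← hp v hv0]
        obtain ⟨s, rfl⟩ := hrq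
        simp [h5]
    obtain ⟨n, hn⟩ := h4
    rw [Ideal.mem_span_singleton] at hn
    obtain ⟨i, -, hi⟩ := hr.prime.exists_mem_finset_dvd (hr.prime.dvd_of_dvd_pow hn)
    exact hq i ((hr.associated_of_dvd (prime_linearForm i).irreducible hi).symm.dvd.trans hrq)
  obtain ⟨c, hc, rfl⟩ := isUnit_iff_eq_C_of_isReduced.mp hunit
  exact ⟨c, hc.ne_zero, mul_comm _ _⟩

/-! ### Uniqueness -/

/-- Without a zero, p would be constant on affine lines in the plane y₂ = 0, so p(2e + f) = p(e +
f/2). Homogeneity multiplies the right side by 2^n, forcing 2^n = 1. -/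
theorem exists_eval_eq_zero {p : Poly3} {n : ℕ} (hn : n ≠ 0) (hp : p.IsHomogeneous n) :
    ∃ v : Fin 3 → ℂ, v ≠ 0 ∧ v 1 = 0 ∧ eval v p = 0 := by
  by_contra! h
  have hval {x y : Fin 3 → ℂ} (hx : x 1 = 0) (hy : y 1 = 0)
      (hxy : ∀ t : ℂ, x + t • y ≠ 0) (t : ℂ) : eval (x + t • y) p = eval x p := by
    have hdeg : (restrictLine x y p).degree = 0 := by
      by_contra hdeg
      obtain ⟨t, ht⟩ := IsAlgClosed.exists_root _ hdeg
      rw [Polynomial.IsRoot, eval_restrictLine] at ht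
      exact h _ (hxy t) (by simp [hx, hy]) ht
    have h1 := eval_restrictLine x y p t
    have h2 := eval_restrictLine x y p 0
    rw [Polynomial.eq_C_of_degree_eq_zero hdeg, Polynomial.eval_C] at h1 h2
    rw [← h1, h2, zero_smul, add_zero]
  set e : Fin 3 → ℂ := Pi.single 0 1 with he
  set f : Fin 3 → ℂ := Pi.single 2 1 with hf
  have hef (t : ℂ) : e + t • f ≠ 0 := fun h0 => by
    have := congrFun h0 0
    simp [he, hf] at this
  have hfe (t : ℂ) : f + t • e ≠ 0 := fun h0 => by
    have := congrFun h0 2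
    simp [he, hf] at this
  have he1 : e 1 = 0 := by simp [he]
  have hf1 : f 1 = 0 := by simp [hf]
  have he0 := h e (by simp [he]) he1
  have h1 := hval he1 hf1 hef
  have h2 := hval hf1 he1 hfe
  have h3 : eval f p = eval e p := by
    rw [← h2 1, ← h1 1, one_smul, one_smul, add_comm]
  have h4 : (2 : ℂ) ^ n * eval e p = eval e p := by
    have h5 : (2 : ℂ) • (e + (1 / 2 : ℂ) • f) = f + (2 : ℂ) • e := by module
    have h6 := eval_smul_of_isHomogeneous hp 2 (e + (1 / 2 : ℂ) • f)
    rw [h5, h2, h3, h1] at h6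
    exact h6.symm
  have h5 : (2 : ℂ) ^ n = 1 := mul_right_cancel₀ he0 (h4.trans (one_mul _).symm)
  have h6 : (2 : ℕ) ^ n = 1 := by exact_mod_cast h5
  exact hn (by simpa using h6)

/-- An equivariant map of odd degree commutes with the linear group. -/
theorem IsLift.linearGroup_le_commutant {n : ℕ} (hn : Odd n) {P : Fin 3 → Poly3} {f : CP2 → CP2}
    (h : IsLift n P f) (hf : IsEquivariant f) : linearGroup ≤ commutant P := by
  have h0 : refl 0 ∈ commutant P := by
    obtain ⟨c, hc⟩ := h.exists_evalMap_mulVec hf (refl_mem 0)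
    -- At such a point both v and P(v) are -1 eigenvectors of `refl 0`; as n is odd, the scalar c
    -- must be 1.
    obtain ⟨v, hv, hv1, hPv⟩ := exists_eval_eq_zero hn.pos.ne' (h.1 1)
    have h1 : (refl 0).1 *ᵥ v = (-1 : ℂ) • v := by
      rw [refl_zero_mulVec]
      funext j
      fin_cases j <;> simp [hv1]
    have h2 := hc v
    rw [h1, evalMap_smul h.1, hn.neg_one_pow, refl_zero_mulVec] at h2
    have h3 : (refl 0).1 *ᵥ evalMap P v = (-1 : ℂ) • evalMap P v := by
      rw [refl_zero_mulVec]
      have h4 : evalMap P v 1 = 0 := hPv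
      funext j
      fin_cases j <;> simp [h4]
    rw [← refl_zero_mulVec, h3, smul_smul] at h2
    have h5 := smul_left_injective ℂ (h.evalMap_ne_zero hv) h2
    have h6 : c = 1 := by linear_combination h5
    rw [h6] at hc
    exact mem_commutant.mpr fun v => by rw [hc, one_smul]
  -- Conjugating by k preserves commutation with P, since the unknown scalar of k occurs on both
  -- sides.
  have hi (i : Fin 21) : refl i ∈ commutant P := by
    obtain ⟨k, hk, -, -, h1, -⟩ := exists_conj_refl i
    obtain ⟨c, hc⟩ := h.exists_evalMap_mulVec hf hk
    have h2 (u : Fin 3 → ℂ) : (refl i).1 *ᵥ (k.1 *ᵥ u) = k.1 *ᵥ ((refl 0).1 *ᵥ u) := by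
      rw [Matrix.mulVec_mulVec, Matrix.mulVec_mulVec, ← Units.val_mul, ← Units.val_mul, h1]
    rw [mem_commutant]
    intro v
    obtain ⟨u, rfl⟩ : ∃ u, v = k.1 *ᵥ u :=
      ⟨(k⁻¹).1 *ᵥ v, by rw [Matrix.mulVec_mulVec, Units.mul_inv, Matrix.one_mulVec]⟩
    rw [h2, hc, hc, mem_commutant.mp h0, Matrix.mulVec_smul, h2]
  refine linearGroup_le_closure_refl.trans ((Subgroup.closure_le _).mpr ?_)
  rintro _ ⟨i, rfl⟩
  exact hi i

theorem X_dvd_of_lineProduct_dvd {n : ℕ} {p : Poly3} (h : lineProduct ^ n ∣ p) : X 1 ^ n ∣ p := by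
  have h1 : linearForm (reflForm 0) = C (2 * Real.sqrt 3 * (1 - theta) : ℂ) * X 1 := by
    rw [reflForm_zero, linearForm_smul, linearForm_single]
  have h2 : X 1 ∣ linearForm (reflForm 0) := by
    rw [h1]
    exact dvd_mul_left _ _
  exact (pow_dvd_pow_of_dvd (h2.trans (linearForm_dvd_lineProduct 0)) n).trans h

theorem exists_eval_lineProduct_ne_zero : ∃ v : Fin 3 → ℂ, eval v lineProduct ≠ 0 := by
  by_contra! h
  exact lineProduct_ne_zero (MvPolynomial.funext fun v => by rw [h v, map_zero])

/-- Take t = -s with s an eigenvalue of B⁻¹ A. -/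
theorem exists_det_add_smul_eq_zero (A : Matrix (Fin 3) (Fin 3) ℂ) {B : Matrix (Fin 3) (Fin 3) ℂ}
    (hB : B.det ≠ 0) : ∃ t : ℂ, (A + t • B).det = 0 := by
  obtain ⟨s, hs⟩ := IsAlgClosed.exists_root (B⁻¹ * A).charpoly (by
    rw [Matrix.charpoly_degree_eq_dim]
    decide)
  rw [Polynomial.IsRoot, Matrix.eval_charpoly] at hs
  refine ⟨-s, ?_⟩
  have h1 : A + (-s) • B = -(B * (Matrix.scalar (Fin 3) s - B⁻¹ * A)) := by
    rw [mul_sub, ← mul_assoc, Matrix.mul_nonsing_inv _ (isUnit_iff_ne_zero.mpr hB), one_mul,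
      Matrix.scalar_apply, ← Matrix.smul_one_eq_diagonal, Matrix.mul_smul, mul_one]
    module
  rw [h1, Matrix.det_neg, Matrix.det_mul, hs, mul_zero, mul_zero]

/-- A lift with the properties of `h` is a multiple of `h`. -/
theorem exists_evalMap_eq_smul_evalMap_mapH {P : Fin 3 → Poly3} {f : CP2 → CP2}
    (h : IsLift 15 P f) (hG : linearGroup ≤ commutant P) (hJ : lineProduct ^ 2 ∣ jacobianDet P) :
    ∃ c : ℂ, ∀ v, evalMap P v = c • evalMap mapH v := by
  have hP1 : X 1 ^ 3 ∣ P 1 :=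
    X_pow_dvd_of_dvd_jacobianDet (by decide) h.1 hG
      ⟨Pi.single 0 1, by simp, h.evalMap_ne_zero (by simp)⟩ (X_dvd_of_lineProduct_dvd hJ)
  obtain ⟨v, hv⟩ := exists_eval_lineProduct_ne_zero
  obtain ⟨c, hc, hH⟩ := jacobianDet_mapH
  -- At a point v off the lines J(H) is invertible, so some P + tH has singular Jacobian there. Its
  -- Jacobian determinant is a multiple of L² and L(v) ≠ 0, so it is identically zero.
  obtain ⟨t, ht⟩ := exists_det_add_smul_eq_zero
    ((jacobian P).map (eval v)) (B := (jacobian mapH).map (eval v)) (by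
      rw [← eval_det, ← jacobianDet_eq, hH, map_mul, eval_C, map_pow]
      exact mul_ne_zero hc (pow_ne_zero 2 hv))
  set R : Fin 3 → Poly3 := fun i => P i + C t * mapH i with hR
  have hRh (i : Fin 3) : (R i).IsHomogeneous 15 := by
    refine (h.1 i).add ?_
    rw [← zero_add 15]
    exact (isHomogeneous_C _ _).mul (isHomogeneous_mapH i)
  have hRG : linearGroup ≤ commutant R := fun g hg =>
    commutant_add_smul t (hG hg) (linearGroup_le_commutant_mapH hg)
  have hR1 : X 1 ^ 3 ∣ R 1 := dvd_add hP1 (X_pow_three_dvd_mapH.mul_left _)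
  obtain ⟨d, hd⟩ := eq_C_mul_of_dvd_of_isHomogeneous (isHomogeneous_jacobianDet hRh)
    (isHomogeneous_lineProduct.pow 2) (pow_ne_zero 2 lineProduct_ne_zero)
    (lineProduct_sq_dvd_jacobianDet hRG hR1)
  have h1 : eval v (jacobianDet R) = 0 := by
    rw [jacobianDet_eq, eval_det, ← ht]
    congr 1
    ext1 i j
    simp [jacobian, hR]
  rw [hd, map_mul, eval_C, map_pow] at h1
  have h2 : d = 0 := (mul_eq_zero.mp h1).resolve_right (pow_ne_zero 2 hv)
  rw [h2, C_0, zero_mul] at hd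
  have h3 := eq_zero_of_jacobianDet_eq_zero (by decide) (by decide) hRh hRG hd
  refine ⟨-t, fun w => funext fun i => ?_⟩
  have h4 := congrArg (eval w) (h3 i)
  simp only [hR, map_add, map_mul, eval_C, map_zero] at h4
  simp only [evalMap, Pi.smul_apply, smul_eq_mul]
  linear_combination h4

theorem exists_isLift_fifteen {f : CP2 → CP2} (hf : IsDoublyCriticalAtReflectionLines f) :
    ∃ P, IsLift 15 P f ∧ lineProduct ^ 2 ∣ jacobianDet P := by
  obtain ⟨n, P, h, hzero, hmult⟩ := hf
  have hJ := isHomogeneous_jacobianDet h.1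
  obtain ⟨c, hc, hP⟩ := eq_C_mul_lineProduct_sq ((zeroSet_eq_iff hJ).mp hzero) fun i =>
    hmult _ (isReflectionForm_iff.mpr ⟨i, 1, one_ne_zero, (one_smul _ _).symm⟩)
  have h1 : (C c * lineProduct ^ 2).IsHomogeneous (0 + 21 * 2) :=
    (isHomogeneous_C _ _).mul (isHomogeneous_lineProduct.pow 2)
  have hne : jacobianDet P ≠ 0 := by
    rw [hP]
    exact mul_ne_zero (isUnit_C hc).ne_zero (pow_ne_zero 2 lineProduct_ne_zero)
  rw [← hP] at h1
  have h2 := hJ.inj_right h1 hne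
  -- From 3(n - 1) = 42; truncated subtraction does no harm, since n = 0 would give 0.
  obtain rfl : n = 15 := by omega
  exact ⟨P, h, by rw [hP]; exact dvd_mul_left _ _⟩

end KleinHeptic

theorem mainTheorem1 :
    KleinHeptic.reflectionLines.ncard = 21 ∧
    ∃ h : KleinHeptic.CP2 → KleinHeptic.CP2,
      KleinHeptic.IsLift 15 KleinHeptic.mapH h ∧
      ∀ f : KleinHeptic.CP2 → KleinHeptic.CP2,
        (KleinHeptic.IsHolomorphicMap f ∧ KleinHeptic.IsEquivariant f ∧
          KleinHeptic.IsDoublyCriticalAtReflectionLines f) ↔ f = h := by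
  obtain ⟨h, hh⟩ := KleinHeptic.exists_isLift KleinHeptic.isHomogeneous_mapH
    fun _ => KleinHeptic.eq_zero_of_evalMap_mapH
  refine ⟨KleinHeptic.reflectionLines_ncard, h, hh, fun f => ⟨?_, ?_⟩⟩
  · rintro ⟨-, hf, hcrit⟩
    obtain ⟨P, hP, hJ⟩ := KleinHeptic.exists_isLift_fifteen hcrit
    obtain ⟨c, hc⟩ := KleinHeptic.exists_evalMap_eq_smul_evalMap_mapH hP
      (hP.linearGroup_le_commutant (by decide) hf) hJ
    exact hP.eq_of_evalMap_eq_smul hh c hc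
  · rintro rfl
    exact ⟨⟨15, _, hh⟩, hh.isEquivariant KleinHeptic.linearGroup_le_commutant_mapH,
      KleinHeptic.isDoublyCritical_of_isLift_mapH hh⟩
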